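/- Let $Q\in C^1([0,\infty))$, $Q\ge 0$, and let $C_1,C_2,F_0>0$ and $\mu_1,\mu_2,\mu_3\in(0,1)$ be constants such that (Q1) $Q(s)\ge C_1 s^{1+1/\mu_1}$ for $s\ge F_0$; (Q2) $Q(s)\le C_2 s^{1+1/\mu_2}$ for $0\le s\le F_0$; (Q3) $Q(\lambda s)\ge \lambda^{1+1/\mu_3}Q(s)$ for $s\ge 0$, $0\le\lambda\le 1$; (Q4) $Q''(s)>0$ for $s>0$, and $Q'(0)=0$. For measurable $f=f(x,v)$, $x,v\in\mathbb R^2$, put $\rho_f(x)=\int f(x,v)\,dv$, $$P(f)=\frac12\iint |v|^2 f\,dv\,dx+\iint Q(f)\,dv\,dx,\qquad E_{\rm pot}(f)=-\frac12\iint\frac{\rho_f(x)\rho_f(y)}{|x-y|}\,dx\,dy,\qquad D(f)=P(f)+E_{\rm pot}(f).$$ For $M>0$ let $F_M^S$ be the set of all $f\in L^1(\mathbb R^4)$ with $f\ge 0$, $\iint f\,dv\,dx=M$, $P(f)<\infty$ and $f(Ax,Av)=f(x,v)$ for all $A\in SO(2)$, and let $D_M^S=\inf\{D(f): f\in F_M^S\}$.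 Then $E_{\rm pot}$ is given by an absolutely convergent integral on $F_M^S$, and $-\infty<D_M^S<0$. There is a constant $C_\alpha<0$ such that, with $\alpha=1/(1-\mu_3)$, $(1-t)^{1+\alpha}+t^{1+\alpha}-1\le C_\alpha(1-t)t$ for $0\le t\le 1$; and for every such $C_\alpha$ there is a constant $C_M>0$ such that for all $f\in F_M^S$ and $R>0$ $$D(f)-D_M^S\ \ge\ \Bigl(\frac{C_\alpha D_M^S}{M^2}\int_{|x|<R}\int f\,dv\,dx-\frac{C_M}{\sqrt R}\Bigr)\int_{|x|>R}\int f\,dv\,dx .\qquad(*)$$ For any constants $C_\alpha<0$, $C_M>0$ for which $(*)$ holds for all $f\in F_M^S$ and $R>0$, put $$R_M=\Bigl(\frac{2MC_M}{C_\alpha D_M^S}\Bigr)^2 .$$ Let $(f_n)\subset F_M^S$ be a minimizing sequence of $D$, i.e. $D(f_n)\to D_M^S$. Then there are $f_0\in F_M^S$ and a subsequence $(f_{n_k})$ such that $f_0$ minimizes $D$ over $F_M^S$, i.e. $D(f_0)=D_M^S$; $f_0$ vanishes a.e. outside $B_{R_M}\times\mathbb R^2$, where $B_{R_M}\subset\mathbb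 R^2$ is the disc of radius $R_M$ about $0$; $f_{n_k}\rightharpoonup f_0$ weakly in $L^{1+1/\mu_1}(\mathbb R^4)$; and $E_{\rm pot}(f_{n_k}-f_0)\to 0$, these energies being given by absolutely convergent integrals. -/

import Mathlib

open MeasureTheory Filter Topology

noncomputable section

namespace FlatVP

/-- The plane `ℝ²` with its Euclidean norm. -/
abbrev Plane : Type := EuclideanSpace ℝ (Fin 2)

/-- Phase space `ℝ² × ℝ²` of points `(x, v)`, with Lebesgue measure as `volume`. -/
abbrev Phase : Type := Plane × Plane

/-- The assumptions `Q ∈ C¹([0,∞))`, `Q ≥ 0` and (Q1)-(Q4) on the Casimir function `Q`.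
Only the values of `Q` on `[0,∞)` matter. In `Q4_pos`, positivity of the derivative of `Q'` at `s`
includes that `Q'` is differentiable at `s`. -/
structure CasimirAssumptions (Q : ℝ → ℝ) (C₁ C₂ F₀ μ₁ μ₂ μ₃ : ℝ) : Prop where
  C₁_pos : 0 < C₁
  C₂_pos : 0 < C₂
  F₀_pos : 0 < F₀
  μ₁_mem : μ₁ ∈ Set.Ioo (0 : ℝ) 1
  μ₂_mem : μ₂ ∈ Set.Ioo (0 : ℝ) 1
  μ₃_mem : μ₃ ∈ Set.Ioo (0 : ℝ) 1
  contDiffOn : ContDiffOn ℝ 1 Q (Set.Ici 0)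
  nonneg : ∀ s, 0 ≤ s → 0 ≤ Q s
  Q1 : ∀ s, F₀ ≤ s → C₁ * s ^ (1 + 1 / μ₁) ≤ Q s
  Q2 : ∀ s, 0 ≤ s → s ≤ F₀ → Q s ≤ C₂ * s ^ (1 + 1 / μ₂)
  Q3 : ∀ s t, 0 ≤ s → 0 ≤ t → t ≤ 1 → t ^ (1 + 1 / μ₃) * Q s ≤ Q (t * s)
  Q4_pos : ∀ s, 0 < s → 0 < deriv (deriv Q) s
  Q4_zero : derivWithin Q (Set.Ici 0) 0 = 0

/-- The spatial density `ρ_f(x) = ∫ f(x,v) dv`. -/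
def rho (f : Phase → ℝ) (x : Plane) : ℝ := ∫ v : Plane, f (x, v)

/-- The potential `U_ρ = - (1/|·|) ∗ ρ` on the plane. -/
def potential (ρ : Plane → ℝ) (x : Plane) : ℝ := -∫ y : Plane, ρ y / ‖x - y‖

/-- The kinetic energy `½ ∬ |v|² f dv dx`. -/
def Ekin (f : Phase → ℝ) : ℝ := (1 / 2) * ∫ z : Phase, ‖z.2‖ ^ 2 * f z

/-- The potential energy `½ ∫ ρ_f U_f dx`. -/
def Epot (f : Phase → ℝ) : ℝ := (1 / 2) * ∫ x : Plane, rho f x * potential (rho f) x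

/-- Absolute convergence of `∬ ρ_f(x) ρ_f(y) / |x - y| dx dy`, i.e. the potential energy of `f` is
well defined. -/
def EpotFinite (f : Phase → ℝ) : Prop :=
  Integrable (fun p : Plane × Plane => rho f p.1 * rho f p.2 / ‖p.1 - p.2‖)

/-- The Casimir functional `∬ Q(f) dv dx`. -/
def casimir (Q : ℝ → ℝ) (f : Phase → ℝ) : ℝ := ∫ z : Phase, Q (f z)

/-- The positive part `P(f) = E_kin(f) + C(f)` of the energy-Casimir functional. -/
def posPart (Q : ℝ → ℝ) (f : Phase → ℝ) : ℝ := Ekin f + casimir Q f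

/-- The energy-Casimir functional `D(f) = P(f) + E_pot(f)`. -/
def energyCasimir (Q : ℝ → ℝ) (f : Phase → ℝ) : ℝ := posPart Q f + Epot f

/-- The set `F_M` of (representatives of) `f ∈ L¹(ℝ⁴)` with `f ≥ 0`, mass `M` and `P(f) < ∞`.
Both terms of `P(f)` are integrals of nonnegative measurable functions, so `P(f) < ∞` is
integrability of the two integrands. -/
def massClass (Q : ℝ → ℝ) (M : ℝ) : Set (Phase → ℝ) :=
  {f | Integrable f ∧ (∀ᵐ z : Phase, 0 ≤ f z) ∧ ∫ z : Phase, f z = M ∧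
    Integrable (fun z : Phase => ‖z.2‖ ^ 2 * f z) ∧ Integrable (fun z : Phase => Q (f z))}

/-- The action of a `2 × 2` matrix on the plane. -/
def act (A : Matrix (Fin 2) (Fin 2) ℝ) (x : Plane) : Plane := WithLp.toLp 2 (A.mulVec x.ofLp)

/-- Axial symmetry: `f(Ax, Av) = f(x, v)` for all `A ∈ SO(2)`, as an identity in `L¹`. -/
def AxiallySymmetric (f : Phase → ℝ) : Prop :=
  ∀ A ∈ Matrix.specialOrthogonalGroup (Fin 2) ℝ, ∀ᵐ z : Phase, f (act A z.1, act A z.2) = f z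

/-- The set `F_M^S` of axially symmetric elements of `F_M`. -/
def symMassClass (Q : ℝ → ℝ) (M : ℝ) : Set (Phase → ℝ) :=
  {f | f ∈ massClass Q M ∧ AxiallySymmetric f}

/-- The infimum `D_M^S` of `D` over `F_M^S`. -/
def symInf (Q : ℝ → ℝ) (M : ℝ) : ℝ := sInf (energyCasimir Q '' symMassClass Q M)

/-- `(f_n) ⊂ F_M^S` is a minimizing sequence of `D`. -/
def IsMinimizingSeq (Q : ℝ → ℝ) (M : ℝ) (f : ℕ → Phase → ℝ) : Prop :=
  (∀ n, f n ∈ symMassClass Q M) ∧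
    Tendsto (fun n => energyCasimir Q (f n)) atTop (𝓝 (symInf Q M))

/-- `Cα < 0` satisfies `(1-x)^(1+α) + x^(1+α) - 1 ≤ Cα (1-x) x` on `[0,1]`, where
`α = 1/(1-μ₃)`. -/
def IsAlphaConstant (μ₃ Cα : ℝ) : Prop :=
  Cα < 0 ∧ ∀ x ∈ Set.Icc (0 : ℝ) 1,
    (1 - x) ^ (1 + 1 / (1 - μ₃)) + x ^ (1 + 1 / (1 - μ₃)) - 1 ≤ Cα * (1 - x) * x

/-- `Cα < 0` and `CM > 0` are constants in the splitting estimate on `F_M^S`, which compares the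
mass inside and outside of the disc of radius `R`. -/
def AreSplittingConstants (Q : ℝ → ℝ) (M Cα CM : ℝ) : Prop :=
  Cα < 0 ∧ 0 < CM ∧ ∀ f ∈ symMassClass Q M, ∀ R : ℝ, 0 < R →
    (Cα * symInf Q M / M ^ 2 * (∫ x in {x : Plane | ‖x‖ < R}, rho f x) - CM / √R) *
        (∫ x in {x : Plane | R < ‖x‖}, rho f x) ≤
      energyCasimir Q f - symInf Q M

/-- The radius `R_M = (2 M C_M / (C_α D_M^S))²`. -/
def radius (Q : ℝ → ℝ) (M Cα CM : ℝ) : ℝ := (2 * M * CM / (Cα * symInf Q M)) ^ 2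

/-- Weak convergence in `L^p(ℝ⁴)`, `1 < p < ∞`: all functions are in `L^p`, and the integrals
against every element of the dual space `L^{p'}`, `p' = p/(p-1)`, converge. -/
def WeakTendstoLp (p : ℝ) (u : ℕ → Phase → ℝ) (u₀ : Phase → ℝ) : Prop :=
  (∀ k, MemLp (u k) (ENNReal.ofReal p)) ∧ MemLp u₀ (ENNReal.ofReal p) ∧
    ∀ g : Phase → ℝ, MemLp g (ENNReal.ofReal p.conjExponent) →
      Tendsto (fun k => ∫ z : Phase, u k z * g z) atTop (𝓝 (∫ z : Phase, u₀ z * g z))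

end FlatVP

end

/-!
The proof is the concentration-compactness argument for symmetric steady states of the flat
Vlasov-Poisson system, in an `L²`-`L^{3/2}` setting. As `1 + 1/μ₁ > 2`, the bound `Q1` controls
`∬ f²` by an arbitrarily small multiple of `∬ Q(f)` plus a multiple of the mass. Interpolation with the
kinetic energy then bounds `∫ ρ_f^{3/2}` by an arbitrarily small multiple of `P(f)` plus a constant
(`CasimirAssumptions.exists_isDensity`). Young's inequality turns such bounds into a weak
Hardy-Littlewood-Sobolev inequality for kernels whose power `3/2` is integrable. Applied to the
singular part `1/|x| - 1/max(|x|, r)` of the Coulomb kernel it yields absolute convergence of the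
potential energy, `P ≤ 2 D + C`, and a contribution of the singular part that tends to zero with
`r`, uniformly on sets where `P` is bounded. The infimum is negative, because on widely spread
plateaus of small height `Q2` makes the Casimir term negligible against the potential energy.

For the splitting estimate, `f` is cut at the radius `R`. The positive part `P` is additive. Each
piece is bounded below by rescaling it to mass `M`, where `Q3` gives the factor `(m/M)^{1+α}`
(`CasimirAssumptions.rpow_mul_symInf_le`), and the assumed inequality for `C_α` compares the sum
with `D_M^S`. The mixed potential energy is `O(R^{-1/2})` times the outer mass, by a bound on the
potential of a radial density outside of its support: averaging the Coulomb kernel over rotations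
leaves a singularity that is mild enough to be integrated against a density in `L^{3/2}`
(`IsDensity.lintegral_potential_le`). For densities with large `P` the estimate follows from
`P ≤ 2 D + C` instead.

Let now `f_n` be a minimizing sequence. It is bounded in `L²`, so a subsequence converges weakly to
some `f₀`. Beyond `R_M`, the splitting estimate makes the outer mass of `f_n` tend to zero: more
than half of the mass cannot be outside, since by continuity some larger radius would then halve the
mass, and there the estimate leaves a fixed excess of energy. With the bound on the velocities, no
mass is lost, and `f₀` has mass `M` and is supported in the disc of radius `R_M`. Preservation of
mass improves weak `L²` convergence to convergence against bounded functions
(`WeakTendstoL2.tendsto_bounded`), which gives weak convergence in `L^{1+1/μ₁}`, and weak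
convergence of the spatial densities as measures. Hence the energies for the truncated kernels
`1/max(|x - y|, r)` converge, and so do the potential energies, the singular parts being uniformly
small (`tendsto_interaction`). Finally `P` is weakly lower semicontinuous by convexity
(`CasimirAssumptions.posPart_le_of_weak`), so that `f₀` is a minimizer.
-/

noncomputable section

namespace FlatVP

/-! ### The Coulomb kernel on the plane and the bilinear potential energy -/

/-- Nonnegative densities on the plane with mass at most `M` and `∫ ρ^{3/2} ≤ S`. -/
structure IsDensity (ρ : Plane → ℝ) (M S : ℝ) : Prop where
  integrable : Integrable ρ
  nonneg : ∀ᵐ x, 0 ≤ ρ x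
  mass_le : ∫ x, ρ x ≤ M
  integrable_rpow : Integrable (fun x => ρ x ^ (3 / 2 : ℝ))
  rpow_le : ∫ x, ρ x ^ (3 / 2 : ℝ) ≤ S

lemma IsDensity.mono {ρ : Plane → ℝ} {M S M' S' : ℝ} (h : IsDensity ρ M S) (hM : M ≤ M')
    (hS : S ≤ S') : IsDensity ρ M' S' :=
  ⟨h.integrable, h.nonneg, h.mass_le.trans hM, h.integrable_rpow, h.rpow_le.trans hS⟩

lemma IsDensity.rpow_nonneg {ρ : Plane → ℝ} {M S : ℝ} (h : IsDensity ρ M S) :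
    0 ≤ ∫ x, ρ x ^ (3 / 2 : ℝ) :=
  integral_nonneg_of_ae (h.nonneg.mono fun _ hx => Real.rpow_nonneg hx _)

lemma IsDensity.S_nonneg {ρ : Plane → ℝ} {M S : ℝ} (h : IsDensity ρ M S) : 0 ≤ S :=
  h.rpow_nonneg.trans h.rpow_le

lemma IsDensity.M_nonneg {ρ : Plane → ℝ} {M S : ℝ} (h : IsDensity ρ M S) : 0 ≤ M :=
  (integral_nonneg_of_ae h.nonneg).trans h.mass_le

lemma sqrt_mul_le {a b τ : ℝ} (ha : 0 ≤ a) (hb : 0 ≤ b) (hτ : 0 < τ) :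
    a ^ (1 / 2 : ℝ) * b ≤ τ * a ^ (3 / 2 : ℝ) + τ ^ (-(1 / 2) : ℝ) * b ^ (3 / 2 : ℝ) := by
  have h1 : 0 ≤ τ * a ^ (3 / 2 : ℝ) := by positivity
  have h2 : 0 ≤ τ ^ (-(1 / 2) : ℝ) * b ^ (3 / 2 : ℝ) := by positivity
  rcases le_total b (τ * a) with h | h
  · have : a ^ (1 / 2 : ℝ) * b ≤ a ^ (1 / 2 : ℝ) * (τ * a) := by gcongr
    have e : a ^ (3 / 2 : ℝ) = a ^ (1 / 2 : ℝ) * a := by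
      rw [← Real.rpow_add_one' ha (by norm_num)]; norm_num
    rw [e] at h1 ⊢
    nlinarith
  · have h3 : a ≤ τ⁻¹ * b := by
      rw [inv_mul_eq_div, le_div_iff₀ hτ]; linarith
    have : a ^ (1 / 2 : ℝ) * b ≤ (τ⁻¹ * b) ^ (1 / 2 : ℝ) * b := by gcongr
    have e : (τ⁻¹ * b) ^ (1 / 2 : ℝ) * b = τ ^ (-(1 / 2) : ℝ) * b ^ (3 / 2 : ℝ) := by
      rw [Real.mul_rpow (by positivity) hb, Real.inv_rpow hτ.le, Real.rpow_neg hτ.le, mul_assoc,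
        ← Real.rpow_add_one' hb (by norm_num)]
      norm_num
    linarith

lemma mul_le_rpow_add {a b : ℝ} (ha : 0 ≤ a) (hb : 0 ≤ b) :
    a * b ≤ a ^ (3 / 2 : ℝ) * b ^ (1 / 2 : ℝ) + b ^ (3 / 2 : ℝ) * a ^ (1 / 2 : ℝ) := by
  have key : ∀ {a b : ℝ}, 0 ≤ a → 0 ≤ b → a ≤ b → a * b ≤ b ^ (3 / 2 : ℝ) * a ^ (1 / 2 : ℝ) := by
    intro a b ha hb h
    have e1 : b ^ (3 / 2 : ℝ) = b * b ^ (1 / 2 : ℝ) := by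
      rw [mul_comm, ← Real.rpow_add_one' hb (by norm_num)]; norm_num
    have e2 : a = a ^ (1 / 2 : ℝ) * a ^ (1 / 2 : ℝ) := by
      rw [← Real.rpow_add' ha (by norm_num)]; norm_num
    have h3 : a ^ (1 / 2 : ℝ) ≤ b ^ (1 / 2 : ℝ) := by gcongr
    calc a * b = (a ^ (1 / 2 : ℝ) * a ^ (1 / 2 : ℝ)) * b := by rw [← e2]
      _ ≤ (b ^ (1 / 2 : ℝ) * a ^ (1 / 2 : ℝ)) * b := by gcongr
      _ = _ := by rw [e1]; ring
  rcases le_total a b with h | h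
  · have := key ha hb h
    have : 0 ≤ a ^ (3 / 2 : ℝ) * b ^ (1 / 2 : ℝ) := by positivity
    linarith
  · have := key hb ha h
    have : 0 ≤ b ^ (3 / 2 : ℝ) * a ^ (1 / 2 : ℝ) := by positivity
    linarith

lemma integrable_mul_comp_sub {B K : Plane → ℝ} (hB : Integrable B) (hK : Integrable K) :
    Integrable (fun p : Plane × Plane => B p.2 * K (p.1 - p.2)) ∧
      ∫ p : Plane × Plane, B p.2 * K (p.1 - p.2) = (∫ x, B x) * ∫ x, K x := by
  have mp := measurePreserving_sub_prod (volume : Measure Plane) (volume : Measure Plane)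
  have hi : Integrable (fun p : Plane × Plane => K p.1 * B p.2)
      ((volume : Measure Plane).prod volume) := hK.mul_prod hB
  have hi' := hi
  rw [← mp.map_eq] at hi'
  constructor
  · have := hi'.comp_measurable mp.measurable
    refine this.congr (ae_of_all _ fun p => ?_)
    simp [mul_comm]
  · have := integral_map (mp.measurable.aemeasurable) hi'.aestronglyMeasurable
    rw [mp.map_eq, integral_prod_mul] at this
    rw [mul_comm, this]
    refine integral_congr_ae (ae_of_all _ fun p => ?_)
    simp [mul_comm]

lemma integrable_mul_comp_sub' {B K : Plane → ℝ} (hB : Integrable B) (hK : Integrable K)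
    (hKe : ∀ x, K (-x) = K x) :
    Integrable (fun p : Plane × Plane => B p.1 * K (p.1 - p.2)) ∧
      ∫ p : Plane × Plane, B p.1 * K (p.1 - p.2) = (∫ x, B x) * ∫ x, K x := by
  obtain ⟨h1, h2⟩ := integrable_mul_comp_sub hB hK
  have e : (fun p : Plane × Plane => B p.1 * K (p.1 - p.2))
      = (fun p : Plane × Plane => B p.2 * K (p.1 - p.2)) ∘ Prod.swap := by
    funext p
    simp only [Function.comp, Prod.fst_swap, Prod.snd_swap]
    rw [← hKe (p.1 - p.2), neg_sub]
  rw [e]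
  refine ⟨h1.swap, ?_⟩
  rw [← h2]
  exact integral_prod_swap (μ := (volume : Measure Plane)) (ν := (volume : Measure Plane))
    (fun p : Plane × Plane => B p.2 * K (p.1 - p.2))

/-- A weak form of the Hardy-Littlewood-Sobolev inequality: a singular kernel with `κ^{3/2}`
integrable is controlled by the `L^{3/2}`-norms of the densities. The larger of the values `ρ x`,
`σ y` gets the power `3/2` and the smaller one the power `1/2`. -/
lemma IsDensity.near_bound {ρ σ : Plane → ℝ} {M S : ℝ} (hρ : IsDensity ρ M S)
    (hσ : IsDensity σ M S) {κ : Plane → ℝ} (hκm : Measurable κ) (hκ0 : ∀ x, 0 ≤ κ x)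
    (hκe : ∀ x, κ (-x) = κ x) (hκi : Integrable (fun x => κ x ^ (3 / 2 : ℝ)))
    {τ : ℝ} (hτ : 0 < τ) :
    Integrable (fun p : Plane × Plane => ρ p.1 * σ p.2 * κ (p.1 - p.2)) ∧
      ∫ p : Plane × Plane, ρ p.1 * σ p.2 * κ (p.1 - p.2) ≤
        2 * S * (τ * S + τ ^ (-(1 / 2) : ℝ) * ∫ x, κ x ^ (3 / 2 : ℝ)) := by
  set K : Plane → ℝ := fun x => κ x ^ (3 / 2 : ℝ) with hK
  set A : Plane → ℝ := fun x => ρ x ^ (3 / 2 : ℝ) with hA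
  set B : Plane → ℝ := fun x => σ x ^ (3 / 2 : ℝ) with hB
  set t := τ ^ (-(1 / 2) : ℝ) with ht
  have ht0 : 0 ≤ t := by positivity
  have i1 : Integrable (fun p : Plane × Plane => A p.1 * B p.2) :=
    hρ.integrable_rpow.mul_prod hσ.integrable_rpow
  obtain ⟨i2, e2⟩ : Integrable (fun p : Plane × Plane => B p.2 * K (p.1 - p.2)) ∧
      ∫ p : Plane × Plane, B p.2 * K (p.1 - p.2) = (∫ x, B x) * ∫ x, K x :=
    integrable_mul_comp_sub hσ.integrable_rpow hκi
  obtain ⟨i3, e3⟩ : Integrable (fun p : Plane × Plane => A p.1 * K (p.1 - p.2)) ∧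
      ∫ p : Plane × Plane, A p.1 * K (p.1 - p.2) = (∫ x, A x) * ∫ x, K x :=
    integrable_mul_comp_sub' hρ.integrable_rpow hκi (fun x => by simp only [hK, hκe])
  have e1 : ∫ p : Plane × Plane, A p.1 * B p.2 = (∫ x, A x) * ∫ x, B x := integral_prod_mul _ _
  set G : Plane × Plane → ℝ := fun p => 2 * τ * (A p.1 * B p.2) +
    t * (B p.2 * K (p.1 - p.2)) + t * (A p.1 * K (p.1 - p.2)) with hG
  have i12 : Integrable (fun p : Plane × Plane => 2 * τ * (A p.1 * B p.2) +
      t * (B p.2 * K (p.1 - p.2))) := (i1.const_mul _).add (i2.const_mul _)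
  have iG : Integrable G := i12.add (i3.const_mul _)
  have eG : ∫ p, G p = 2 * τ * ((∫ x, A x) * ∫ x, B x) + t * ((∫ x, B x) * ∫ x, K x)
      + t * ((∫ x, A x) * ∫ x, K x) := by
    rw [hG, integral_add i12 (i3.const_mul _), integral_add (i1.const_mul _) (i2.const_mul _),
      integral_const_mul, integral_const_mul, integral_const_mul, e1, e2, e3]
  have n1 : ∀ᵐ p : Plane × Plane, 0 ≤ ρ p.1 :=
    Measure.quasiMeasurePreserving_fst.ae hρ.nonneg
  have n2 : ∀ᵐ p : Plane × Plane, 0 ≤ σ p.2 :=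
    Measure.quasiMeasurePreserving_snd.ae hσ.nonneg
  have bd : ∀ᵐ p : Plane × Plane, ρ p.1 * σ p.2 * κ (p.1 - p.2) ≤ G p := by
    filter_upwards [n1, n2] with p h1 h2
    have hk := hκ0 (p.1 - p.2)
    have a1 := mul_le_mul_of_nonneg_right (mul_le_rpow_add h1 h2) hk
    have a2 := mul_le_mul_of_nonneg_left (sqrt_mul_le h1 hk hτ)
      (Real.rpow_nonneg h2 (3 / 2 : ℝ))
    have a3 := mul_le_mul_of_nonneg_left (sqrt_mul_le h2 hk hτ)
      (Real.rpow_nonneg h1 (3 / 2 : ℝ))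
    simp only [hG, hA, hB, hK, ht]
    nlinarith
  have ms : AEStronglyMeasurable (fun p : Plane × Plane => ρ p.1 * σ p.2 * κ (p.1 - p.2)) := by
    refine AEStronglyMeasurable.mul ?_ ?_
    · exact hρ.integrable.aestronglyMeasurable.comp_fst.mul
        hσ.integrable.aestronglyMeasurable.comp_snd
    · exact (hκm.comp (measurable_fst.sub measurable_snd)).aestronglyMeasurable
  have iF : Integrable (fun p : Plane × Plane => ρ p.1 * σ p.2 * κ (p.1 - p.2)) := by
    refine iG.mono' ms ?_
    filter_upwards [n1, n2, bd] with p h1 h2 h3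
    rw [Real.norm_of_nonneg (mul_nonneg (mul_nonneg h1 h2) (hκ0 _))]
    exact h3
  refine ⟨iF, (integral_mono_ae iF iG bd).trans ?_⟩
  rw [eG]
  have k0 : 0 ≤ ∫ x, K x := integral_nonneg fun x => Real.rpow_nonneg (hκ0 x) _
  have hA0 := hρ.rpow_nonneg
  have hB0 := hσ.rpow_nonneg
  have hA1 := hρ.rpow_le
  have hB1 := hσ.rpow_le
  have hS := hρ.S_nonneg
  have b1 : (∫ x, A x) * ∫ x, B x ≤ S * S := mul_le_mul hA1 hB1 hB0 hS
  have b2 : (∫ x, B x) * ∫ x, K x ≤ S * ∫ x, K x := by gcongr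
  have b3 : (∫ x, A x) * ∫ x, K x ≤ S * ∫ x, K x := by gcongr
  calc _ ≤ 2 * τ * (S * S) + t * (S * ∫ x, K x) + t * (S * ∫ x, K x) := by gcongr
    _ = _ := by ring

/-- The singular part `|1/|x| - 1/max(|x|,r)|` of the Coulomb kernel. The value `1/r` at the origin
comes from `1/0 = 0` and makes the pointwise splitting below valid without exception. -/
def nearKernel (r : ℝ) (x : Plane) : ℝ := |1 / ‖x‖ - 1 / max ‖x‖ r|

lemma nearKernel_nonneg (r : ℝ) (x : Plane) : 0 ≤ nearKernel r x := abs_nonneg _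

lemma nearKernel_neg (r : ℝ) (x : Plane) : nearKernel r (-x) = nearKernel r x := by
  simp [nearKernel]

lemma measurable_nearKernel (r : ℝ) : Measurable (nearKernel r) := by
  unfold nearKernel
  fun_prop

lemma one_div_norm_le {r : ℝ} (hr : 0 < r) (x : Plane) : 1 / ‖x‖ ≤ nearKernel r x + 1 / r := by
  have h1 : 1 / max ‖x‖ r ≤ 1 / r := one_div_le_one_div_of_le hr (le_max_right _ _)
  have h2 := le_abs_self (1 / ‖x‖ - 1 / max ‖x‖ r)
  unfold nearKernel
  linarith

lemma volume_real_ball (x : Plane) {r : ℝ} (hr : 0 ≤ r) :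
    volume.real (Metric.ball x r) = Real.pi * r ^ 2 := by
  rw [Measure.real, EuclideanSpace.volume_ball_fin_two, ENNReal.toReal_mul, ENNReal.toReal_pow,
    ENNReal.toReal_ofReal hr, mul_comm]
  simp [Real.pi_nonneg]

lemma integrable_near_majorant {r : ℝ} (hr : 0 < r) :
    Integrable (fun x : Plane => (Set.Ioo 0 r).indicator (fun s => s ^ (-(3 / 2) : ℝ)) ‖x‖) ∧
      ∫ x : Plane, (Set.Ioo 0 r).indicator (fun s => s ^ (-(3 / 2) : ℝ)) ‖x‖
        = 4 * Real.pi * r ^ (1 / 2 : ℝ) := by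
  have hc : ∀ y ∈ Set.Ioi (0 : ℝ), y ^ (2 - 1) • (Set.Ioo 0 r).indicator
      (fun s => s ^ (-(3 / 2) : ℝ)) y = (Set.Ioo 0 r).indicator (fun s => s ^ (-(1 / 2) : ℝ)) y := by
    intro y hy
    by_cases h : y ∈ Set.Ioo 0 r
    · simp only [Set.indicator_of_mem h, smul_eq_mul]
      rw [show (2 - 1 : ℕ) = 1 from rfl, pow_one, mul_comm, ← Real.rpow_add_one (ne_of_gt hy)]
      norm_num
    · simp [Set.indicator_of_notMem h]
  have hsub : Set.Ioi (0 : ℝ) ∩ Set.Ioo 0 r = Set.Ioo 0 r :=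
    Set.inter_eq_right.mpr fun y hy => hy.1
  constructor
  · rw [integrable_fun_norm_addHaar, finrank_euclideanSpace_fin]
    refine IntegrableOn.congr_fun ?_ (fun y hy => (hc y hy).symm) measurableSet_Ioi
    rw [IntegrableOn, integrable_indicator_iff measurableSet_Ioo, IntegrableOn,
      Measure.restrict_restrict measurableSet_Ioo, Set.inter_comm, hsub]
    exact (intervalIntegrable_iff_integrableOn_Ioo_of_le hr.le).1
      (intervalIntegral.intervalIntegrable_rpow' (by norm_num))
  · rw [integral_fun_norm_addHaar, finrank_euclideanSpace_fin,
      setIntegral_congr_fun measurableSet_Ioi hc, setIntegral_indicator measurableSet_Ioo, hsub,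
      ← integral_Ioc_eq_integral_Ioo, ← intervalIntegral.integral_of_le hr.le,
      integral_rpow (Or.inl (by norm_num)), volume_real_ball _ zero_le_one]
    norm_num
    ring

lemma nearKernel_rpow {r : ℝ} (hr : 0 < r) :
    Integrable (fun x => nearKernel r x ^ (3 / 2 : ℝ)) ∧
      ∫ x, nearKernel r x ^ (3 / 2 : ℝ) ≤ 4 * Real.pi * r ^ (1 / 2 : ℝ) := by
  obtain ⟨h1, h2⟩ := integrable_near_majorant hr
  have hb : ∀ᵐ x : Plane, nearKernel r x ^ (3 / 2 : ℝ) ≤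
      (Set.Ioo 0 r).indicator (fun s => s ^ (-(3 / 2) : ℝ)) ‖x‖ := by
    have : ∀ᵐ x : Plane, x ≠ 0 := by simp [ae_iff, measure_singleton]
    filter_upwards [this] with x hx
    have hx0 : 0 < ‖x‖ := norm_pos_iff.2 hx
    rcases lt_or_ge ‖x‖ r with h | h
    · rw [Set.indicator_of_mem (show ‖x‖ ∈ Set.Ioo 0 r from ⟨hx0, h⟩)]
      have : nearKernel r x ≤ ‖x‖⁻¹ := by
        unfold nearKernel
        rw [max_eq_right h.le, abs_of_nonneg
          (sub_nonneg.2 (one_div_le_one_div_of_le hx0 h.le)), one_div]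
        have : 0 < 1 / r := by positivity
        linarith
      calc _ ≤ (‖x‖⁻¹) ^ (3 / 2 : ℝ) := by
            gcongr; exact nearKernel_nonneg _ _
        _ = _ := by rw [Real.inv_rpow hx0.le, Real.rpow_neg hx0.le]
    · rw [Set.indicator_of_notMem (fun h' : ‖x‖ ∈ Set.Ioo 0 r => absurd h'.2 (not_lt.2 h))]
      simp [nearKernel, max_eq_left h]
  have hi : Integrable (fun x => nearKernel r x ^ (3 / 2 : ℝ)) := by
    refine h1.mono' ((measurable_nearKernel r).pow_const _).aestronglyMeasurable ?_
    filter_upwards [hb] with x hx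
    rwa [Real.norm_of_nonneg (Real.rpow_nonneg (nearKernel_nonneg _ _) _)]
  exact ⟨hi, (integral_mono_ae hi h1 hb).trans h2.le⟩

/-- The bilinear form `∬ ρ(x) σ(y) / |x - y| dx dy`. -/
def interaction (ρ σ : Plane → ℝ) : ℝ := ∫ p : Plane × Plane, ρ p.1 * σ p.2 / ‖p.1 - p.2‖

lemma IsDensity.near_le {ρ σ : Plane → ℝ} {M S : ℝ} (hρ : IsDensity ρ M S)
    (hσ : IsDensity σ M S) {r τ : ℝ} (hr : 0 < r) (hτ : 0 < τ) :
    Integrable (fun p : Plane × Plane => ρ p.1 * σ p.2 * nearKernel r (p.1 - p.2)) ∧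
      ∫ p : Plane × Plane, ρ p.1 * σ p.2 * nearKernel r (p.1 - p.2) ≤
        2 * S * (τ * S + τ ^ (-(1 / 2) : ℝ) * (4 * Real.pi * r ^ (1 / 2 : ℝ))) := by
  obtain ⟨h1, h2⟩ := hρ.near_bound hσ (measurable_nearKernel r) (nearKernel_nonneg r)
    (nearKernel_neg r) (nearKernel_rpow hr).1 hτ
  refine ⟨h1, h2.trans ?_⟩
  have := hρ.S_nonneg
  gcongr
  exact (nearKernel_rpow hr).2

lemma IsDensity.integrable_interaction {ρ σ : Plane → ℝ} {M S : ℝ} (hρ : IsDensity ρ M S)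
    (hσ : IsDensity σ M S) :
    Integrable (fun p : Plane × Plane => ρ p.1 * σ p.2 / ‖p.1 - p.2‖) := by
  have h1 := (hρ.near_le hσ zero_lt_one zero_lt_one).1
  have h2 : Integrable (fun p : Plane × Plane => ρ p.1 * σ p.2) :=
    hρ.integrable.mul_prod hσ.integrable
  refine (h1.add h2).mono' ?_ ?_
  · exact h2.aestronglyMeasurable.mul
      ((measurable_fst.sub measurable_snd).norm.inv).aestronglyMeasurable
  · have n1 : ∀ᵐ p : Plane × Plane, 0 ≤ ρ p.1 :=
      Measure.quasiMeasurePreserving_fst.ae hρ.nonneg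
    have n2 : ∀ᵐ p : Plane × Plane, 0 ≤ σ p.2 :=
      Measure.quasiMeasurePreserving_snd.ae hσ.nonneg
    filter_upwards [n1, n2] with p p1 p2
    have := mul_le_mul_of_nonneg_left (one_div_norm_le zero_lt_one (p.1 - p.2)) (mul_nonneg p1 p2)
    rw [Real.norm_of_nonneg (by positivity)]
    simp only [Pi.add_apply]
    rw [div_eq_mul_one_div]
    linarith

lemma IsDensity.interaction_le {ρ σ : Plane → ℝ} {M S : ℝ} (hρ : IsDensity ρ M S)
    (hσ : IsDensity σ M S) {r τ : ℝ} (hr : 0 < r) (hτ : 0 < τ) :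
    interaction ρ σ ≤ 2 * S * (τ * S + τ ^ (-(1 / 2) : ℝ) * (4 * Real.pi * r ^ (1 / 2 : ℝ)))
      + M ^ 2 / r := by
  obtain ⟨h1, h1'⟩ := hρ.near_le hσ hr hτ
  have h2 : Integrable (fun p : Plane × Plane => ρ p.1 * σ p.2) :=
    hρ.integrable.mul_prod hσ.integrable
  have n1 : ∀ᵐ p : Plane × Plane, 0 ≤ ρ p.1 :=
    Measure.quasiMeasurePreserving_fst.ae hρ.nonneg
  have n2 : ∀ᵐ p : Plane × Plane, 0 ≤ σ p.2 :=
    Measure.quasiMeasurePreserving_snd.ae hσ.nonneg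
  have e2 : ∫ p : Plane × Plane, ρ p.1 * σ p.2 = (∫ x, ρ x) * ∫ x, σ x := integral_prod_mul _ _
  calc interaction ρ σ ≤ ∫ p : Plane × Plane, (ρ p.1 * σ p.2 * nearKernel r (p.1 - p.2)
        + 1 / r * (ρ p.1 * σ p.2)) := by
        refine integral_mono_ae (hρ.integrable_interaction hσ) (h1.add (h2.const_mul _)) ?_
        filter_upwards [n1, n2] with p p1 p2
        have := mul_le_mul_of_nonneg_left (one_div_norm_le hr (p.1 - p.2)) (mul_nonneg p1 p2)
        rw [div_eq_mul_one_div]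
        linarith
    _ = (∫ p : Plane × Plane, ρ p.1 * σ p.2 * nearKernel r (p.1 - p.2))
        + 1 / r * ((∫ x, ρ x) * ∫ x, σ x) := by
        rw [integral_add h1 (h2.const_mul _), integral_const_mul, e2]
    _ ≤ _ := by
        have hM := hρ.M_nonneg
        have : (∫ x, ρ x) * ∫ x, σ x ≤ M * M :=
          mul_le_mul hρ.mass_le hσ.mass_le (integral_nonneg_of_ae hσ.nonneg) hM
        have h4 : 1 / r * ((∫ x, ρ x) * ∫ x, σ x) ≤ 1 / r * (M * M) := by gcongr
        have h5 : M ^ 2 / r = 1 / r * (M * M) := by ring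
        rw [h5]
        exact add_le_add h1' h4

/-! ### Properties of the Casimir function -/

section Casimir

variable {Q : ℝ → ℝ} {C₁ C₂ F₀ μ₁ μ₂ μ₃ : ℝ}

lemma CasimirAssumptions.zero (hQ : CasimirAssumptions Q C₁ C₂ F₀ μ₁ μ₂ μ₃) : Q 0 = 0 := by
  have h := hQ.Q2 0 le_rfl hQ.F₀_pos.le
  have hμ := hQ.μ₂_mem.1
  rw [Real.zero_rpow (by positivity), mul_zero] at h
  exact le_antisymm h (hQ.nonneg 0 le_rfl)

lemma CasimirAssumptions.convexOn (hQ : CasimirAssumptions Q C₁ C₂ F₀ μ₁ μ₂ μ₃) :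
    ConvexOn ℝ (Set.Ici 0) Q := by
  refine (strictConvexOn_of_deriv2_pos (convex_Ici 0) hQ.contDiffOn.continuousOn ?_).convexOn
  intro x hx
  rw [interior_Ici] at hx
  exact hQ.Q4_pos x hx

lemma CasimirAssumptions.differentiableWithinAt (hQ : CasimirAssumptions Q C₁ C₂ F₀ μ₁ μ₂ μ₃)
    {s : ℝ} (hs : 0 ≤ s) : DifferentiableWithinAt ℝ Q (Set.Ici 0) s :=
  hQ.contDiffOn.differentiableOn_one s hs

/-- The tangent inequality for the convex function `Q` on `[0,∞)`. -/
lemma CasimirAssumptions.tangent (hQ : CasimirAssumptions Q C₁ C₂ F₀ μ₁ μ₂ μ₃) {s t : ℝ}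
    (hs : 0 ≤ s) (ht : 0 ≤ t) : Q s + derivWithin Q (Set.Ici 0) s * (t - s) ≤ Q t := by
  rcases hs.eq_or_lt with rfl | hs'
  · rw [hQ.Q4_zero, hQ.zero]
    simpa using hQ.nonneg t ht
  have hd : HasDerivAt Q (derivWithin Q (Set.Ici 0) s) s :=
    (hQ.differentiableWithinAt hs).hasDerivWithinAt.hasDerivAt (Ici_mem_nhds hs')
  rcases lt_trichotomy s t with h | rfl | h
  · have := hQ.convexOn.le_slope_of_hasDerivAt hs ht h hd
    rw [slope_def_field, le_div_iff₀ (sub_pos.2 h)] at this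
    linarith
  · simp
  · have := hQ.convexOn.slope_le_of_hasDerivAt ht hs h hd
    rw [slope_def_field, div_le_iff₀ (sub_pos.2 h)] at this
    linarith

lemma CasimirAssumptions.continuous_comp_max (hQ : CasimirAssumptions Q C₁ C₂ F₀ μ₁ μ₂ μ₃) :
    Continuous (fun s => Q (max s 0)) := by
  refine hQ.contDiffOn.continuousOn.comp_continuous (by fun_prop) fun s => ?_
  exact (le_max_right s 0 : (0 : ℝ) ≤ max s 0)

lemma CasimirAssumptions.continuous_deriv_comp_max
    (hQ : CasimirAssumptions Q C₁ C₂ F₀ μ₁ μ₂ μ₃) :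
    Continuous (fun s => derivWithin Q (Set.Ici 0) (max s 0)) := by
  refine (hQ.contDiffOn.continuousOn_derivWithin (uniqueDiffOn_Ici 0) le_rfl).comp_continuous
    (by fun_prop) fun s => ?_
  exact (le_max_right s 0 : (0 : ℝ) ≤ max s 0)

lemma CasimirAssumptions.aestronglyMeasurable_comp
    (hQ : CasimirAssumptions Q C₁ C₂ F₀ μ₁ μ₂ μ₃) {f : Phase → ℝ}
    (hf : AEStronglyMeasurable f) (h0 : ∀ᵐ z, 0 ≤ f z) :
    AEStronglyMeasurable (fun z => Q (f z)) := by
  refine (hQ.continuous_comp_max.comp_aestronglyMeasurable hf).congr ?_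
  filter_upwards [h0] with z hz
  simp [max_eq_left hz]

/-- By (Q1) with `1 + 1/μ₁ > 2`, squares are controlled by `Q` with an arbitrarily small
constant, up to a multiple of the mass. -/
lemma CasimirAssumptions.exists_sq_le (hQ : CasimirAssumptions Q C₁ C₂ F₀ μ₁ μ₂ μ₃) {ε : ℝ}
    (hε : 0 < ε) : ∃ C, 0 ≤ C ∧ ∀ s, 0 ≤ s → s ^ 2 ≤ ε * Q s + C * s := by
  obtain ⟨h0, h1⟩ := hQ.μ₁_mem
  have hp : 0 < 1 / μ₁ - 1 := by
    rw [sub_pos, lt_div_iff₀ h0]; linarith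
  have hC := hQ.C₁_pos
  obtain ⟨K, hK1, hK2⟩ := ((tendsto_rpow_atTop hp).eventually_ge_atTop (1 / (ε * C₁))).and
    (eventually_ge_atTop F₀) |>.exists
  have hK : 0 < K := hQ.F₀_pos.trans_le hK2
  refine ⟨K, hK.le, fun s hs => ?_⟩
  have hQs := hQ.nonneg s hs
  rcases le_total s K with h | h
  · nlinarith [mul_nonneg hε.le hQs]
  · have hs' : 0 < s := hK.trans_le h
    have h3 : 1 / (ε * C₁) ≤ s ^ (1 / μ₁ - 1) :=
      hK1.trans (Real.rpow_le_rpow hK.le h hp.le)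
    have h4 : s ^ (1 + 1 / μ₁) = s ^ 2 * s ^ (1 / μ₁ - 1) := by
      rw [← Real.rpow_natCast, ← Real.rpow_add hs']
      congr 1; push_cast; ring
    have h5 := hQ.Q1 s (hK2.trans h)
    rw [h4] at h5
    rw [div_le_iff₀ (by positivity)] at h3
    have h6 : s ^ 2 * 1 ≤ s ^ 2 * (s ^ (1 / μ₁ - 1) * (ε * C₁)) := by gcongr
    have h7 : ε * (C₁ * (s ^ 2 * s ^ (1 / μ₁ - 1))) ≤ ε * Q s := by gcongr
    nlinarith [mul_nonneg hK.le hs]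

/-- By (Q1), the `(1 + 1/μ₁)`-th power is controlled by `Q` and the mass. -/
lemma CasimirAssumptions.rpow_le (hQ : CasimirAssumptions Q C₁ C₂ F₀ μ₁ μ₂ μ₃) {s : ℝ}
    (hs : 0 ≤ s) : s ^ (1 + 1 / μ₁) ≤ 1 / C₁ * Q s + F₀ ^ (1 / μ₁) * s := by
  have h0 := hQ.μ₁_mem.1
  have hC := hQ.C₁_pos
  have hF := hQ.F₀_pos
  have hQs := hQ.nonneg s hs
  rcases le_total s F₀ with h | h
  · have : s ^ (1 + 1 / μ₁) = s ^ (1 / μ₁) * s := by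
      rw [add_comm, Real.rpow_add_one' hs (by positivity)]
    rw [this]
    have : s ^ (1 / μ₁) * s ≤ F₀ ^ (1 / μ₁) * s := by gcongr
    have : 0 ≤ 1 / C₁ * Q s := by positivity
    linarith
  · have h5 := hQ.Q1 s h
    have : s ^ (1 + 1 / μ₁) ≤ 1 / C₁ * Q s := by
      rw [div_mul_eq_mul_div, one_mul, le_div_iff₀ hC]; linarith
    have : 0 ≤ F₀ ^ (1 / μ₁) * s := by positivity
    linarith

end Casimir

/-! ### Spatial densities of phase space densities -/

lemma integrable_rho {f : Phase → ℝ} (hf : Integrable f) : Integrable (rho f) :=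
  Integrable.integral_prod_left (μ := (volume : Measure Plane)) hf

lemma integral_rho {f : Phase → ℝ} (hf : Integrable f) : ∫ x, rho f x = ∫ z, f z :=
  (integral_prod (μ := (volume : Measure Plane)) (ν := (volume : Measure Plane)) f hf).symm

lemma rho_nonneg {f : Phase → ℝ} (h0 : ∀ᵐ z, 0 ≤ f z) : ∀ᵐ x, 0 ≤ rho f x := by
  have := Measure.ae_ae_of_ae_prod (μ := (volume : Measure Plane)) (ν := (volume : Measure Plane)) h0
  filter_upwards [this] with x hx
  exact integral_nonneg_of_ae hx

/-- Interpolation between `∫ g²` and the second moment: the low velocities `|v| < s` are estimated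
by the square integral, the others by the second moment, with `s² = √m / δ` and `m = ∫ g`. -/
lemma integral_rpow_le_moments {g : Plane → ℝ} (hg : Integrable g) (h0 : ∀ᵐ v, 0 ≤ g v)
    (h2 : Integrable (fun v => g v ^ 2)) (hv : Integrable (fun v => ‖v‖ ^ 2 * g v)) {δ : ℝ}
    (hδ : 0 < δ) : (∫ v, g v) ^ (3 / 2 : ℝ) ≤
      Real.pi / δ * (∫ v, g v ^ 2) + 2 * δ * ∫ v, ‖v‖ ^ 2 * g v := by
  set m := ∫ v, g v with hm
  have hm0 : 0 ≤ m := integral_nonneg_of_ae h0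
  have hA : 0 ≤ ∫ v, g v ^ 2 := integral_nonneg fun v => sq_nonneg _
  have hB : 0 ≤ ∫ v, ‖v‖ ^ 2 * g v :=
    integral_nonneg_of_ae (h0.mono fun v hv => mul_nonneg (sq_nonneg _) hv)
  have hπ := Real.pi_pos
  rcases hm0.eq_or_lt with h | hmp
  · rw [← h, Real.zero_rpow (by norm_num)]; positivity
  set w := √m with hw
  have hw0 : 0 < w := Real.sqrt_pos.2 hmp
  have hw2 : w ^ 2 = m := Real.sq_sqrt hm0
  have hrp : m ^ (3 / 2 : ℝ) = m * w := by
    rw [show (3 / 2 : ℝ) = 1 / 2 + 1 by norm_num, Real.rpow_add_one hmp.ne', ← Real.sqrt_eq_rpow,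
      mul_comm]
  set s := √(w / δ) with hs
  have hs0 : 0 < s := Real.sqrt_pos.2 (by positivity)
  have hs2 : s ^ 2 = w / δ := Real.sq_sqrt (by positivity)
  set u := δ * w / Real.pi with hu
  have hu0 : 0 < u := by positivity
  have hI : Integrable ((Metric.ball (0 : Plane) s).indicator (fun _ => u / 2)) :=
    (integrable_indicator_iff Metric.isOpen_ball.measurableSet).2
      (integrableOn_const measure_ball_lt_top.ne)
  have i1 : Integrable (fun v : Plane => 1 / (2 * u) * g v ^ 2 + 1 / s ^ 2 * (‖v‖ ^ 2 * g v)) :=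
    (h2.const_mul _).add (hv.const_mul _)
  have key : m ≤ ∫ v : Plane, (1 / (2 * u) * g v ^ 2 + 1 / s ^ 2 * (‖v‖ ^ 2 * g v)
      + (Metric.ball (0 : Plane) s).indicator (fun _ => u / 2) v) := by
    refine integral_mono_ae hg (i1.add hI) ?_
    filter_upwards [h0] with v hv0
    by_cases hvs : v ∈ Metric.ball (0 : Plane) s
    · simp only [Set.indicator_of_mem hvs]
      have e : 1 / (2 * u) * g v ^ 2 + u / 2 - g v = 1 / (2 * u) * (g v - u) ^ 2 := by
        field_simp; ring
      have : 0 ≤ 1 / (2 * u) * (g v - u) ^ 2 := by positivity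
      have : 0 ≤ 1 / s ^ 2 * (‖v‖ ^ 2 * g v) := by positivity
      linarith
    · simp only [Set.indicator_of_notMem hvs]
      have hvs' : s ≤ ‖v‖ := by simpa using hvs
      have h3 : s ^ 2 ≤ ‖v‖ ^ 2 := by gcongr
      have h4 : s ^ 2 * g v ≤ ‖v‖ ^ 2 * g v := by gcongr
      have : g v ≤ 1 / s ^ 2 * (‖v‖ ^ 2 * g v) := by
        rw [one_div, ← div_eq_inv_mul, le_div_iff₀ (by positivity)]; linarith
      have : 0 ≤ 1 / (2 * u) * g v ^ 2 := by positivity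
      linarith
  rw [integral_add i1 hI, integral_add (h2.const_mul _) (hv.const_mul _), integral_const_mul,
    integral_const_mul, integral_indicator Metric.isOpen_ball.measurableSet, setIntegral_const,
    volume_real_ball _ hs0.le, smul_eq_mul, hs2] at key
  have e1 : Real.pi * (w / δ) * (u / 2) = m / 2 := by
    rw [← hw2, hu]; field_simp
  rw [e1] at key
  have e2 : 1 / (2 * u) * (∫ v, g v ^ 2) = (Real.pi / δ * ∫ v, g v ^ 2) / (2 * w) := by
    rw [hu]; field_simp
  have e3 : 1 / (w / δ) * (∫ v, ‖v‖ ^ 2 * g v) = (2 * δ * ∫ v, ‖v‖ ^ 2 * g v) / (2 * w) := by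
    field_simp
  rw [e2, e3] at key
  have key2 : m / 2 ≤ (Real.pi / δ * (∫ v, g v ^ 2) + 2 * δ * ∫ v, ‖v‖ ^ 2 * g v) / (2 * w) := by
    rw [add_div]; linarith
  rw [le_div_iff₀ (by positivity)] at key2
  rw [hrp]
  linarith

lemma rho_rpow_le {f : Phase → ℝ} (hf : Integrable f) (h0 : ∀ᵐ z, 0 ≤ f z)
    (h2 : Integrable (fun z => f z ^ 2)) (hv : Integrable (fun z : Phase => ‖z.2‖ ^ 2 * f z))
    {δ : ℝ} (hδ : 0 < δ) :
    Integrable (fun x => rho f x ^ (3 / 2 : ℝ)) ∧ ∫ x, rho f x ^ (3 / 2 : ℝ) ≤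
      Real.pi / δ * (∫ z, f z ^ 2) + 2 * δ * ∫ z : Phase, ‖z.2‖ ^ 2 * f z := by
  have a0 := Measure.ae_ae_of_ae_prod (μ := (volume : Measure Plane))
    (ν := (volume : Measure Plane)) h0
  have a1 := Integrable.prod_right_ae (μ := (volume : Measure Plane)) hf
  have a2 := Integrable.prod_right_ae (μ := (volume : Measure Plane)) h2
  have a3 := Integrable.prod_right_ae (μ := (volume : Measure Plane)) hv
  set G : Plane → ℝ := fun x => Real.pi / δ * rho (fun z => f z ^ 2) x +
    2 * δ * rho (fun z => ‖z.2‖ ^ 2 * f z) x with hG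
  have iG : Integrable G := ((integrable_rho h2).const_mul _).add ((integrable_rho hv).const_mul _)
  have bd : ∀ᵐ x, rho f x ^ (3 / 2 : ℝ) ≤ G x := by
    filter_upwards [a0, a1, a2, a3] with x x0 x1 x2 x3
    exact integral_rpow_le_moments x1 x0 x2 x3 hδ
  have i : Integrable (fun x => rho f x ^ (3 / 2 : ℝ)) := by
    refine iG.mono' ((integrable_rho hf).aestronglyMeasurable.aemeasurable.pow_const
      _).aestronglyMeasurable ?_
    filter_upwards [bd, rho_nonneg h0] with x hx hx0
    rwa [Real.norm_of_nonneg (Real.rpow_nonneg hx0 _)]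
  refine ⟨i, (integral_mono_ae i iG bd).trans ?_⟩
  rw [hG, integral_add ((integrable_rho h2).const_mul _) ((integrable_rho hv).const_mul _),
    integral_const_mul, integral_const_mul, integral_rho h2, integral_rho hv]

/-! ### Lower bound of the energy-Casimir functional -/

section Bounds

variable {Q : ℝ → ℝ} {C₁ C₂ F₀ μ₁ μ₂ μ₃ : ℝ}

lemma Ekin_nonneg {f : Phase → ℝ} (h0 : ∀ᵐ z, 0 ≤ f z) : 0 ≤ Ekin f :=
  mul_nonneg (by norm_num)
    (integral_nonneg_of_ae (h0.mono fun _ hz => mul_nonneg (sq_nonneg _) hz))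

lemma CasimirAssumptions.casimir_nonneg (hQ : CasimirAssumptions Q C₁ C₂ F₀ μ₁ μ₂ μ₃)
    {f : Phase → ℝ} (h0 : ∀ᵐ z, 0 ≤ f z) : 0 ≤ casimir Q f :=
  integral_nonneg_of_ae (h0.mono fun _ hz => hQ.nonneg _ hz)

lemma CasimirAssumptions.posPart_nonneg (hQ : CasimirAssumptions Q C₁ C₂ F₀ μ₁ μ₂ μ₃)
    {f : Phase → ℝ} (h0 : ∀ᵐ z, 0 ≤ f z) : 0 ≤ posPart Q f :=
  add_nonneg (Ekin_nonneg h0) (hQ.casimir_nonneg h0)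

lemma CasimirAssumptions.integrable_sq (hQ : CasimirAssumptions Q C₁ C₂ F₀ μ₁ μ₂ μ₃)
    {f : Phase → ℝ} {M : ℝ} (hf : f ∈ massClass Q M) : Integrable (fun z => f z ^ 2) := by
  obtain ⟨h1, h0, -, -, h4⟩ := hf
  obtain ⟨C, -, hC⟩ := hQ.exists_sq_le one_pos
  refine ((h4.const_mul 1).add (h1.const_mul C)).mono' (h1.aestronglyMeasurable.pow 2) ?_
  filter_upwards [h0] with z hz
  rw [Real.norm_of_nonneg (sq_nonneg _)]
  exact hC _ hz

lemma CasimirAssumptions.exists_integral_sq_le (hQ : CasimirAssumptions Q C₁ C₂ F₀ μ₁ μ₂ μ₃)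
    (M : ℝ) {ε : ℝ} (hε : 0 < ε) :
    ∃ C, ∀ f ∈ massClass Q M, ∫ z, f z ^ 2 ≤ ε * casimir Q f + C := by
  obtain ⟨C, -, hC⟩ := hQ.exists_sq_le hε
  refine ⟨C * M, fun f hf => ?_⟩
  have h2 := hQ.integrable_sq hf
  obtain ⟨h1, h0, hm, -, h4⟩ := hf
  calc ∫ z, f z ^ 2 ≤ ∫ z, (ε * Q (f z) + C * f z) :=
        integral_mono_ae h2 ((h4.const_mul ε).add (h1.const_mul C)) (h0.mono fun z hz => hC _ hz)
    _ = _ := by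
        rw [integral_add (h4.const_mul ε) (h1.const_mul C), integral_const_mul,
          integral_const_mul, hm]; rfl

/-- The `L^{3/2}`-bound on the spatial density by an arbitrarily small multiple of `P(f)`. -/
lemma CasimirAssumptions.exists_isDensity (hQ : CasimirAssumptions Q C₁ C₂ F₀ μ₁ μ₂ μ₃)
    (M : ℝ) {η : ℝ} (hη : 0 < η) :
    ∃ C, 1 ≤ C ∧ ∀ f ∈ massClass Q M, IsDensity (rho f) M (η * posPart Q f + C) := by
  -- With `∫ f² ≤ δ² ∫ Q(f) + C` the moment bound becomes `(π + 4) δ P(f) + C'`.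
  set δ := η / 8 with hδ'
  have hδ : 0 < δ := by positivity
  obtain ⟨C, hC⟩ := hQ.exists_integral_sq_le M (ε := δ ^ 2) (by positivity)
  refine ⟨max 1 (Real.pi / δ * C), le_max_left _ _, fun f hf => ?_⟩
  have h2 := hQ.integrable_sq hf
  have hCf := hC f hf
  obtain ⟨h1, h0, hm, h3, h4⟩ := hf
  obtain ⟨k1, k2⟩ := rho_rpow_le h1 h0 h2 h3 hδ
  refine ⟨integrable_rho h1, rho_nonneg h0, (integral_rho h1).trans hm |>.le, k1, k2.trans ?_⟩
  have hk := Ekin_nonneg h0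
  have hc := hQ.casimir_nonneg h0
  have e1 : (∫ z : Phase, ‖z.2‖ ^ 2 * f z) = 2 * Ekin f := by unfold Ekin; ring
  rw [e1]
  have h5 : Real.pi / δ * (∫ z, f z ^ 2) ≤ Real.pi / δ * (δ ^ 2 * casimir Q f + C) := by
    gcongr
  have e2 : Real.pi / δ * (δ ^ 2 * casimir Q f + C)
      = Real.pi * δ * casimir Q f + Real.pi / δ * C := by field_simp
  have h6 : Real.pi * δ * casimir Q f ≤ 8 * δ * casimir Q f := by
    gcongr; linarith [Real.pi_le_four]
  have h7 := le_max_right 1 (Real.pi / δ * C)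
  have h8 : η = 8 * δ := by rw [hδ']; ring
  unfold posPart
  rw [h8]
  nlinarith [mul_nonneg hδ.le hk]

lemma epotFinite_of_isDensity {f : Phase → ℝ} {M S : ℝ} (h : IsDensity (rho f) M S) :
    EpotFinite f := h.integrable_interaction h

lemma CasimirAssumptions.epotFinite (hQ : CasimirAssumptions Q C₁ C₂ F₀ μ₁ μ₂ μ₃) {M : ℝ}
    {f : Phase → ℝ} (hf : f ∈ massClass Q M) : EpotFinite f := by
  obtain ⟨C, -, h⟩ := hQ.exists_isDensity M one_pos
  exact epotFinite_of_isDensity (h f hf)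

lemma Epot_eq_interaction {f : Phase → ℝ} (h : EpotFinite f) :
    Epot f = -(1 / 2) * interaction (rho f) (rho f) := by
  unfold Epot interaction potential
  have : ∫ p : Plane × Plane, rho f p.1 * rho f p.2 / ‖p.1 - p.2‖
      = ∫ x, ∫ y, rho f x * rho f y / ‖x - y‖ :=
    integral_prod (μ := (volume : Measure Plane)) (ν := (volume : Measure Plane)) _ h
  rw [this]
  simp only [mul_neg, integral_neg, mul_div_assoc, integral_const_mul]
  ring

/-- The potential energy is dominated by the positive part of the energy-Casimir functional. -/
lemma CasimirAssumptions.exists_neg_Epot_le (hQ : CasimirAssumptions Q C₁ C₂ F₀ μ₁ μ₂ μ₃)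
    (M : ℝ) : ∃ C, ∀ f ∈ massClass Q M, -Epot f ≤ 1 / 2 * posPart Q f + C := by
  have hπ := Real.pi_pos
  set c := 1 + 4 * Real.pi + M ^ 2 / 2 with hc
  have hc0 : 0 < c := by positivity
  obtain ⟨C, hC1, h⟩ := hQ.exists_isDensity M (η := 1 / (2 * c)) (by positivity)
  refine ⟨c * C, fun f hf => ?_⟩
  have hd := h f hf
  have hP := hQ.posPart_nonneg hf.2.1
  set S := 1 / (2 * c) * posPart Q f + C with hS
  have hS1 : 1 ≤ S := by
    have : 0 ≤ 1 / (2 * c) * posPart Q f := by positivity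
    linarith
  have hS0 : 0 < S := by linarith
  have key := hd.interaction_le hd (r := S⁻¹) (τ := S⁻¹) (by positivity) (by positivity)
  rw [Epot_eq_interaction (epotFinite_of_isDensity hd)]
  have e1 : S⁻¹ ^ (-(1 / 2) : ℝ) * (4 * Real.pi * S⁻¹ ^ (1 / 2 : ℝ)) = 4 * Real.pi := by
    rw [mul_left_comm, ← Real.rpow_add (by positivity)]; norm_num
  rw [e1, inv_mul_cancel₀ hS0.ne', div_inv_eq_mul] at key
  have e2 : c * S = 1 / 2 * posPart Q f + c * C := by
    rw [hS]; field_simp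
  rw [← e2, hc]
  nlinarith

lemma CasimirAssumptions.exists_posPart_le (hQ : CasimirAssumptions Q C₁ C₂ F₀ μ₁ μ₂ μ₃)
    (M : ℝ) : ∃ C, ∀ f ∈ massClass Q M, posPart Q f ≤ 2 * energyCasimir Q f + C := by
  obtain ⟨C, h⟩ := hQ.exists_neg_Epot_le M
  refine ⟨2 * C, fun f hf => ?_⟩
  have := h f hf
  unfold energyCasimir
  linarith

lemma CasimirAssumptions.bddBelow (hQ : CasimirAssumptions Q C₁ C₂ F₀ μ₁ μ₂ μ₃)
    (M : ℝ) : BddBelow (energyCasimir Q '' symMassClass Q M) := by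
  obtain ⟨C, h⟩ := hQ.exists_posPart_le M
  refine ⟨-C / 2, ?_⟩
  rintro _ ⟨f, hf, rfl⟩
  have h1 := h f hf.1
  have h2 := hQ.posPart_nonneg hf.1.2.1
  linarith

lemma CasimirAssumptions.symInf_le (hQ : CasimirAssumptions Q C₁ C₂ F₀ μ₁ μ₂ μ₃) {M : ℝ}
    {f : Phase → ℝ} (hf : f ∈ symMassClass Q M) : symInf Q M ≤ energyCasimir Q f :=
  csInf_le (hQ.bddBelow M) ⟨f, hf, rfl⟩

end Bounds

/-! ### Rotations -/

lemma norm_act {A : Matrix (Fin 2) (Fin 2) ℝ} (hA : A ∈ Matrix.specialOrthogonalGroup (Fin 2) ℝ)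
    (x : Plane) : ‖act A x‖ = ‖x‖ := by
  have h1 : A.transpose * A = 1 :=
    (Matrix.mem_orthogonalGroup_iff' _ _).1 (Matrix.mem_specialOrthogonalGroup_iff.1 hA).1
  have h2 : ‖act A x‖ ^ 2 = ‖x‖ ^ 2 := by
    rw [EuclideanSpace.real_norm_sq_eq, EuclideanSpace.real_norm_sq_eq]
    have e : ∀ y : Fin 2 → ℝ, ∑ i, y i ^ 2 = dotProduct y y := fun y => by
      simp [dotProduct, sq]
    rw [e, e]
    simp only [act]
    rw [Matrix.dotProduct_mulVec, Matrix.vecMul_mulVec, h1, Matrix.vecMul_one]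
  exact (sq_eq_sq₀ (norm_nonneg _) (norm_nonneg _)).1 h2

lemma act_smul (A : Matrix (Fin 2) (Fin 2) ℝ) (b : ℝ) (x : Plane) :
    act A (b • x) = b • act A x := by
  simp only [act, WithLp.ofLp_smul, Matrix.mulVec_smul, WithLp.toLp_smul]

/-- The action of `A ∈ SO(2)` on the plane as a linear isometry. -/
def rotation (A : Matrix (Fin 2) (Fin 2) ℝ) (hA : A ∈ Matrix.specialOrthogonalGroup (Fin 2) ℝ) :
    Plane ≃ₗᵢ[ℝ] Plane :=
  LinearIsometry.toLinearIsometryEquiv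
    { toFun := act A
      map_add' := fun x y => by
        simp only [act, WithLp.ofLp_add, Matrix.mulVec_add, WithLp.toLp_add]
      map_smul' := fun b x => by simp [act_smul]
      norm_map' := fun x => norm_act hA x } rfl

@[simp] lemma rotation_apply (A : Matrix (Fin 2) (Fin 2) ℝ)
    (hA : A ∈ Matrix.specialOrthogonalGroup (Fin 2) ℝ) (x : Plane) :
    rotation A hA x = act A x := rfl

/-! ### Scaling -/

section Scaling

variable {Q : ℝ → ℝ} {C₁ C₂ F₀ μ₁ μ₂ μ₃ : ℝ}

/-- The scaling of space and velocity, `(x, v) ↦ (b x, c v)`. -/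
def dilation {b c : ℝ} (hb : b ≠ 0) (hc : c ≠ 0) : Phase ≃ᵐ Phase :=
  (MeasurableEquiv.smul₀ b hb).prodCongr (MeasurableEquiv.smul₀ c hc)

lemma map_dilation {b c : ℝ} (hb : b ≠ 0) (hc : c ≠ 0) :
    Measure.map (dilation hb hc) volume =
      (ENNReal.ofReal (b ^ 2)⁻¹ * ENNReal.ofReal (c ^ 2)⁻¹) • (volume : Measure Phase) := by
  have e : (dilation hb hc : Phase → Phase) =
      Prod.map (fun x : Plane => b • x) (fun v : Plane => c • v) := rfl
  rw [e, Measure.volume_eq_prod, ← Measure.map_prod_map _ _ (by fun_prop) (by fun_prop),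
    Measure.map_addHaar_smul _ hb, Measure.map_addHaar_smul _ hc, Measure.prod_smul_left,
    Measure.prod_smul_right, smul_smul, finrank_euclideanSpace_fin, abs_of_nonneg (by positivity),
    abs_of_nonneg (by positivity)]

lemma integral_comp_dilation {b c : ℝ} (hb : b ≠ 0) (hc : c ≠ 0) (F : Phase → ℝ) :
    ∫ z : Phase, F (b • z.1, c • z.2) = (b ^ 2)⁻¹ * (c ^ 2)⁻¹ * ∫ z, F z := by
  have h := (dilation hb hc).measurableEmbedding.integral_map (μ := volume) F
  rw [map_dilation, integral_smul_measure, ENNReal.toReal_mul,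
    ENNReal.toReal_ofReal (by positivity), ENNReal.toReal_ofReal (by positivity)] at h
  exact h.symm

lemma integrable_comp_dilation {b c : ℝ} (hb : b ≠ 0) (hc : c ≠ 0) {F : Phase → ℝ}
    (hF : Integrable F) : Integrable (fun z : Phase => F (b • z.1, c • z.2)) := by
  refine ((dilation hb hc).measurableEmbedding.integrable_map_iff (μ := volume) (g := F)).1 ?_
  rw [map_dilation]
  exact hF.smul_measure (ENNReal.mul_ne_top ENNReal.ofReal_ne_top ENNReal.ofReal_ne_top)

lemma ae_comp_dilation {b c : ℝ} (hb : b ≠ 0) (hc : c ≠ 0) {p : Phase → Prop}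
    (h : ∀ᵐ z, p z) : ∀ᵐ z : Phase, p (b • z.1, c • z.2) := by
  have : ∀ᵐ z ∂(Measure.map (dilation hb hc) volume), p z := by
    rw [map_dilation]; exact Measure.ae_smul_measure h _
  exact ae_of_ae_map (dilation hb hc).measurable.aemeasurable this

/-- The rescaled function `a f(b x, c v)`. -/
def rescale (a b c : ℝ) (f : Phase → ℝ) (z : Phase) : ℝ := a * f (b • z.1, c • z.2)

lemma rho_rescale {a b c : ℝ} (f : Phase → ℝ) (x : Plane) :
    rho (rescale a b c f) x = a * (c ^ 2)⁻¹ * rho f (b • x) := by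
  simp only [rho, rescale, integral_const_mul]
  have := Measure.integral_comp_smul (volume : Measure Plane) (fun v => f (b • x, v)) c
  rw [finrank_euclideanSpace_fin, abs_of_nonneg (by positivity), smul_eq_mul] at this
  rw [this]; ring

lemma Epot_rescale {a b c : ℝ} (hb : 0 < b) (f : Phase → ℝ) :
    Epot (rescale a b c f) = (a * (b ^ 2)⁻¹ * (c ^ 2)⁻¹) ^ 2 * b * Epot f := by
  have h1 : ∀ x, potential (rho (rescale a b c f)) x =
      a * (c ^ 2)⁻¹ * b⁻¹ * potential (rho f) (b • x) := by
    intro x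
    have := Measure.integral_comp_smul (volume : Measure Plane) (fun y => rho f y / ‖b • x - y‖) b
    rw [finrank_euclideanSpace_fin, abs_of_nonneg (by positivity), smul_eq_mul] at this
    have e : ∀ y : Plane, rho (rescale a b c f) y / ‖x - y‖
        = a * (c ^ 2)⁻¹ * b * (rho f (b • y) / ‖b • x - b • y‖) := by
      intro y
      rw [rho_rescale, ← smul_sub, norm_smul, Real.norm_of_nonneg hb.le]
      field_simp
    simp only [potential, e, integral_const_mul, this]
    field_simp
  have h2 := Measure.integral_comp_smul (volume : Measure Plane)
    (fun x => rho f x * potential (rho f) x) b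
  rw [finrank_euclideanSpace_fin, abs_of_nonneg (by positivity), smul_eq_mul] at h2
  have e : ∀ x : Plane, rho (rescale a b c f) x * potential (rho (rescale a b c f)) x
      = (a * (c ^ 2)⁻¹) ^ 2 * b⁻¹ * (rho f (b • x) * potential (rho f) (b • x)) := by
    intro x
    rw [h1, rho_rescale]; ring
  simp only [Epot, e, integral_const_mul, h2]
  field_simp

lemma Ekin_rescale {a b c : ℝ} (hb : b ≠ 0) (hc : c ≠ 0) (f : Phase → ℝ) :
    Ekin (rescale a b c f) = a * (b ^ 2)⁻¹ * (c ^ 2)⁻¹ * (c ^ 2)⁻¹ * Ekin f := by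
  have h := integral_comp_dilation hb hc (fun z => ‖z.2‖ ^ 2 * f z)
  have e : ∀ z : Phase, ‖z.2‖ ^ 2 * rescale a b c f z
      = a * (c ^ 2)⁻¹ * (‖c • z.2‖ ^ 2 * f (b • z.1, c • z.2)) := by
    intro z
    rw [rescale, norm_smul, mul_pow, Real.norm_eq_abs, sq_abs]
    field_simp
  simp only [Ekin, e, integral_const_mul]
  simp only at h
  rw [h]; ring

lemma CasimirAssumptions.mul_le (hQ : CasimirAssumptions Q C₁ C₂ F₀ μ₁ μ₂ μ₃) {a s : ℝ}
    (ha : 1 ≤ a) (hs : 0 ≤ s) : Q (a * s) ≤ a ^ (1 + 1 / μ₃) * Q s := by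
  have ha0 : 0 < a := by linarith
  have h := hQ.Q3 (a * s) a⁻¹ (by positivity) (by positivity) (inv_le_one_of_one_le₀ ha)
  rw [inv_mul_cancel_left₀ ha0.ne', Real.inv_rpow ha0.le, inv_mul_le_iff₀ (by positivity)] at h
  exact h

lemma CasimirAssumptions.rescale_mem (hQ : CasimirAssumptions Q C₁ C₂ F₀ μ₁ μ₂ μ₃) {a b c m : ℝ}
    (ha : 1 ≤ a) (hb : b ≠ 0) (hc : c ≠ 0) {f : Phase → ℝ} (hf : f ∈ symMassClass Q m) :
    rescale a b c f ∈ symMassClass Q (a * (b ^ 2)⁻¹ * (c ^ 2)⁻¹ * m) ∧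
      casimir Q (rescale a b c f) ≤
        (b ^ 2)⁻¹ * (c ^ 2)⁻¹ * a ^ (1 + 1 / μ₃) * casimir Q f := by
  obtain ⟨⟨h1, h0, hm, h3, h4⟩, hs⟩ := hf
  have ha0 : 0 < a := by linarith
  have n0 : ∀ᵐ z, 0 ≤ rescale a b c f z :=
    (ae_comp_dilation hb hc h0).mono fun z hz => mul_nonneg ha0.le hz
  have i1 : Integrable (rescale a b c f) := (integrable_comp_dilation hb hc h1).const_mul a
  have i4 : Integrable (fun z : Phase => a ^ (1 + 1 / μ₃) * Q (f (b • z.1, c • z.2))) :=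
    (integrable_comp_dilation hb hc h4).const_mul _
  have bd : ∀ᵐ z, Q (rescale a b c f z) ≤ a ^ (1 + 1 / μ₃) * Q (f (b • z.1, c • z.2)) :=
    (ae_comp_dilation hb hc h0).mono fun z hz => hQ.mul_le ha hz
  have i5 : Integrable (fun z => Q (rescale a b c f z)) := by
    refine i4.mono' (hQ.aestronglyMeasurable_comp i1.aestronglyMeasurable n0) ?_
    filter_upwards [n0, bd] with z z0 z1
    rwa [Real.norm_of_nonneg (hQ.nonneg _ z0)]
  refine ⟨⟨⟨i1, n0, ?_, ?_, i5⟩, ?_⟩, ?_⟩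
  · simp only [rescale, integral_const_mul]
    rw [integral_comp_dilation hb hc, hm]; ring
  · have := (integrable_comp_dilation hb hc h3).const_mul (a * (c ^ 2)⁻¹)
    refine this.congr (ae_of_all _ fun z => ?_)
    simp only [rescale]
    rw [norm_smul, mul_pow, Real.norm_eq_abs, sq_abs]
    field_simp
  · intro A hA
    filter_upwards [ae_comp_dilation hb hc (hs A hA)] with z hz
    simp only [rescale, ← act_smul, hz]
  · refine (integral_mono_ae i5 i4 bd).trans_eq ?_
    rw [integral_const_mul, integral_comp_dilation hb hc (fun z => Q (f z)), casimir]
    ring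

lemma energyCasimir_congr {f g : Phase → ℝ} (h : f =ᵐ[volume] g) :
    energyCasimir Q f = energyCasimir Q g := by
  have h1 : rho f =ᵐ[volume] rho g := by
    have := Measure.ae_ae_of_ae_prod (μ := (volume : Measure Plane))
      (ν := (volume : Measure Plane)) h
    filter_upwards [this] with x hx
    exact integral_congr_ae hx
  have h2 : potential (rho f) = potential (rho g) := by
    funext x
    simp only [potential]
    congr 1
    refine integral_congr_ae ?_
    filter_upwards [h1] with y hy
    rw [hy]
  have h3 : Epot f = Epot g := by
    simp only [Epot, h2]
    congr 1
    refine integral_congr_ae ?_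
    filter_upwards [h1] with y hy
    rw [hy]
  have h4 : Ekin f = Ekin g := by
    simp only [Ekin]
    congr 1
    refine integral_congr_ae ?_
    filter_upwards [h] with y hy
    rw [hy]
  have h5 : casimir Q f = casimir Q g := by
    refine integral_congr_ae ?_
    filter_upwards [h] with y hy
    rw [hy]
  simp only [energyCasimir, posPart, h3, h4, h5]

/-- By scaling, the infimum of the energy-Casimir functional at a smaller mass `m ≤ M` is bounded
below by `(m / M)^{1+α}` times its infimum at mass `M`. -/
lemma CasimirAssumptions.rpow_mul_symInf_le (hQ : CasimirAssumptions Q C₁ C₂ F₀ μ₁ μ₂ μ₃)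
    {m M : ℝ} (hM : 0 < M) (hmM : m ≤ M) {f : Phase → ℝ} (hf : f ∈ symMassClass Q m) :
    (m / M) ^ (1 + 1 / (1 - μ₃)) * symInf Q M ≤ energyCasimir Q f := by
  obtain ⟨k0, k1⟩ := hQ.μ₃_mem
  set α := 1 / (1 - μ₃) with hα
  have hα0 : 0 < α := by rw [hα]; apply one_div_pos.2; linarith
  have hα' : α * (1 - μ₃) = 1 := by rw [hα]; exact one_div_mul_cancel (by linarith)
  have hm0 : 0 ≤ m := by rw [← hf.1.2.2.1]; exact integral_nonneg_of_ae hf.1.2.1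
  rcases hm0.eq_or_lt with h | hm
  · have hz : f =ᵐ[volume] fun _ => 0 := by
      have := (integral_eq_zero_iff_of_nonneg_ae hf.1.2.1 hf.1.1).1 (hf.1.2.2.1.trans h.symm)
      exact this
    rw [energyCasimir_congr hz, ← h, zero_div, Real.zero_rpow (by positivity), zero_mul]
    simp [energyCasimir, posPart, Ekin, casimir, Epot, rho, hQ.zero]
  -- The powers of `t = M / m` are chosen so that all three terms of the functional are
  -- multiplied by at most `t ^ (1 + α)` and the mass by `t`.
  set t := M / m with ht
  have ht0 : 0 < t := by positivity
  have ht1 : 1 ≤ t := by rw [ht, one_le_div hm]; exact hmM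
  set a := t ^ (α * μ₃) with ha
  set b := t ^ (α - 1) with hb
  set c := t ^ (-(α / 2)) with hc
  have ha1 : 1 ≤ a := Real.one_le_rpow ht1 (by positivity)
  have hb0 : 0 < b := by positivity
  have hc0 : 0 < c := by positivity
  have hb2 : (b ^ 2)⁻¹ = t ^ (-(2 * (α - 1))) := by
    rw [hb, ← Real.rpow_natCast, ← Real.rpow_mul ht0.le, ← Real.rpow_neg ht0.le]
    congr 1; push_cast; ring
  have hc2 : (c ^ 2)⁻¹ = t ^ α := by
    rw [hc, ← Real.rpow_natCast, ← Real.rpow_mul ht0.le, ← Real.rpow_neg ht0.le]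
    congr 1; push_cast; ring
  have hmass : a * (b ^ 2)⁻¹ * (c ^ 2)⁻¹ = t := by
    rw [hb2, hc2, ha, ← Real.rpow_add ht0, ← Real.rpow_add ht0]
    conv_rhs => rw [← Real.rpow_one t]
    congr 1; linarith
  have hT : t ^ (1 + α) = t * t ^ α := by rw [Real.rpow_add ht0, Real.rpow_one]
  obtain ⟨g1, g2⟩ := hQ.rescale_mem ha1 hb0.ne' hc0.ne' hf
  have hgM : a * (b ^ 2)⁻¹ * (c ^ 2)⁻¹ * m = M := by
    rw [hmass, ht]; field_simp
  rw [hgM] at g1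
  have hle := hQ.symInf_le g1
  have eK : Ekin (rescale a b c f) = t ^ (1 + α) * Ekin f := by
    rw [Ekin_rescale hb0.ne' hc0.ne', hmass, hc2, hT]
  have eP : Epot (rescale a b c f) = t ^ (1 + α) * Epot f := by
    rw [Epot_rescale hb0, hmass, hb, sq, mul_assoc t t, ← Real.rpow_one_add' ht0.le, hT]
    · norm_num
    · norm_num; positivity
  have eC : casimir Q (rescale a b c f) ≤ t ^ (1 + α) * casimir Q f := by
    have : (b ^ 2)⁻¹ * (c ^ 2)⁻¹ * a ^ (1 + 1 / μ₃) = t ^ (1 + α) := by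
      rw [hb2, hc2, ha, ← Real.rpow_mul ht0.le, ← Real.rpow_add ht0, ← Real.rpow_add ht0]
      congr 1
      have : α * μ₃ * (1 + 1 / μ₃) = α * μ₃ + α := by field_simp
      linarith
    rw [← this]; exact g2
  have hD : symInf Q M ≤ t ^ (1 + α) * energyCasimir Q f := by
    refine hle.trans ?_
    simp only [energyCasimir, posPart] at *
    rw [eK, eP]
    linarith
  have e : (m / M) ^ (1 + α) = (t ^ (1 + α))⁻¹ := by
    rw [← Real.inv_rpow ht0.le, ht, inv_div]
  rw [e, inv_mul_le_iff₀ (by positivity)]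
  exact hD

lemma CasimirAssumptions.exists_isAlphaConstant
    (hQ : CasimirAssumptions Q C₁ C₂ F₀ μ₁ μ₂ μ₃) : ∃ Cα, IsAlphaConstant μ₃ Cα := by
  obtain ⟨k0, k1⟩ := hQ.μ₃_mem
  have hα : 1 ≤ 1 / (1 - μ₃) := by rw [le_div_iff₀ (by linarith)]; linarith
  -- As the exponent is at least `2`, the left side is at most `(1-x)² + x² - 1 = -2 (1-x) x`.
  have key : ∀ y ∈ Set.Icc (0 : ℝ) 1, y ^ (1 + 1 / (1 - μ₃)) ≤ y ^ 2 := by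
    intro y hy
    rw [← Real.rpow_natCast]
    exact Real.rpow_le_rpow_of_exponent_ge_of_imp hy.1 hy.2 (by push_cast; linarith)
      (fun _ h => by exfalso; linarith)
  refine ⟨-2, by norm_num, fun x hx => ?_⟩
  have h1 := key x hx
  have h2 := key (1 - x) ⟨by linarith [hx.2], by linarith [hx.1]⟩
  nlinarith

end Scaling

/-! ### Negativity of the infimum -/

lemma ae_fst_ne_snd : ∀ᵐ p : Plane × Plane, p.1 ≠ p.2 := by
  have h : ∀ᵐ x : Plane, x ≠ 0 := by simp [ae_iff, measure_singleton]
  have h1 : ∀ᵐ p : Plane × Plane, p.1 ≠ 0 := Measure.quasiMeasurePreserving_fst.ae h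
  have := (measurePreserving_sub_prod (volume : Measure Plane)
    (volume : Measure Plane)).quasiMeasurePreserving.ae h1
  filter_upwards [this] with p hp
  exact sub_ne_zero.1 hp

section TestFunction

variable {Q : ℝ → ℝ} {C₁ C₂ F₀ μ₁ μ₂ μ₃ : ℝ}

/-- The phase space density with constant value `c` on the product of the discs of radius `R` in
space and `w` in velocity. -/
def plateau (c R w : ℝ) : Phase → ℝ :=
  (Metric.ball (0 : Plane) R ×ˢ Metric.ball (0 : Plane) w).indicator fun _ => c

lemma measurableSet_discs (R w : ℝ) :
    MeasurableSet (Metric.ball (0 : Plane) R ×ˢ Metric.ball (0 : Plane) w) :=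
  Metric.isOpen_ball.measurableSet.prod Metric.isOpen_ball.measurableSet

lemma volume_discs_lt_top (R w : ℝ) :
    volume (Metric.ball (0 : Plane) R ×ˢ Metric.ball (0 : Plane) w) < ⊤ := by
  rw [Measure.volume_eq_prod, Measure.prod_prod]
  exact ENNReal.mul_lt_top measure_ball_lt_top measure_ball_lt_top

lemma volume_real_discs {R w : ℝ} (hR : 0 ≤ R) (hw : 0 ≤ w) :
    volume.real (Metric.ball (0 : Plane) R ×ˢ Metric.ball (0 : Plane) w)
      = (Real.pi * R ^ 2) * (Real.pi * w ^ 2) := by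
  rw [Measure.volume_eq_prod, Measure.real, Measure.prod_prod, ENNReal.toReal_mul]
  exact congrArg₂ _ (volume_real_ball _ hR) (volume_real_ball _ hw)

lemma integrable_indicator_discs (R w k : ℝ) :
    Integrable ((Metric.ball (0 : Plane) R ×ˢ Metric.ball (0 : Plane) w).indicator fun _ => k) :=
  (integrable_indicator_iff (measurableSet_discs R w)).2
    (integrableOn_const (volume_discs_lt_top R w).ne)

lemma integral_indicator_discs {R w : ℝ} (hR : 0 ≤ R) (hw : 0 ≤ w) (k : ℝ) :
    ∫ z, (Metric.ball (0 : Plane) R ×ˢ Metric.ball (0 : Plane) w).indicator (fun _ => k) z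
      = (Real.pi * R ^ 2) * (Real.pi * w ^ 2) * k := by
  rw [integral_indicator (measurableSet_discs R w), setIntegral_const, volume_real_discs hR hw,
    smul_eq_mul]

lemma plateau_nonneg {c : ℝ} (hc : 0 ≤ c) (R w : ℝ) (z : Phase) : 0 ≤ plateau c R w z :=
  Set.indicator_nonneg (fun _ _ => hc) z

lemma comp_plateau (h0 : Q 0 = 0) (c R w : ℝ) (z : Phase) : Q (plateau c R w z) =
    (Metric.ball (0 : Plane) R ×ˢ Metric.ball (0 : Plane) w).indicator (fun _ => Q c) z := by
  unfold plateau
  by_cases h : z ∈ Metric.ball (0 : Plane) R ×ˢ Metric.ball (0 : Plane) w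
  · simp only [Set.indicator_of_mem h]
  · simp only [Set.indicator_of_notMem h, h0]

lemma sq_norm_mul_plateau_le {c : ℝ} (hc : 0 ≤ c) (R w : ℝ) (z : Phase) :
    ‖z.2‖ ^ 2 * plateau c R w z ≤ w ^ 2 * plateau c R w z := by
  unfold plateau
  by_cases h : z ∈ Metric.ball (0 : Plane) R ×ˢ Metric.ball (0 : Plane) w
  · simp only [Set.indicator_of_mem h]
    have : ‖z.2‖ < w := by simpa using h.2
    gcongr
  · simp only [Set.indicator_of_notMem h]; simp

lemma integrable_sq_norm_mul_plateau {c : ℝ} (hc : 0 ≤ c) (R w : ℝ) :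
    Integrable (fun z : Phase => ‖z.2‖ ^ 2 * plateau c R w z) := by
  have hi : Integrable (plateau c R w) := integrable_indicator_discs R w c
  refine (hi.const_mul (w ^ 2)).mono' ?_ (ae_of_all _ fun z => ?_)
  · exact (by fun_prop : Measurable fun z : Phase => ‖z.2‖ ^ 2).aestronglyMeasurable.mul
      hi.aestronglyMeasurable
  · rw [Real.norm_of_nonneg (mul_nonneg (sq_nonneg _) (plateau_nonneg hc R w z))]
    exact sq_norm_mul_plateau_le hc R w z

lemma CasimirAssumptions.plateau_mem (hQ : CasimirAssumptions Q C₁ C₂ F₀ μ₁ μ₂ μ₃)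
    {c R w : ℝ} (hc : 0 ≤ c) (hR : 0 ≤ R) (hw : 0 ≤ w) :
    plateau c R w ∈ symMassClass Q ((Real.pi * R ^ 2) * (Real.pi * w ^ 2) * c) := by
  refine ⟨⟨integrable_indicator_discs R w c, ae_of_all _ (plateau_nonneg hc R w),
    integral_indicator_discs hR hw c, integrable_sq_norm_mul_plateau hc R w, ?_⟩, ?_⟩
  · simp only [comp_plateau hQ.zero]
    exact integrable_indicator_discs R w _
  · intro A hA
    refine ae_of_all _ fun z => ?_
    simp only [plateau, Set.indicator, Set.mem_prod, mem_ball_zero_iff, norm_act hA]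

lemma rho_plateau {c R w : ℝ} (hw : 0 ≤ w) (x : Plane) : rho (plateau c R w) x =
    (Metric.ball (0 : Plane) R).indicator (fun _ => Real.pi * w ^ 2 * c) x := by
  by_cases h : x ∈ Metric.ball (0 : Plane) R
  · have e : ∀ v, plateau c R w (x, v) = (Metric.ball (0 : Plane) w).indicator (fun _ => c) v := by
      intro v
      unfold plateau
      by_cases hv : v ∈ Metric.ball (0 : Plane) w
      · rw [Set.indicator_of_mem hv, Set.indicator_of_mem (Set.mk_mem_prod h hv)]
      · rw [Set.indicator_of_notMem hv, Set.indicator_of_notMem fun h' => hv h'.2]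
    simp only [rho, e, Set.indicator_of_mem h]
    rw [integral_indicator Metric.isOpen_ball.measurableSet, setIntegral_const,
      volume_real_ball _ hw, smul_eq_mul]
  · have e : ∀ v, plateau c R w (x, v) = 0 := by
      intro v
      simp only [plateau, Set.indicator, Set.prodMk_mem_set_prod_eq, h, false_and, if_false]
    simp [rho, e, Set.indicator_of_notMem h]

/-- The points of a disc of radius `R` have distances below `2 R`, so that the potential energy of
a plateau of mass `m` is at most `-m² / (4 R)`. -/
lemma CasimirAssumptions.energyCasimir_plateau_le
    (hQ : CasimirAssumptions Q C₁ C₂ F₀ μ₁ μ₂ μ₃) {c R w m : ℝ} (hc : 0 ≤ c) (hR : 0 < R)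
    (hw : 0 ≤ w) (hm : (Real.pi * R ^ 2) * (Real.pi * w ^ 2) * c = m) :
    energyCasimir Q (plateau c R w) ≤
      1 / 2 * w ^ 2 * m + (Real.pi * R ^ 2) * (Real.pi * w ^ 2) * Q c - m ^ 2 / (4 * R) := by
  have hmem := hQ.plateau_mem hc hR.le hw
  rw [hm] at hmem
  have hi := hmem.1.1
  have hk : Ekin (plateau c R w) ≤ 1 / 2 * w ^ 2 * m := by
    have := integral_mono (integrable_sq_norm_mul_plateau hc R w) (hi.const_mul (w ^ 2))
      (sq_norm_mul_plateau_le hc R w)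
    rw [integral_const_mul, hmem.1.2.2.1] at this
    unfold Ekin
    linarith
  have hcas : casimir Q (plateau c R w) = (Real.pi * R ^ 2) * (Real.pi * w ^ 2) * Q c := by
    simp only [casimir, comp_plateau hQ.zero]
    exact integral_indicator_discs hR.le hw _
  have hfin := hQ.epotFinite hmem.1
  have hpot : m ^ 2 / (2 * R) ≤ interaction (rho (plateau c R w)) (rho (plateau c R w)) := by
    have i2 : Integrable (fun p : Plane × Plane =>
        1 / (2 * R) * (rho (plateau c R w) p.1 * rho (plateau c R w) p.2)) :=
      ((integrable_rho hi).mul_prod (integrable_rho hi)).const_mul _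
    have e2 : ∫ p : Plane × Plane,
        1 / (2 * R) * (rho (plateau c R w) p.1 * rho (plateau c R w) p.2) = m ^ 2 / (2 * R) := by
      rw [integral_const_mul]
      have : ∫ p : Plane × Plane, rho (plateau c R w) p.1 * rho (plateau c R w) p.2
          = (∫ x, rho (plateau c R w) x) * ∫ x, rho (plateau c R w) x := integral_prod_mul _ _
      rw [this, integral_rho hi, hmem.1.2.2.1]; ring
    rw [← e2]
    refine integral_mono_ae i2 hfin ?_
    filter_upwards [ae_fst_ne_snd] with p hp
    have hp' : 0 < ‖p.1 - p.2‖ := norm_pos_iff.2 (sub_ne_zero.2 hp)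
    simp only [rho_plateau hw]
    by_cases h1 : p.1 ∈ Metric.ball (0 : Plane) R
    · by_cases h2 : p.2 ∈ Metric.ball (0 : Plane) R
      · have h3 : ‖p.1 - p.2‖ ≤ 2 * R := by
          have := norm_sub_le p.1 p.2
          rw [mem_ball_zero_iff] at h1 h2
          linarith
        simp only [Set.indicator_of_mem h1, Set.indicator_of_mem h2]
        rw [one_div_mul_eq_div]
        gcongr
      · simp [Set.indicator_of_notMem h2]
    · simp [Set.indicator_of_notMem h1]
  have hE := Epot_eq_interaction hfin
  have e : m ^ 2 / (4 * R) = 1 / 2 * (m ^ 2 / (2 * R)) := by field_simp; norm_num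
  simp only [energyCasimir, posPart]
  rw [hE, hcas, e]
  linarith

/-- Widely spread plateaus of small height have negative energy: with radius proportional to `1/c`
and `w²` proportional to `c`, the kinetic and the potential energy are proportional to `c`, while
`∬ Q(f) = O(c^{1/μ₂})` with `1/μ₂ > 1`. -/
lemma CasimirAssumptions.symInf_neg (hQ : CasimirAssumptions Q C₁ C₂ F₀ μ₁ μ₂ μ₃) {M : ℝ}
    (hM : 0 < M) : symInf Q M < 0 := by
  obtain ⟨h0, h1⟩ := hQ.μ₂_mem
  have hπ := Real.pi_pos
  have hC := hQ.C₂_pos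
  have hp : 0 < 1 / μ₂ - 1 := by
    rw [sub_pos, lt_div_iff₀ h0]; linarith
  have hlim : Tendsto (fun c : ℝ => C₂ * c ^ (1 / μ₂ - 1)) (𝓝[>] 0) (𝓝 0) := by
    have h : Tendsto (fun c : ℝ => C₂ * c ^ (1 / μ₂ - 1)) (𝓝 0) (𝓝 (C₂ * 0 ^ (1 / μ₂ - 1))) :=
      ((Real.continuousAt_rpow_const 0 _ (Or.inr hp.le)).tendsto).const_mul C₂
    rw [Real.zero_rpow hp.ne', mul_zero] at h
    exact h.mono_left nhdsWithin_le_nhds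
  have hlt : (0 : ℝ) < M * Real.pi ^ 2 / 32 := by positivity
  obtain ⟨c, ⟨hc1, hc2⟩, hc0⟩ := ((hlim.eventually_lt_const hlt).and
    ((eventually_lt_nhds hQ.F₀_pos).filter_mono nhdsWithin_le_nhds)).and
    (self_mem_nhdsWithin : Set.Ioi (0 : ℝ) ∈ 𝓝[>] 0) |>.exists
  have hc0 : 0 < c := hc0
  set R := 4 / (Real.pi ^ 2 * c) with hR
  have hR0 : 0 < R := by positivity
  set w := √(M * Real.pi ^ 2 * c / 16) with hw
  have hw2 : w ^ 2 = M * Real.pi ^ 2 * c / 16 := Real.sq_sqrt (by positivity)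
  have hm : (Real.pi * R ^ 2) * (Real.pi * w ^ 2) * c = M := by
    rw [hw2, hR]; field_simp; norm_num
  have hmem := hQ.plateau_mem hc0.le hR0.le (Real.sqrt_nonneg _ : 0 ≤ w)
  rw [hm] at hmem
  have hle := hQ.energyCasimir_plateau_le hc0.le hR0 (Real.sqrt_nonneg _ : 0 ≤ w) hm
  refine (hQ.symInf_le hmem).trans_lt (hle.trans_lt ?_)
  have hQc := hQ.Q2 c hc0.le hc2.le
  have e1 : c ^ (1 + 1 / μ₂) = c * (c * c ^ (1 / μ₂ - 1)) := by
    rw [show 1 + 1 / μ₂ = 1 + (1 + (1 / μ₂ - 1)) by ring, Real.rpow_add hc0, Real.rpow_add hc0,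
      Real.rpow_one]
  rw [e1] at hQc
  have e2 : (Real.pi * R ^ 2) * (Real.pi * w ^ 2) = M / c := by
    rw [eq_div_iff hc0.ne', hm]
  have h3 : M / c * Q c ≤ M * c * (C₂ * c ^ (1 / μ₂ - 1)) := by
    calc M / c * Q c ≤ M / c * (C₂ * (c * (c * c ^ (1 / μ₂ - 1)))) := by gcongr
      _ = _ := by field_simp
  have h4 : M * c * (C₂ * c ^ (1 / μ₂ - 1)) < M * c * (M * Real.pi ^ 2 / 32) := by gcongr
  have e3 : M ^ 2 / (4 * R) = M * c * (M * Real.pi ^ 2 / 16) := by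
    rw [hR]; field_simp; norm_num
  rw [e2, e3, hw2]
  linarith

end TestFunction

/-! ### The potential of a radial density outside of a disc -/

/-- The rotation by the angle `θ`. -/
def rotMatrix (θ : ℝ) : Matrix (Fin 2) (Fin 2) ℝ :=
  !![Real.cos θ, -Real.sin θ; Real.sin θ, Real.cos θ]

lemma rotMatrix_mem (θ : ℝ) : rotMatrix θ ∈ Matrix.specialOrthogonalGroup (Fin 2) ℝ := by
  have h := Real.sin_sq_add_cos_sq θ
  rw [Matrix.mem_specialOrthogonalGroup_iff, Matrix.mem_orthogonalGroup_iff]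
  constructor
  · ext i j
    fin_cases i <;> fin_cases j <;>
      simp [rotMatrix, Matrix.mul_apply, Fin.sum_univ_two] <;> nlinarith
  · simp only [rotMatrix, Matrix.det_fin_two_of]; nlinarith

lemma act_rotMatrix (θ : ℝ) (x : Plane) : act (rotMatrix θ) x =
    !₂[Real.cos θ * x 0 - Real.sin θ * x 1, Real.sin θ * x 0 + Real.cos θ * x 1] := by
  ext i
  fin_cases i <;>
    simp [act, rotMatrix, dotProduct, Fin.sum_univ_two, sub_eq_add_neg]

lemma continuous_act_rotMatrix : Continuous fun p : ℝ × Plane => act (rotMatrix p.1) p.2 := by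
  simp only [act_rotMatrix]
  refine (PiLp.continuous_toLp 2 _).comp (continuous_pi fun i => ?_)
  fin_cases i <;> simp <;> fun_prop

lemma exists_add_eq_mul_cos (a b : ℝ) :
    ∃ θ₀, ∀ θ, a * Real.cos θ + b * Real.sin θ = √(a ^ 2 + b ^ 2) * Real.cos (θ - θ₀) := by
  refine ⟨Complex.arg ⟨a, b⟩, fun θ => ?_⟩
  have h1 := Complex.norm_mul_cos_arg ⟨a, b⟩
  have h2 := Complex.norm_mul_sin_arg ⟨a, b⟩
  rw [Complex.norm_eq_sqrt_sq_add_sq] at h1 h2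
  simp only at h1 h2
  rw [Real.cos_sub]
  linear_combination (-Real.cos θ) * h1 - Real.sin θ * h2

lemma exists_norm_act_sub (x y : Plane) : ∃ θ₀, ∀ θ, ‖act (rotMatrix θ) x - y‖ =
    √(‖x‖ ^ 2 + ‖y‖ ^ 2 - 2 * ‖x‖ * ‖y‖ * Real.cos (θ - θ₀)) := by
  obtain ⟨θ₀, h⟩ := exists_add_eq_mul_cos (x 0 * y 0 + x 1 * y 1) (x 0 * y 1 - x 1 * y 0)
  refine ⟨θ₀, fun θ => ?_⟩
  have hx : ‖x‖ ^ 2 = x 0 ^ 2 + x 1 ^ 2 := by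
    rw [EuclideanSpace.real_norm_sq_eq, Fin.sum_univ_two]
  have hy : ‖y‖ ^ 2 = y 0 ^ 2 + y 1 ^ 2 := by
    rw [EuclideanSpace.real_norm_sq_eq, Fin.sum_univ_two]
  have h1 : √((x 0 * y 0 + x 1 * y 1) ^ 2 + (x 0 * y 1 - x 1 * y 0) ^ 2) = ‖x‖ * ‖y‖ := by
    rw [← Real.sqrt_sq (by positivity : 0 ≤ ‖x‖ * ‖y‖), mul_pow, hx, hy]
    congr 1; ring
  have h2 := h θ
  rw [h1] at h2
  rw [← Real.sqrt_sq (norm_nonneg (act (rotMatrix θ) x - y))]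
  congr 1
  rw [EuclideanSpace.real_norm_sq_eq, Fin.sum_univ_two, act_rotMatrix]
  simp only [PiLp.sub_apply, Matrix.cons_val_zero, Matrix.cons_val_one]
  rw [hx, hy]
  have h3 := Real.sin_sq_add_cos_sq θ
  linear_combination (-2) * h2 + (x 0 ^ 2 + x 1 ^ 2) * h3

/-- Lower bound of the distance of the points with polar coordinates `(s, 0)` and `(r, φ)`: it is
at least `r - s` and at least a multiple of `r φ`. -/
lemma rpow_mul_rpow_le_dist {s r φ : ℝ} (hs : 0 ≤ s) (hsr : s < r) (h0 : 0 ≤ φ)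
    (hπ : φ ≤ Real.pi) : (r - s) ^ (1 / 6 : ℝ) * (r * φ / (2 * Real.pi)) ^ (5 / 6 : ℝ) ≤
      √(s ^ 2 + r ^ 2 - 2 * s * r * Real.cos φ) := by
  have hp := Real.pi_pos
  have hr : 0 < r := hs.trans_lt hsr
  have hd : 0 < r - s := sub_pos.2 hsr
  set D := √(s ^ 2 + r ^ 2 - 2 * s * r * Real.cos φ) with hD
  have hcos := Real.cos_le_one_sub_mul_cos_sq (x := φ) (by rw [abs_of_nonneg h0]; exact hπ)
  have hc1 := Real.cos_le_one φ
  have hsr0 : 0 ≤ s * r := mul_nonneg hs hr.le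
  have b1 : r - s ≤ D := by
    refine Real.le_sqrt_of_sq_le ?_
    nlinarith
  have b2 : r * φ / (2 * Real.pi) ≤ D := by
    rcases le_total (r / 2) s with h | h
    · refine Real.le_sqrt_of_sq_le ?_
      have e : (r * φ / (2 * Real.pi)) ^ 2 = r ^ 2 * (1 / Real.pi ^ 2 * φ ^ 2) / 4 := by
        field_simp; norm_num
      set q := 1 / Real.pi ^ 2 * φ ^ 2 with hq
      have hq0 : 0 ≤ q := by positivity
      have hcos' : Real.cos φ ≤ 1 - 2 * q := by
        have : 2 / Real.pi ^ 2 * φ ^ 2 = 2 * q := by rw [hq]; ring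
        linarith
      rw [e]
      have h1 : s * r * Real.cos φ ≤ s * r * (1 - 2 * q) := by gcongr
      have h2 : r ^ 2 / 2 * q ≤ s * r * q := by
        have : r ^ 2 / 2 ≤ s * r := by nlinarith
        gcongr
      nlinarith [sq_nonneg (r - s), mul_nonneg (sq_nonneg r) hq0]
    · have : r * φ / (2 * Real.pi) ≤ r * Real.pi / (2 * Real.pi) := by gcongr
      have e : r * Real.pi / (2 * Real.pi) = r / 2 := by field_simp
      linarith
  have hD0 : 0 < D := hd.trans_le b1
  calc _ ≤ D ^ (1 / 6 : ℝ) * D ^ (5 / 6 : ℝ) := by gcongr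
    _ = D := by rw [← Real.rpow_add hD0]; norm_num

/-- The constant in the bound of the angular average of the Coulomb kernel. -/
def angularConst : ℝ := 12 * (2 * Real.pi) ^ (5 / 6 : ℝ) * Real.pi ^ (1 / 6 : ℝ)

lemma angularConst_pos : 0 < angularConst := by
  have := Real.pi_pos
  unfold angularConst; positivity

lemma dist_sq_pos {s r : ℝ} (hs : 0 ≤ s) (hsr : s < r) (φ : ℝ) :
    0 < s ^ 2 + r ^ 2 - 2 * s * r * Real.cos φ := by
  have hc1 := Real.cos_le_one φ
  have hsr0 : 0 ≤ s * r := mul_nonneg hs (hs.trans hsr.le)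
  nlinarith [mul_pos (sub_pos.2 hsr) (sub_pos.2 hsr)]

/-- The angular average of `1/|x - y|` for `|x| = s < |y| = r`. The average is less singular
at `s = r` than the kernel itself. -/
lemma integral_inv_dist_le {s r : ℝ} (hs : 0 ≤ s) (hsr : s < r) :
    ∫ φ in (-Real.pi)..Real.pi, 1 / √(s ^ 2 + r ^ 2 - 2 * s * r * Real.cos φ) ≤
      angularConst * (r ^ (-(5 / 6) : ℝ) * (r - s) ^ (-(1 / 6) : ℝ)) := by
  have hp := Real.pi_pos
  have hr : 0 < r := hs.trans_lt hsr
  have hd : 0 < r - s := sub_pos.2 hsr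
  set F : ℝ → ℝ := fun φ => 1 / √(s ^ 2 + r ^ 2 - 2 * s * r * Real.cos φ) with hF
  have hFc : Continuous F := by
    refine continuous_const.div (by fun_prop) fun φ => ?_
    exact (Real.sqrt_pos.2 (dist_sq_pos hs hsr φ)).ne'
  have hFi : ∀ a b, IntervalIntegrable F volume a b := fun a b => hFc.intervalIntegrable a b
  have e1 : ∫ φ in (-Real.pi)..0, F φ = ∫ φ in (0 : ℝ)..Real.pi, F φ := by
    have := intervalIntegral.integral_comp_neg (a := 0) (b := Real.pi) F
    rw [neg_zero] at this
    rw [← this]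
    simp only [hF, Real.cos_neg]
  have hi : IntervalIntegrable (fun φ : ℝ => φ ^ (-(5 / 6) : ℝ)) volume 0 Real.pi :=
    intervalIntegral.intervalIntegrable_rpow' (by norm_num)
  set k := r ^ (-(5 / 6) : ℝ) * (r - s) ^ (-(1 / 6) : ℝ) * (2 * Real.pi) ^ (5 / 6 : ℝ) with hk
  have e2 : ∫ φ in (0 : ℝ)..Real.pi, F φ ≤ ∫ φ in (0 : ℝ)..Real.pi, k * φ ^ (-(5 / 6) : ℝ) := by
    refine intervalIntegral.integral_mono_on_of_le_Ioo hp.le (hFi _ _) (hi.const_mul k) ?_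
    intro φ hφ
    have h := rpow_mul_rpow_le_dist hs hsr hφ.1.le hφ.2.le
    have hφ0 := hφ.1
    have : 1 / √(s ^ 2 + r ^ 2 - 2 * s * r * Real.cos φ) ≤
        1 / ((r - s) ^ (1 / 6 : ℝ) * (r * φ / (2 * Real.pi)) ^ (5 / 6 : ℝ)) :=
      one_div_le_one_div_of_le (by positivity) h
    refine this.trans_eq ?_
    rw [hk, Real.rpow_neg hr.le, Real.rpow_neg hd.le, Real.rpow_neg hφ0.le,
      Real.div_rpow (by positivity) (by positivity), Real.mul_rpow hr.le hφ0.le]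
    have : 0 < r ^ (5 / 6 : ℝ) := by positivity
    have : 0 < φ ^ (5 / 6 : ℝ) := by positivity
    have : 0 < (r - s) ^ (1 / 6 : ℝ) := by positivity
    field_simp
  rw [intervalIntegral.integral_const_mul, integral_rpow (Or.inl (by norm_num)),
    Real.zero_rpow (by norm_num)] at e2
  rw [← intervalIntegral.integral_add_adjacent_intervals (hFi (-Real.pi) 0) (hFi 0 Real.pi), e1]
  have e3 : (Real.pi ^ (-(5 / 6) + 1 : ℝ) - 0) / (-(5 / 6) + 1) = 6 * Real.pi ^ (1 / 6 : ℝ) := by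
    norm_num; ring
  rw [e3] at e2
  unfold angularConst
  rw [hk] at e2
  linarith

lemma act_sub_ne_zero {x y : Plane} (h : ‖x‖ < ‖y‖) (θ : ℝ) : act (rotMatrix θ) x - y ≠ 0 := by
  intro h0
  have : ‖act (rotMatrix θ) x‖ = ‖y‖ := by rw [sub_eq_zero.1 h0]
  rw [norm_act (rotMatrix_mem θ)] at this
  exact h.ne this

lemma continuous_inv_norm_act_sub {x y : Plane} (h : ‖x‖ < ‖y‖) :
    Continuous fun θ => 1 / ‖act (rotMatrix θ) x - y‖ := by
  refine continuous_const.div ?_ fun θ => norm_ne_zero_iff.2 (act_sub_ne_zero h θ)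
  have : Continuous fun θ => act (rotMatrix θ) x :=
    Continuous.comp (f := fun θ : ℝ => (θ, x)) continuous_act_rotMatrix (by fun_prop)
  fun_prop

lemma integral_inv_norm_act_sub_le {x y : Plane} (h : ‖x‖ < ‖y‖) :
    ∫ θ in (0 : ℝ)..(2 * Real.pi), 1 / ‖act (rotMatrix θ) x - y‖ ≤
      angularConst * (‖y‖ ^ (-(5 / 6) : ℝ) * (‖y‖ - ‖x‖) ^ (-(1 / 6) : ℝ)) := by
  obtain ⟨θ₀, hθ⟩ := exists_norm_act_sub x y
  set F : ℝ → ℝ := fun φ => 1 / √(‖x‖ ^ 2 + ‖y‖ ^ 2 - 2 * ‖x‖ * ‖y‖ * Real.cos φ) with hF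
  have hper : Function.Periodic F (2 * Real.pi) := fun φ => by
    simp only [hF, Real.cos_add_two_pi]
  have e : ∀ θ, 1 / ‖act (rotMatrix θ) x - y‖ = F (θ - θ₀) := fun θ => by rw [hθ θ]
  simp only [e]
  rw [intervalIntegral.integral_comp_sub_right, zero_sub,
    show 2 * Real.pi - θ₀ = -θ₀ + 2 * Real.pi by ring,
    hper.intervalIntegral_add_eq (-θ₀) (-Real.pi),
    show -Real.pi + 2 * Real.pi = Real.pi by ring]
  exact integral_inv_dist_le (norm_nonneg x) h

/-- The function `(r - |x|)^{-1/2}` on the annulus `r - 1 < |x| < r`. -/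
def annulusWeight (r : ℝ) : ℝ → ℝ :=
  (Set.Ioo (r - 1) r).indicator fun s => (r - s) ^ (-(1 / 2) : ℝ)

lemma annulusWeight_nonneg (r s : ℝ) : 0 ≤ annulusWeight r s :=
  Set.indicator_nonneg (fun _ hs => Real.rpow_nonneg (sub_nonneg.2 hs.2.le) _) s

lemma integrable_annulusWeight (r : ℝ) :
    Integrable (annulusWeight r) ∧ ∫ s, annulusWeight r s = 2 := by
  have hi : IntervalIntegrable (fun u : ℝ => u ^ (-(1 / 2) : ℝ)) volume 1 0 :=
    intervalIntegral.intervalIntegrable_rpow' (by norm_num)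
  have hle : r - 1 ≤ r := by linarith
  constructor
  · unfold annulusWeight
    rw [integrable_indicator_iff measurableSet_Ioo,
      ← intervalIntegrable_iff_integrableOn_Ioo_of_le hle]
    have := hi.comp_sub_left r
    rwa [sub_zero] at this
  · unfold annulusWeight
    rw [integral_indicator measurableSet_Ioo, ← integral_Ioc_eq_integral_Ioo,
      ← intervalIntegral.integral_of_le hle,
      intervalIntegral.integral_comp_sub_left (fun u : ℝ => u ^ (-(1 / 2) : ℝ)) r,
      integral_rpow (Or.inl (by norm_num))]
    norm_num

lemma integrable_annulusWeight_norm {r : ℝ} (hr : 0 < r) :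
    Integrable (fun x : Plane => annulusWeight r ‖x‖) ∧
      ∫ x : Plane, annulusWeight r ‖x‖ ≤ 4 * Real.pi * r := by
  obtain ⟨h1, h2⟩ := integrable_annulusWeight r
  have hb : ∀ s ∈ Set.Ioi (0 : ℝ), s ^ (2 - 1) • annulusWeight r s ≤ r * annulusWeight r s := by
    intro s hs
    rw [show (2 - 1 : ℕ) = 1 from rfl, pow_one, smul_eq_mul]
    by_cases h : s ∈ Set.Ioo (r - 1) r
    · have := annulusWeight_nonneg r s
      have := h.2.le
      gcongr
    · simp [annulusWeight, Set.indicator_of_notMem h]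
  have hi : IntegrableOn (fun s => s ^ (2 - 1) • annulusWeight r s) (Set.Ioi 0) := by
    refine (h1.const_mul r).integrableOn.mono' ?_ ?_
    · exact (continuous_pow _).aestronglyMeasurable.smul h1.aestronglyMeasurable.restrict
    · filter_upwards [self_mem_ae_restrict measurableSet_Ioi] with s hs
      have hs' : 0 ≤ s := le_of_lt hs
      rw [Real.norm_of_nonneg (smul_nonneg (by positivity) (annulusWeight_nonneg r s))]
      exact hb s hs
  constructor
  · rw [integrable_fun_norm_addHaar, finrank_euclideanSpace_fin]
    exact hi
  · rw [integral_fun_norm_addHaar, finrank_euclideanSpace_fin, volume_real_ball _ zero_le_one]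
    have h3 : ∫ s in Set.Ioi (0 : ℝ), s ^ (2 - 1) • annulusWeight r s ≤ r * 2 := by
      calc _ ≤ ∫ s in Set.Ioi (0 : ℝ), r * annulusWeight r s :=
            setIntegral_mono_on hi (h1.const_mul r).integrableOn measurableSet_Ioi hb
        _ ≤ ∫ s, r * annulusWeight r s := setIntegral_le_integral (h1.const_mul r)
            (ae_of_all _ fun s => mul_nonneg hr.le (annulusWeight_nonneg r s))
        _ = r * 2 := by rw [integral_const_mul, h2]
    have hp := Real.pi_pos
    simp only [smul_eq_mul, nsmul_eq_mul, Nat.cast_ofNat] at h3 ⊢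
    nlinarith

lemma mul_le_add_rpow {a h τ : ℝ} (ha : 0 ≤ a) (hh : 0 ≤ h) (hτ : 0 < τ) :
    a * h ≤ τ * a ^ (3 / 2 : ℝ) + (τ ^ 2)⁻¹ * h ^ 3 := by
  have e : a ^ (3 / 2 : ℝ) = a * √a := by
    rcases ha.eq_or_lt with rfl | ha'
    · rw [Real.zero_rpow (by norm_num), zero_mul]
    · rw [show (3 / 2 : ℝ) = 1 + 1 / 2 by norm_num, Real.rpow_add ha', Real.rpow_one,
        Real.sqrt_eq_rpow]
  have hs := Real.sqrt_nonneg a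
  have hs2 := Real.sq_sqrt ha
  rw [e]
  rcases le_total h (τ * √a) with h1 | h1
  · have : a * h ≤ a * (τ * √a) := by gcongr
    have : 0 ≤ (τ ^ 2)⁻¹ * h ^ 3 := by positivity
    linarith
  · have h2 : a ≤ (τ ^ 2)⁻¹ * h ^ 2 := by
      rw [le_inv_mul_iff₀ (by positivity)]
      calc τ ^ 2 * a = (τ * √a) ^ 2 := by rw [mul_pow, hs2]
        _ ≤ h ^ 2 := by gcongr
    have h3 : a * h ≤ (τ ^ 2)⁻¹ * h ^ 2 * h := by gcongr
    have : 0 ≤ τ * (a * √a) := by positivity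
    have : (τ ^ 2)⁻¹ * h ^ 2 * h = (τ ^ 2)⁻¹ * h ^ 3 := by ring
    linarith

/-- Splitting of `ρ (r - |x|)^{-1/6}` by Young's inequality, with the parameter `r^{1/3}` that
balances the terms after integration. Where `r - |x| ≥ 1` one also has `r ≥ 1`. -/
lemma mul_rpow_le {a s r : ℝ} (ha : 0 ≤ a) (hs : 0 ≤ s) (hsr : s < r) :
    a * (r - s) ^ (-(1 / 6) : ℝ) ≤ r ^ (1 / 3 : ℝ) * (a ^ (3 / 2 : ℝ) + a) +
      r ^ (-(2 / 3) : ℝ) * annulusWeight r s := by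
  have hr : 0 < r := hs.trans_lt hsr
  have hd : 0 < r - s := sub_pos.2 hsr
  have hw := annulusWeight_nonneg r s
  rcases lt_or_ge (r - s) 1 with h | h
  · have h1 := mul_le_add_rpow ha (Real.rpow_nonneg hd.le (-(1 / 6) : ℝ))
      (Real.rpow_pos_of_pos hr (1 / 3 : ℝ))
    have e1 : ((r ^ (1 / 3 : ℝ)) ^ 2)⁻¹ = r ^ (-(2 / 3) : ℝ) := by
      rw [← Real.rpow_natCast, ← Real.rpow_mul hr.le, ← Real.rpow_neg hr.le]; norm_num
    have e2 : ((r - s) ^ (-(1 / 6) : ℝ)) ^ 3 = annulusWeight r s := by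
      rw [annulusWeight, Set.indicator_of_mem (show s ∈ Set.Ioo (r - 1) r from ⟨by linarith, hsr⟩),
        ← Real.rpow_natCast, ← Real.rpow_mul hd.le]
      norm_num
    rw [e1, e2] at h1
    have : 0 ≤ r ^ (1 / 3 : ℝ) * a := by positivity
    linarith
  · have h1 : (r - s) ^ (-(1 / 6) : ℝ) ≤ 1 :=
      Real.rpow_le_one_of_one_le_of_nonpos h (by norm_num)
    have h2 : 1 ≤ r ^ (1 / 3 : ℝ) := Real.one_le_rpow (by linarith) (by norm_num)
    have h3 : a * (r - s) ^ (-(1 / 6) : ℝ) ≤ a * 1 := by gcongr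
    have h4 : 1 * a ≤ r ^ (1 / 3 : ℝ) * a := by gcongr
    have : 0 ≤ r ^ (1 / 3 : ℝ) * a ^ (3 / 2 : ℝ) := by positivity
    have : 0 ≤ r ^ (-(2 / 3) : ℝ) * annulusWeight r s := by positivity
    linarith

/-- The constant in the bound of the potential of a radial density. -/
def radialConst (M S : ℝ) : ℝ := angularConst * (S + M + 4 * Real.pi) / (2 * Real.pi)

/-- The potential at `y` of a rotation invariant density, restricted to the disc of radius `|y|`, is
`O(|y|^{-1/2})`. By invariance the Coulomb kernel may be replaced by its average over rotations. -/
lemma IsDensity.lintegral_potential_le {ρ : Plane → ℝ} {M S : ℝ} (hρ : IsDensity ρ M S)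
    (hinv : ∀ A ∈ Matrix.specialOrthogonalGroup (Fin 2) ℝ, ∀ᵐ x, ρ (act A x) = ρ x) {y : Plane}
    (hy : 0 < ‖y‖) : ∫⁻ x in Metric.ball (0 : Plane) ‖y‖,
      ENNReal.ofReal (ρ x) * ENNReal.ofReal (1 / ‖x - y‖) ≤
        ENNReal.ofReal (radialConst M S * ‖y‖ ^ (-(1 / 2) : ℝ)) := by
  set r := ‖y‖ with hr
  have hp := Real.pi_pos
  set B := Metric.ball (0 : Plane) r with hB
  have hBm : MeasurableSet B := Metric.isOpen_ball.measurableSet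
  set L := ∫⁻ x in B, ENNReal.ofReal (ρ x) * ENNReal.ofReal (1 / ‖x - y‖) with hL
  have hrot : ∀ θ, L = ∫⁻ x in B, ENNReal.ofReal (ρ x) *
      ENNReal.ofReal (1 / ‖act (rotMatrix θ) x - y‖) := by
    intro θ
    have hA := rotMatrix_mem θ
    have mp := (rotation _ hA).measurePreserving
    have := mp.lintegral_comp_emb (rotation _ hA).toHomeomorph.measurableEmbedding
      (B.indicator fun x => ENNReal.ofReal (ρ x) * ENNReal.ofReal (1 / ‖x - y‖))
    rw [lintegral_indicator hBm] at this
    rw [hL, ← this, ← lintegral_indicator hBm]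
    refine lintegral_congr_ae ?_
    filter_upwards [hinv _ hA] with x hx
    have hmem : act (rotMatrix θ) x ∈ B ↔ x ∈ B := by
      rw [hB, mem_ball_zero_iff, mem_ball_zero_iff, norm_act hA]
    rw [rotation_apply]
    by_cases hxB : x ∈ B
    · rw [Set.indicator_of_mem hxB, Set.indicator_of_mem (hmem.2 hxB), hx]
    · rw [Set.indicator_of_notMem hxB, Set.indicator_of_notMem (hxB ∘ hmem.1)]
  have hconst : ENNReal.ofReal (2 * Real.pi) * L = ∫⁻ _ in Set.Ioc (0 : ℝ) (2 * Real.pi), L := by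
    rw [setLIntegral_const, Real.volume_Ioc, sub_zero, mul_comm]
  have hswap : ENNReal.ofReal (2 * Real.pi) * L = ∫⁻ x in B, ∫⁻ θ in Set.Ioc (0 : ℝ) (2 * Real.pi),
      ENNReal.ofReal (ρ x) * ENNReal.ofReal (1 / ‖act (rotMatrix θ) x - y‖) := by
    rw [hconst, lintegral_congr fun θ => hrot θ]
    refine lintegral_lintegral_swap ?_
    have h1 : AEMeasurable (fun x => ENNReal.ofReal (ρ x)) (volume.restrict B) :=
      hρ.integrable.aestronglyMeasurable.aemeasurable.ennreal_ofReal.restrict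
    have h2 : Measurable fun p : ℝ × Plane => ENNReal.ofReal (1 / ‖act (rotMatrix p.1) p.2 - y‖) :=
      (measurable_const.div (continuous_act_rotMatrix.measurable.sub
        measurable_const).norm).ennreal_ofReal
    exact h1.comp_snd.mul h2.aemeasurable
  set H : Plane → ℝ := fun x => angularConst * r ^ (-(5 / 6) : ℝ) *
    (r ^ (1 / 3 : ℝ) * (ρ x ^ (3 / 2 : ℝ) + ρ x) +
      r ^ (-(2 / 3) : ℝ) * annulusWeight r ‖x‖) with hH
  have hC := angularConst_pos
  obtain ⟨w1, w2⟩ := integrable_annulusWeight_norm hy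
  have j1 : Integrable (fun x => r ^ (1 / 3 : ℝ) * (ρ x ^ (3 / 2 : ℝ) + ρ x)) :=
    (hρ.integrable_rpow.add hρ.integrable).const_mul _
  have j2 : Integrable (fun x : Plane => r ^ (-(2 / 3) : ℝ) * annulusWeight r ‖x‖) :=
    w1.const_mul _
  have hHi : Integrable H := (j1.add j2).const_mul _
  have hH0 : ∀ᵐ x, 0 ≤ H x := by
    filter_upwards [hρ.nonneg] with x hx
    have := annulusWeight_nonneg r ‖x‖
    positivity
  have hbd : ∀ᵐ x, x ∈ B → ∫⁻ θ in Set.Ioc (0 : ℝ) (2 * Real.pi),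
      ENNReal.ofReal (ρ x) * ENNReal.ofReal (1 / ‖act (rotMatrix θ) x - y‖) ≤
        ENNReal.ofReal (H x) := by
    filter_upwards [hρ.nonneg] with x hx hxB
    rw [hB, mem_ball_zero_iff] at hxB
    have hc := continuous_inv_norm_act_sub (x := x) (y := y) hxB
    have h2π : (0 : ℝ) ≤ 2 * Real.pi := by positivity
    rw [lintegral_const_mul _ hc.measurable.ennreal_ofReal,
      ← ofReal_integral_eq_lintegral_ofReal
        ((intervalIntegrable_iff_integrableOn_Ioc_of_le h2π).1 (hc.intervalIntegrable _ _))
        (ae_of_all _ fun θ => by positivity),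
      ← ENNReal.ofReal_mul hx, ← intervalIntegral.integral_of_le h2π]
    refine ENNReal.ofReal_le_ofReal ?_
    have h1 := integral_inv_norm_act_sub_le (x := x) (y := y) hxB
    have h2 := mul_rpow_le hx (norm_nonneg x) hxB
    calc _ ≤ ρ x * (angularConst * (r ^ (-(5 / 6) : ℝ) * (r - ‖x‖) ^ (-(1 / 6) : ℝ))) := by
          gcongr
      _ = angularConst * r ^ (-(5 / 6) : ℝ) * (ρ x * (r - ‖x‖) ^ (-(1 / 6) : ℝ)) := by ring
      _ ≤ H x := mul_le_mul_of_nonneg_left h2 (by positivity)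
  have hint : ∫ x, H x ≤ angularConst * (S + M + 4 * Real.pi) * r ^ (-(1 / 2) : ℝ) := by
    rw [hH, integral_const_mul, integral_add j1 j2, integral_const_mul, integral_const_mul,
      integral_add hρ.integrable_rpow hρ.integrable]
    have e1 : r ^ (-(5 / 6) : ℝ) * r ^ (1 / 3 : ℝ) = r ^ (-(1 / 2) : ℝ) := by
      rw [← Real.rpow_add hy]; norm_num
    have e2 : r ^ (-(5 / 6) : ℝ) * (r ^ (-(2 / 3) : ℝ) * r) = r ^ (-(1 / 2) : ℝ) := by
      rw [← Real.rpow_add_one hy.ne', ← Real.rpow_add hy]; norm_num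
    calc _ ≤ angularConst * r ^ (-(5 / 6) : ℝ) * (r ^ (1 / 3 : ℝ) * (S + M) +
          r ^ (-(2 / 3) : ℝ) * (4 * Real.pi * r)) := by
          have := hρ.rpow_le
          have := hρ.mass_le
          gcongr
      _ = angularConst * ((r ^ (-(5 / 6) : ℝ) * r ^ (1 / 3 : ℝ)) * (S + M) +
          (r ^ (-(5 / 6) : ℝ) * (r ^ (-(2 / 3) : ℝ) * r)) * (4 * Real.pi)) := by ring
      _ = _ := by rw [e1, e2]; ring
  have hfin : ENNReal.ofReal (2 * Real.pi) * L ≤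
      ENNReal.ofReal (angularConst * (S + M + 4 * Real.pi) * r ^ (-(1 / 2) : ℝ)) := by
    rw [hswap]
    calc _ ≤ ∫⁻ x in B, ENNReal.ofReal (H x) := setLIntegral_mono_ae' hBm hbd
      _ ≤ ∫⁻ x, ENNReal.ofReal (H x) := setLIntegral_le_lintegral _ _
      _ = ENNReal.ofReal (∫ x, H x) := (ofReal_integral_eq_lintegral_ofReal hHi hH0).symm
      _ ≤ _ := ENNReal.ofReal_le_ofReal hint
  have e : radialConst M S * r ^ (-(1 / 2) : ℝ) =
      (angularConst * (S + M + 4 * Real.pi) * r ^ (-(1 / 2) : ℝ)) / (2 * Real.pi) := by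
    unfold radialConst; ring
  rw [e, ENNReal.ofReal_div_of_pos (by positivity),
    ENNReal.le_div_iff_mul_le (Or.inl (by simpa using hp)) (Or.inl ENNReal.ofReal_ne_top), mul_comm]
  exact hfin

/-! ### The splitting estimate -/

lemma AxiallySymmetric.rho_act {f : Phase → ℝ} (hs : AxiallySymmetric f)
    {A : Matrix (Fin 2) (Fin 2) ℝ} (hA : A ∈ Matrix.specialOrthogonalGroup (Fin 2) ℝ) :
    ∀ᵐ x, rho f (act A x) = rho f x := by
  have := Measure.ae_ae_of_ae_prod (μ := (volume : Measure Plane))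
    (ν := (volume : Measure Plane)) (hs A hA)
  filter_upwards [this] with x hx
  have h := (rotation A hA).measurePreserving.integral_comp
    (rotation A hA).toHomeomorph.measurableEmbedding (fun v => f (act A x, v))
  exact h.symm.trans (integral_congr_ae hx)

lemma IsDensity.indicator {ρ : Plane → ℝ} {M S : ℝ} (hρ : IsDensity ρ M S) {E : Set Plane}
    (hE : MeasurableSet E) : IsDensity (E.indicator ρ) M S := by
  have h0 : ∀ᵐ x, 0 ≤ E.indicator ρ x := by
    filter_upwards [hρ.nonneg] with x hx
    exact Set.indicator_nonneg (s := E) (f := fun _ => ρ x) (fun _ _ => hx) x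
  have e : (fun x => E.indicator ρ x ^ (3 / 2 : ℝ)) = E.indicator fun x => ρ x ^ (3 / 2 : ℝ) := by
    funext x
    by_cases h : x ∈ E
    · simp only [Set.indicator_of_mem h]
    · simp only [Set.indicator_of_notMem h]
      exact Real.zero_rpow (by norm_num)
  refine ⟨hρ.integrable.indicator hE, h0, ?_, ?_, ?_⟩
  · rw [integral_indicator hE]
    exact (setIntegral_le_integral hρ.integrable hρ.nonneg).trans hρ.mass_le
  · rw [e]; exact hρ.integrable_rpow.indicator hE
  · rw [e, integral_indicator hE]
    exact (setIntegral_le_integral hρ.integrable_rpow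
      (hρ.nonneg.mono fun _ hx => Real.rpow_nonneg hx _)).trans hρ.rpow_le

lemma interaction_comm (ρ σ : Plane → ℝ) : interaction ρ σ = interaction σ ρ := by
  have h := integral_prod_swap (μ := (volume : Measure Plane)) (ν := (volume : Measure Plane))
    (fun p : Plane × Plane => σ p.1 * ρ p.2 / ‖p.1 - p.2‖)
  unfold interaction
  refine Eq.trans (integral_congr_ae (ae_of_all _ fun p => ?_)) h
  simp only [Prod.fst_swap, Prod.snd_swap, norm_sub_rev p.2 p.1, mul_comm]

/-- The interaction of the parts of a rotation invariant density inside and outside of a disc of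
radius `R` is at most `O(R^{-1/2})` times the outer mass. -/
lemma IsDensity.cross_le {ρ : Plane → ℝ} {M S : ℝ} (hρ : IsDensity ρ M S)
    (hinv : ∀ A ∈ Matrix.specialOrthogonalGroup (Fin 2) ℝ, ∀ᵐ x, ρ (act A x) = ρ x) {R : ℝ}
    (hR : 0 < R) :
    interaction ({x : Plane | ‖x‖ < R}.indicator ρ) ({x : Plane | R < ‖x‖}.indicator ρ) ≤
      radialConst M S / √R * ∫ x in {x : Plane | R < ‖x‖}, ρ x := by
  have hm1 : MeasurableSet {x : Plane | ‖x‖ < R} := measurableSet_lt measurable_norm measurable_const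
  have hm2 : MeasurableSet {x : Plane | R < ‖x‖} := measurableSet_lt measurable_const measurable_norm
  have d1 := hρ.indicator hm1
  have d2 := hρ.indicator hm2
  have hi := d1.integrable_interaction d2
  have hK : 0 ≤ radialConst M S := by
    have := angularConst_pos
    have := hρ.S_nonneg
    have := hρ.M_nonneg
    have := Real.pi_pos
    unfold radialConst; positivity
  have hkey : ∀ y : Plane, R < ‖y‖ →
      ∫ x, {x : Plane | ‖x‖ < R}.indicator ρ x / ‖x - y‖ ≤ radialConst M S / √R := by
    intro y hy
    have hy0 : 0 < ‖y‖ := hR.trans hy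
    have n0 : ∀ᵐ x : Plane, 0 ≤ {x : Plane | ‖x‖ < R}.indicator ρ x / ‖x - y‖ :=
      d1.nonneg.mono fun x hx => div_nonneg hx (norm_nonneg _)
    have ms : AEStronglyMeasurable
        (fun x : Plane => {x : Plane | ‖x‖ < R}.indicator ρ x / ‖x - y‖) volume :=
      d1.integrable.aestronglyMeasurable.mul
        ((measurable_id.sub measurable_const).norm.inv).aestronglyMeasurable
    rw [integral_eq_lintegral_of_nonneg_ae n0 ms]
    have h1 : ∫⁻ x : Plane, ENNReal.ofReal ({x : Plane | ‖x‖ < R}.indicator ρ x / ‖x - y‖) ≤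
        ∫⁻ x in Metric.ball (0 : Plane) ‖y‖,
          ENNReal.ofReal (ρ x) * ENNReal.ofReal (1 / ‖x - y‖) := by
      rw [← lintegral_indicator Metric.isOpen_ball.measurableSet]
      refine lintegral_mono fun x => ?_
      by_cases hx : x ∈ {x : Plane | ‖x‖ < R}
      · have hx' : x ∈ Metric.ball (0 : Plane) ‖y‖ := by
          rw [mem_ball_zero_iff]; exact lt_trans hx hy
        rw [Set.indicator_of_mem hx, Set.indicator_of_mem hx', div_eq_mul_one_div,
          ENNReal.ofReal_mul' (by positivity)]
      · rw [Set.indicator_of_notMem hx]; simp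
    have h2 := h1.trans (hρ.lintegral_potential_le hinv hy0)
    refine (ENNReal.toReal_le_of_le_ofReal (by positivity) h2).trans ?_
    rw [Real.rpow_neg (norm_nonneg _), ← Real.sqrt_eq_rpow, ← div_eq_mul_inv]
    gcongr
  have e2 : ∫ x in {x : Plane | R < ‖x‖}, ρ x = ∫ x, {x : Plane | R < ‖x‖}.indicator ρ x :=
    (integral_indicator hm2).symm
  unfold interaction
  rw [Measure.volume_eq_prod, integral_prod_symm _ hi, e2, ← integral_const_mul]
  refine integral_mono_ae hi.integral_prod_right (d2.integrable.const_mul _) ?_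
  filter_upwards [d2.nonneg] with y hy0
  have e : ∀ x : Plane, {x : Plane | ‖x‖ < R}.indicator ρ x * {x : Plane | R < ‖x‖}.indicator ρ y
      / ‖x - y‖ = {x : Plane | R < ‖x‖}.indicator ρ y *
        ({x : Plane | ‖x‖ < R}.indicator ρ x / ‖x - y‖) := fun x => by ring
  simp only [e, integral_const_mul]
  by_cases hy : R < ‖y‖
  · rw [mul_comm]
    exact mul_le_mul_of_nonneg_right (hkey y hy) hy0
  · rw [Set.indicator_of_notMem (show y ∉ {x : Plane | R < ‖x‖} from hy), zero_mul, mul_zero]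

section Cutoff

variable {Q : ℝ → ℝ} {C₁ C₂ F₀ μ₁ μ₂ μ₃ : ℝ}

/-- The restriction of a phase space density to positions in `E`. -/
def cutoff (E : Set Plane) (f : Phase → ℝ) : Phase → ℝ := (Prod.fst ⁻¹' E).indicator f

lemma cutoff_of_mem {E : Set Plane} {f : Phase → ℝ} {z : Phase} (h : z.1 ∈ E) :
    cutoff E f z = f z := Set.indicator_of_mem (s := Prod.fst ⁻¹' E) h f

lemma cutoff_of_notMem {E : Set Plane} {f : Phase → ℝ} {z : Phase} (h : z.1 ∉ E) :
    cutoff E f z = 0 := Set.indicator_of_notMem (s := Prod.fst ⁻¹' E) h f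

lemma rho_cutoff (E : Set Plane) (f : Phase → ℝ) : rho (cutoff E f) = E.indicator (rho f) := by
  funext x
  by_cases h : x ∈ E
  · rw [Set.indicator_of_mem h]
    exact integral_congr_ae (ae_of_all _ fun v => cutoff_of_mem (z := (x, v)) h)
  · rw [Set.indicator_of_notMem h]
    have : ∀ v, cutoff E f (x, v) = 0 := fun v => cutoff_of_notMem (z := (x, v)) h
    simp [rho, this]

lemma cutoff_comp (E : Set Plane) (f : Phase → ℝ) {G : Phase → ℝ → ℝ} (hG : ∀ z, G z 0 = 0) :
    (fun z => G z (cutoff E f z)) = (Prod.fst ⁻¹' E).indicator fun z => G z (f z) := by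
  funext z
  by_cases h : z.1 ∈ E
  · rw [cutoff_of_mem h, Set.indicator_of_mem (show z ∈ Prod.fst ⁻¹' E from h)]
  · rw [cutoff_of_notMem h, Set.indicator_of_notMem (show z ∉ Prod.fst ⁻¹' E from h), hG]

lemma CasimirAssumptions.cutoff_mem (hQ : CasimirAssumptions Q C₁ C₂ F₀ μ₁ μ₂ μ₃) {M : ℝ}
    {f : Phase → ℝ} (hf : f ∈ symMassClass Q M) {E : Set Plane} (hE : MeasurableSet E)
    (hEs : ∀ A ∈ Matrix.specialOrthogonalGroup (Fin 2) ℝ, ∀ x, act A x ∈ E ↔ x ∈ E) :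
    cutoff E f ∈ symMassClass Q (∫ x in E, rho f x) := by
  obtain ⟨⟨h1, h0, hm, h3, h4⟩, hs⟩ := hf
  have hE' : MeasurableSet (Prod.fst ⁻¹' E : Set Phase) := measurable_fst hE
  have i1 : Integrable (cutoff E f) := h1.indicator hE'
  refine ⟨⟨i1, ?_, ?_, ?_, ?_⟩, ?_⟩
  · filter_upwards [h0] with z hz
    exact Set.indicator_nonneg (s := Prod.fst ⁻¹' E) (f := fun _ => f z) (fun _ _ => hz) z
  · rw [← integral_rho i1, rho_cutoff, integral_indicator hE]
  · rw [cutoff_comp E f (G := fun z s => ‖z.2‖ ^ 2 * s) (fun z => mul_zero _)]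
    exact h3.indicator hE'
  · rw [cutoff_comp E f (G := fun _ s => Q s) (fun _ => hQ.zero)]
    exact h4.indicator hE'
  · intro A hA
    filter_upwards [hs A hA] with z hz
    by_cases h : z.1 ∈ E
    · rw [cutoff_of_mem h, cutoff_of_mem (by exact (hEs A hA _).2 h), hz]
    · rw [cutoff_of_notMem h, cutoff_of_notMem (by exact fun h' => h ((hEs A hA _).1 h'))]

lemma integral_indicator_add_eq {α : Type*} [MeasurableSpace α] {μ : Measure α} {g : α → ℝ}
    (hg : Integrable g μ) {E₁ E₂ : Set α} (h1 : MeasurableSet E₁) (h2 : MeasurableSet E₂)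
    (hd : Disjoint E₁ E₂) (hu : ∀ᵐ x ∂μ, x ∈ E₁ ∪ E₂) :
    ∫ x, E₁.indicator g x ∂μ + ∫ x, E₂.indicator g x ∂μ = ∫ x, g x ∂μ := by
  rw [integral_indicator h1, integral_indicator h2, ← setIntegral_union hd h2 hg.integrableOn
    hg.integrableOn, Measure.restrict_eq_self_of_ae_mem hu]

lemma ae_norm_ne (R : ℝ) : ∀ᵐ x : Plane, ‖x‖ ≠ R := by
  have : (volume : Measure Plane) (Metric.sphere 0 R) = 0 := Measure.addHaar_sphere _ _ _
  refine measure_mono_null (fun x hx => ?_) this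
  rw [mem_sphere_zero_iff_norm]
  exact not_not.1 hx

lemma measurableSet_norm_lt (R : ℝ) : MeasurableSet {x : Plane | ‖x‖ < R} :=
  measurableSet_lt measurable_norm measurable_const

lemma measurableSet_lt_norm (R : ℝ) : MeasurableSet {x : Plane | R < ‖x‖} :=
  measurableSet_lt measurable_const measurable_norm

lemma disjoint_norm_lt_lt_norm (R : ℝ) :
    Disjoint {x : Plane | ‖x‖ < R} {x : Plane | R < ‖x‖} :=
  Set.disjoint_left.2 fun x (h1 : ‖x‖ < R) (h2 : R < ‖x‖) => lt_asymm h1 h2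

lemma ae_norm_lt_or_lt_norm (R : ℝ) :
    ∀ᵐ x : Plane, x ∈ {x : Plane | ‖x‖ < R} ∪ {x : Plane | R < ‖x‖} :=
  (ae_norm_ne R).mono fun _ hx => lt_or_gt_of_ne hx

lemma integral_norm_lt_add_lt_norm {ρ : Plane → ℝ} (hρ : Integrable ρ) (R : ℝ) :
    (∫ x in {x : Plane | ‖x‖ < R}, ρ x) + ∫ x in {x : Plane | R < ‖x‖}, ρ x = ∫ x, ρ x := by
  have h := integral_indicator_add_eq hρ (measurableSet_norm_lt R) (measurableSet_lt_norm R)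
    (disjoint_norm_lt_lt_norm R) (ae_norm_lt_or_lt_norm R)
  rwa [integral_indicator (measurableSet_norm_lt R), integral_indicator (measurableSet_lt_norm R)]
    at h

lemma CasimirAssumptions.posPart_cutoff_add (hQ : CasimirAssumptions Q C₁ C₂ F₀ μ₁ μ₂ μ₃)
    {M : ℝ} {f : Phase → ℝ} (hf : f ∈ massClass Q M) {E₁ E₂ : Set Plane} (h1 : MeasurableSet E₁)
    (h2 : MeasurableSet E₂) (hd : Disjoint E₁ E₂) (hu : ∀ᵐ x : Plane, x ∈ E₁ ∪ E₂) :
    posPart Q (cutoff E₁ f) + posPart Q (cutoff E₂ f) = posPart Q f := by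
  obtain ⟨-, -, -, h3, h4⟩ := hf
  have h1' : MeasurableSet (Prod.fst ⁻¹' E₁ : Set Phase) := measurable_fst h1
  have h2' : MeasurableSet (Prod.fst ⁻¹' E₂ : Set Phase) := measurable_fst h2
  have hd' : Disjoint (Prod.fst ⁻¹' E₁ : Set Phase) (Prod.fst ⁻¹' E₂) := hd.preimage _
  have hu' : ∀ᵐ z : Phase, z ∈ (Prod.fst ⁻¹' E₁ : Set Phase) ∪ Prod.fst ⁻¹' E₂ :=
    Measure.quasiMeasurePreserving_fst.ae hu
  have a1 := integral_indicator_add_eq h3 h1' h2' hd' hu'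
  have a2 := integral_indicator_add_eq h4 h1' h2' hd' hu'
  have c1 := cutoff_comp E₁ f (G := fun z s => ‖z.2‖ ^ 2 * s) (fun z => mul_zero _)
  have c2 := cutoff_comp E₂ f (G := fun z s => ‖z.2‖ ^ 2 * s) (fun z => mul_zero _)
  have c3 := cutoff_comp E₁ f (G := fun _ s => Q s) (fun _ => hQ.zero)
  have c4 := cutoff_comp E₂ f (G := fun _ s => Q s) (fun _ => hQ.zero)
  simp only [← c1, ← c2] at a1
  simp only [← c3, ← c4] at a2
  simp only [posPart, Ekin, casimir]
  rw [← a1, ← a2]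
  ring

lemma IsDensity.interaction_split {ρ : Plane → ℝ} {M S : ℝ} (hρ : IsDensity ρ M S)
    {E₁ E₂ : Set Plane} (h1 : MeasurableSet E₁) (h2 : MeasurableSet E₂) (hd : Disjoint E₁ E₂)
    (hu : ∀ᵐ x : Plane, x ∈ E₁ ∪ E₂) :
    interaction ρ ρ = interaction (E₁.indicator ρ) (E₁.indicator ρ) +
      interaction (E₂.indicator ρ) (E₂.indicator ρ) +
        2 * interaction (E₁.indicator ρ) (E₂.indicator ρ) := by
  have d1 := hρ.indicator h1
  have d2 := hρ.indicator h2
  have hsum : ∀ᵐ x, ρ x = E₁.indicator ρ x + E₂.indicator ρ x := by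
    filter_upwards [hu] with x hx
    have := congrFun (Set.indicator_union_of_disjoint hd ρ) x
    rw [Set.indicator_of_mem hx] at this
    exact this
  have n1 : ∀ᵐ p : Plane × Plane, ρ p.1 = E₁.indicator ρ p.1 + E₂.indicator ρ p.1 :=
    Measure.quasiMeasurePreserving_fst.ae hsum
  have n2 : ∀ᵐ p : Plane × Plane, ρ p.2 = E₁.indicator ρ p.2 + E₂.indicator ρ p.2 :=
    Measure.quasiMeasurePreserving_snd.ae hsum
  have i11 := d1.integrable_interaction d1
  have i22 := d2.integrable_interaction d2
  have i12 := d1.integrable_interaction d2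
  have i21 := d2.integrable_interaction d1
  have e : interaction ρ ρ = (interaction (E₁.indicator ρ) (E₁.indicator ρ) +
      interaction (E₂.indicator ρ) (E₂.indicator ρ)) +
        (interaction (E₁.indicator ρ) (E₂.indicator ρ) +
          interaction (E₂.indicator ρ) (E₁.indicator ρ)) := by
    unfold interaction
    rw [← integral_add' i11 i22, ← integral_add' i12 i21,
      ← integral_add' (i11.add i22) (i12.add i21)]
    refine integral_congr_ae ?_
    filter_upwards [n1, n2] with p p1 p2
    rw [p1, p2]
    simp only [Pi.add_apply]
    ring
  rw [e, interaction_comm (E₂.indicator ρ) (E₁.indicator ρ)]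
  ring

lemma CasimirAssumptions.exists_splitting (hQ : CasimirAssumptions Q C₁ C₂ F₀ μ₁ μ₂ μ₃) {M : ℝ}
    (hM : 0 < M) {Cα : ℝ} (hα : IsAlphaConstant μ₃ Cα) :
    ∃ CM, AreSplittingConstants Q M Cα CM := by
  obtain ⟨hα0, hα1⟩ := hα
  have hd := hQ.symInf_neg hM
  set d := symInf Q M with hd'
  obtain ⟨C, hC⟩ := hQ.exists_posPart_le M
  obtain ⟨C', -, hC'⟩ := hQ.exists_isDensity M one_pos
  -- Only densities with `D(f)` below the trivial upper bound of the left side matter; on these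
  -- `P(f)` is bounded, hence so are the spatial densities in `L^{3/2}`.
  set S := 2 * (d + Cα * d) + C + C' with hS
  refine ⟨max 1 (radialConst M S), hα0, by positivity, fun f hf R hR => ?_⟩
  set CM := max 1 (radialConst M S) with hCM
  have hCM0 : 0 < CM := by positivity
  set E₁ : Set Plane := {x | ‖x‖ < R} with hE₁
  set E₂ : Set Plane := {x | R < ‖x‖} with hE₂
  have hm1 : MeasurableSet E₁ := measurableSet_norm_lt R
  have hm2 : MeasurableSet E₂ := measurableSet_lt_norm R
  have hdis : Disjoint E₁ E₂ := disjoint_norm_lt_lt_norm R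
  have hu : ∀ᵐ x : Plane, x ∈ E₁ ∪ E₂ := ae_norm_lt_or_lt_norm R
  have hf1 := hQ.cutoff_mem hf hm1 (fun A hA x => by simp only [hE₁, Set.mem_ofPred_eq, norm_act hA])
  have hf2 := hQ.cutoff_mem hf hm2 (fun A hA x => by simp only [hE₂, Set.mem_ofPred_eq, norm_act hA])
  have hdens := hC' f hf.1
  set m₁ := ∫ x in E₁, rho f x with hm₁
  set m₂ := ∫ x in E₂, rho f x with hm₂
  have hm₁0 : 0 ≤ m₁ := by rw [← hf1.1.2.2.1]; exact integral_nonneg_of_ae hf1.1.2.1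
  have hm₂0 : 0 ≤ m₂ := by rw [← hf2.1.2.2.1]; exact integral_nonneg_of_ae hf2.1.2.1
  have hsum : m₁ + m₂ = M := by
    rw [hm₁, hm₂, integral_norm_lt_add_lt_norm (integrable_rho hf.1.1), integral_rho hf.1.1,
      hf.1.2.2.1]
  have hR' : 0 < √R := Real.sqrt_pos.2 hR
  rcases le_or_gt (d + Cα * d) (energyCasimir Q f) with hcase | hcase
  · have hCd : 0 < Cα * d := mul_pos_of_neg_of_neg hα0 hd
    have h1 : m₁ * m₂ ≤ M ^ 2 := by nlinarith
    have h2 : Cα * d / M ^ 2 * (m₁ * m₂) ≤ Cα * d / M ^ 2 * M ^ 2 := by gcongr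
    have h3 : Cα * d / M ^ 2 * M ^ 2 = Cα * d := by field_simp
    have h4 : 0 ≤ CM / √R * m₂ := by positivity
    nlinarith
  · have hP : posPart Q f ≤ 2 * (d + Cα * d) + C := by linarith [hC f hf.1]
    have hdS : IsDensity (rho f) M S := hdens.mono le_rfl (by rw [hS]; linarith)
    have hcross := hdS.cross_le (fun A hA => hf.2.rho_act hA) hR
    have hI := hdS.interaction_split hm1 hm2 hdis hu
    have hPs := hQ.posPart_cutoff_add hf.1 hm1 hm2 hdis hu
    have l1 := hQ.rpow_mul_symInf_le hM (by linarith) hf1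
    have l2 := hQ.rpow_mul_symInf_le hM (by linarith) hf2
    have p0 := Epot_eq_interaction (hQ.epotFinite hf.1)
    have p1 := Epot_eq_interaction (hQ.epotFinite hf1.1)
    have p2 := Epot_eq_interaction (hQ.epotFinite hf2.1)
    rw [rho_cutoff] at p1 p2
    have hD : energyCasimir Q f = energyCasimir Q (cutoff E₁ f) + energyCasimir Q (cutoff E₂ f)
        - interaction (E₁.indicator (rho f)) (E₂.indicator (rho f)) := by
      simp only [energyCasimir]
      rw [p0, p1, p2, hI, ← hPs]; ring
    have hx := hα1 (m₂ / M) ⟨by positivity, by rw [div_le_one hM]; linarith⟩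
    have e1 : 1 - m₂ / M = m₁ / M := by
      rw [← hsum]; field_simp [hsum ▸ hM.ne']; ring
    rw [e1] at hx
    have hx' := mul_le_mul_of_nonpos_left hx hd.le
    have hCM' : radialConst M S / √R * m₂ ≤ CM / √R * m₂ := by
      gcongr
      exact le_max_right _ _
    have e2 : (Cα * d / M ^ 2 * m₁ - CM / √R) * m₂ =
        d * (Cα * (m₁ / M) * (m₂ / M)) - CM / √R * m₂ := by
      field_simp
    rw [e2, hD]
    linarith

end Cutoff

/-! ### Weak limits in `L²` -/

section WeakLimits

variable {α : Type*} [MeasurableSpace α] {μ : Measure α}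

/-- Weak convergence in `L²`, tested against every element of `L²`. -/
def WeakTendstoL2 (μ : Measure α) (u : ℕ → α → ℝ) (u₀ : α → ℝ) : Prop :=
  ∀ g : α → ℝ, MemLp g 2 μ → Tendsto (fun n => ∫ x, u n x * g x ∂μ) atTop (𝓝 (∫ x, u₀ x * g x ∂μ))

/-- Bounded sequences in `L²` have weakly convergent subsequences. -/
theorem exists_weakTendstoL2 [MeasurableSpace.CountablyGenerated α] [SFinite μ] {u : ℕ → α → ℝ}
    (hu : ∀ n, MemLp (u n) 2 μ) {C : ℝ} (hC : ∀ n, ∫ x, u n x ^ 2 ∂μ ≤ C) :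
    ∃ u₀ : α → ℝ, StronglyMeasurable u₀ ∧ MemLp u₀ 2 μ ∧ ∃ φ : ℕ → ℕ, StrictMono φ ∧
      WeakTendstoL2 μ (fun k => u (φ k)) u₀ := by
  have : Fact ((2 : ENNReal) ≠ ⊤) := ⟨by norm_num⟩
  have : SecondCountableTopology (Lp ℝ 2 μ) := Lp.SecondCountableTopology
  have : TopologicalSpace.SeparableSpace (Lp ℝ 2 μ) := inferInstance
  have hinner : ∀ (v : Lp ℝ 2 μ) {g : α → ℝ} (hg : MemLp g 2 μ),
      inner ℝ v (hg.toLp g) = ∫ x, v x * g x ∂μ := by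
    intro v g hg
    rw [L2.inner_def]
    refine integral_congr_ae ?_
    filter_upwards [hg.coeFn_toLp] with x hx
    rw [hx]
    simp [mul_comm]
  have hinner' : ∀ {f g : α → ℝ} (hf : MemLp f 2 μ) (hg : MemLp g 2 μ),
      inner ℝ (hf.toLp f) (hg.toLp g) = ∫ x, f x * g x ∂μ := by
    intro f g hf hg
    rw [hinner]
    refine integral_congr_ae ?_
    filter_upwards [hf.coeFn_toLp] with x hx
    rw [hx]
  set Λ : ℕ → WeakDual ℝ (Lp ℝ 2 μ) := fun n =>
    StrongDual.toWeakDual (InnerProductSpace.toDual ℝ (Lp ℝ 2 μ) ((hu n).toLp (u n))) with hΛ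
  have hΛmem : ∀ n, Λ n ∈ WeakDual.toStrongDual ⁻¹'
      Metric.closedBall (0 : StrongDual ℝ (Lp ℝ 2 μ)) √C := by
    intro n
    rw [Set.mem_preimage, mem_closedBall_zero_iff]
    have e : WeakDual.toStrongDual (Λ n) =
        InnerProductSpace.toDual ℝ (Lp ℝ 2 μ) ((hu n).toLp (u n)) := rfl
    rw [e, LinearIsometryEquiv.norm_map]
    refine Real.le_sqrt_of_sq_le ?_
    rw [← real_inner_self_eq_norm_sq, hinner' (hu n) (hu n)]
    simpa only [sq] using hC n
  obtain ⟨Λ₀, -, φ, hφ, hlim⟩ := WeakDual.isSeqCompact_closedBall ℝ (Lp ℝ 2 μ) 0 √C hΛmem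
  set v := (InnerProductSpace.toDual ℝ (Lp ℝ 2 μ)).symm (WeakDual.toStrongDual Λ₀) with hv
  refine ⟨v, Lp.stronglyMeasurable v, Lp.memLp v, φ, hφ, fun g hg => ?_⟩
  have h1 := ((WeakDual.eval_continuous (𝕜 := ℝ) (hg.toLp g)).tendsto Λ₀).comp hlim
  have e0 : Λ₀ (hg.toLp g) = ∫ x, v x * g x ∂μ := by
    rw [← hinner v hg, hv, InnerProductSpace.toDual_symm_apply]; rfl
  rw [e0] at h1
  refine h1.congr fun k => ?_
  have : (Λ (φ k)) (hg.toLp g) = inner ℝ ((hu (φ k)).toLp (u (φ k))) (hg.toLp g) := rfl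
  simp only [Function.comp]
  rw [this, hinner']

lemma memLp_two_indicator {E : Set α} (hE : MeasurableSet E) (hμ : μ E < ⊤) {g : α → ℝ}
    (hg : AEStronglyMeasurable g μ) {C : ℝ} (hC : ∀ x ∈ E, |g x| ≤ C) :
    MemLp (E.indicator g) 2 μ := by
  rw [memLp_indicator_iff_restrict hE]
  have : IsFiniteMeasure (μ.restrict E) := ⟨by simpa using hμ⟩
  refine MemLp.of_bound hg.restrict C ?_
  filter_upwards [self_mem_ae_restrict hE] with x hx
  exact hC x hx

lemma WeakTendstoL2.setIntegral {u : ℕ → α → ℝ} {u₀ : α → ℝ} (h : WeakTendstoL2 μ u u₀) {E : Set α}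
    (hE : MeasurableSet E) (hμ : μ E < ⊤) {g : α → ℝ} (hg : AEStronglyMeasurable g μ) {C : ℝ}
    (hC : ∀ x ∈ E, |g x| ≤ C) :
    Tendsto (fun n => ∫ x in E, u n x * g x ∂μ) atTop (𝓝 (∫ x in E, u₀ x * g x ∂μ)) := by
  have e : ∀ w : α → ℝ, ∫ x in E, w x * g x ∂μ = ∫ x, w x * E.indicator g x ∂μ := by
    intro w
    rw [← integral_indicator hE]
    refine integral_congr_ae (ae_of_all _ fun x => ?_)
    by_cases hx : x ∈ E
    · simp only [Set.indicator_of_mem hx]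
    · simp only [Set.indicator_of_notMem hx, mul_zero]
  simp only [e]
  exact h _ (memLp_two_indicator hE hμ hg hC)

lemma WeakTendstoL2.setIntegral_one {u : ℕ → α → ℝ} {u₀ : α → ℝ} (h : WeakTendstoL2 μ u u₀)
    {E : Set α} (hE : MeasurableSet E) (hμ : μ E < ⊤) :
    Tendsto (fun n => ∫ x in E, u n x ∂μ) atTop (𝓝 (∫ x in E, u₀ x ∂μ)) := by
  have := h.setIntegral hE hμ (g := fun _ => 1) aestronglyMeasurable_const (C := 1)
    (fun _ _ => by simp)
  simpa using this

lemma integrableOn_of_memLp_two {u : α → ℝ} (hu : MemLp u 2 μ) {E : Set α} (hμ : μ E < ⊤) :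
    IntegrableOn u E μ := by
  have : IsFiniteMeasure (μ.restrict E) := ⟨by simpa using hμ⟩
  exact (hu.restrict E).integrable (by norm_num)

lemma WeakTendstoL2.nonneg [SigmaFinite μ] {u : ℕ → α → ℝ} {u₀ : α → ℝ}
    (h : WeakTendstoL2 μ u u₀) (h0 : ∀ n, ∀ᵐ x ∂μ, 0 ≤ u n x) (hu₀ : MemLp u₀ 2 μ) :
    ∀ᵐ x ∂μ, 0 ≤ u₀ x := by
  refine ae_nonneg_of_forall_setIntegral_nonneg_of_sigmaFinite
    (fun E _ hμ => integrableOn_of_memLp_two hu₀ hμ) fun E hE hμ => ?_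
  exact ge_of_tendsto' (h.setIntegral_one hE hμ) fun n =>
    integral_nonneg_of_ae (ae_restrict_of_ae (h0 n))

/-- Monotone convergence along a covering by sets on which the integrals are bounded. -/
lemma integrable_of_aecover {h : α → ℝ} (h0 : ∀ᵐ x ∂μ, 0 ≤ h x) {E : ℕ → Set α}
    (hE : AECover μ atTop E) (hi : ∀ k, IntegrableOn h (E k) μ) {I : ℝ}
    (hI : ∀ k, ∫ x in E k, h x ∂μ ≤ I) : Integrable h μ ∧ ∫ x, h x ∂μ ≤ I := by
  have hint := hE.integrable_of_integral_bounded_of_nonneg_ae I hi h0 (Eventually.of_forall hI)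
  exact ⟨hint, le_of_tendsto' (hE.integral_tendsto_of_countably_generated hint) hI⟩

/-- For nonnegative functions of the same mass, weak convergence in `L²` improves to convergence
against all bounded functions: no mass can escape, as the limit has the full mass. -/
lemma WeakTendstoL2.tendsto_bounded {u : ℕ → α → ℝ} {u₀ : α → ℝ} (h : WeakTendstoL2 μ u u₀)
    (h0 : ∀ n, ∀ᵐ x ∂μ, 0 ≤ u n x) (h0' : ∀ᵐ x ∂μ, 0 ≤ u₀ x) (hi : ∀ n, Integrable (u n) μ)
    (hi' : Integrable u₀ μ) {M : ℝ} (hm : ∀ n, ∫ x, u n x ∂μ = M) (hm' : ∫ x, u₀ x ∂μ = M)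
    {E : ℕ → Set α} (hE : AECover μ atTop E) (hμ : ∀ k, μ (E k) < ⊤) {g : α → ℝ}
    (hg : AEStronglyMeasurable g μ) {G : ℝ} (hG : ∀ x, |g x| ≤ G) :
    Tendsto (fun n => ∫ x, u n x * g x ∂μ) atTop (𝓝 (∫ x, u₀ x * g x ∂μ)) := by
  have tail : ∀ w : α → ℝ, (∀ᵐ x ∂μ, 0 ≤ w x) → Integrable w μ → ∫ x, w x ∂μ = M → ∀ k,
      |∫ x, w x * g x ∂μ - ∫ x in E k, w x * g x ∂μ| ≤ G * (M - ∫ x in E k, w x ∂μ) := by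
    intro w w0 wi wm k
    have wg : Integrable (fun x => w x * g x) μ := wi.mul_bdd hg (ae_of_all _ hG)
    have e1 := integral_add_compl (hE.measurableSet k) wg
    have e2 := integral_add_compl (hE.measurableSet k) wi
    rw [← e1, add_sub_cancel_left, ← wm, ← e2, add_sub_cancel_left, ← integral_const_mul]
    refine (norm_integral_le_integral_norm (μ := μ.restrict (E k)ᶜ) fun x => w x * g x).trans ?_
    refine integral_mono_ae wg.integrableOn.norm (wi.const_mul G).integrableOn ?_
    filter_upwards [ae_restrict_of_ae w0] with x hx
    rw [norm_mul, Real.norm_of_nonneg hx, mul_comm]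
    exact mul_le_mul_of_nonneg_right (hG x) hx
  rw [Metric.tendsto_atTop]
  intro ε hε
  -- As `G` could vanish, a positive bound on the errors is chosen with `|G| + 1`.
  set δ := ε / (4 * (|G| + 1)) with hδ
  have hG0 : 0 < |G| + 1 := by positivity
  have hδ0 : 0 < δ := by positivity
  have hlim := hE.integral_tendsto_of_countably_generated hi'
  rw [hm'] at hlim
  obtain ⟨k, hk⟩ := (hlim.eventually (lt_mem_nhds (show M - δ < M by linarith))).exists
  have t1 := h.setIntegral_one (hE.measurableSet k) (hμ k)
  have t2 := h.setIntegral (hE.measurableSet k) (hμ k) hg (C := G) (fun x _ => hG x)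
  obtain ⟨N, hN⟩ := eventually_atTop.1 ((t1.eventually (lt_mem_nhds hk)).and
    (t2.eventually (Metric.ball_mem_nhds _ (show 0 < ε / 2 by positivity))))
  refine ⟨N, fun n hn => ?_⟩
  obtain ⟨n1, n2⟩ := hN n hn
  rw [Real.dist_eq] at n2 ⊢
  have b1 := tail _ (h0 n) (hi n) (hm n) k
  have b2 := tail _ h0' hi' hm' k
  have hle : ∀ {t : ℝ}, M - δ < t → t ≤ M → G * (M - t) ≤ |G| * δ := by
    intro t ht htM
    calc G * (M - t) ≤ |G| * (M - t) :=
          mul_le_mul_of_nonneg_right (le_abs_self G) (by linarith)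
      _ ≤ |G| * δ := mul_le_mul_of_nonneg_left (by linarith) (abs_nonneg G)
  have c1 := hle n1 ((setIntegral_le_integral (hi n) (h0 n)).trans_eq (hm n))
  have c2 := hle hk ((setIntegral_le_integral hi' h0').trans_eq hm')
  have hGd : |G| * δ < ε / 4 := by
    have : (|G| + 1) * δ = ε / 4 := by rw [hδ]; field_simp
    nlinarith
  have b3 := abs_sub_le (∫ x, u n x * g x ∂μ) (∫ x in E k, u n x * g x ∂μ) (∫ x, u₀ x * g x ∂μ)
  have b4 := abs_sub_le (∫ x in E k, u n x * g x ∂μ) (∫ x in E k, u₀ x * g x ∂μ)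
    (∫ x, u₀ x * g x ∂μ)
  rw [abs_sub_comm (∫ x in E k, u₀ x * g x ∂μ)] at b4
  linarith

/-- For sequences bounded in `L^p`, convergence against bounded functions improves to convergence
against `L^q`, by truncation of the test function. -/
lemma tendsto_integral_mul_of_bounded {p q : ℝ} (hpq : p.HolderConjugate q) {u : ℕ → α → ℝ}
    {u₀ : α → ℝ} (h0 : ∀ n, ∀ᵐ x ∂μ, 0 ≤ u n x) (h0' : ∀ᵐ x ∂μ, 0 ≤ u₀ x)
    (hp : ∀ n, MemLp (u n) (ENNReal.ofReal p) μ) (hp' : MemLp u₀ (ENNReal.ofReal p) μ) {B : ℝ}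
    (hB : ∀ n, ∫ x, u n x ^ p ∂μ ≤ B) (hB' : ∫ x, u₀ x ^ p ∂μ ≤ B)
    (hb : ∀ g : α → ℝ, AEStronglyMeasurable g μ → (∃ G, ∀ x, |g x| ≤ G) →
      Tendsto (fun n => ∫ x, u n x * g x ∂μ) atTop (𝓝 (∫ x, u₀ x * g x ∂μ)))
    {g : α → ℝ} (hg : MemLp g (ENNReal.ofReal q) μ) :
    Tendsto (fun n => ∫ x, u n x * g x ∂μ) atTop (𝓝 (∫ x, u₀ x * g x ∂μ)) := by
  have hp1 : 0 < p := hpq.pos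
  have hq1 : 0 < q := hpq.symm.pos
  have hB0 : 0 ≤ B := (integral_nonneg_of_ae (h0'.mono fun x hx => Real.rpow_nonneg hx _)).trans hB'
  set T : ℕ → α → ℝ := fun k x => max (-(k : ℝ)) (min (g x) k) with hT
  have hTm : ∀ k, AEStronglyMeasurable (T k) μ := fun k =>
    (by fun_prop : Continuous fun s : ℝ => max (-(k : ℝ)) (min s k)).comp_aestronglyMeasurable
      hg.aestronglyMeasurable
  have hTb : ∀ k x, |T k x| ≤ k := fun k x => by
    have hk : (0 : ℝ) ≤ k := Nat.cast_nonneg k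
    rw [abs_le]
    exact ⟨le_max_left _ _, max_le (by linarith) (min_le_right _ _)⟩
  have hTg : ∀ k x, |T k x| ≤ |g x| := fun k x => by
    have hk : (0 : ℝ) ≤ k := Nat.cast_nonneg k
    rw [abs_le]
    constructor
    · exact le_max_of_le_right (le_min (neg_abs_le _) ((neg_nonpos.2 (abs_nonneg _)).trans hk))
    · exact max_le ((neg_nonpos.2 hk).trans (abs_nonneg _)) ((min_le_left _ _).trans (le_abs_self _))
  have hTq : ∀ k, MemLp (T k) (ENNReal.ofReal q) μ := fun k =>
    hg.mono (hTm k) (ae_of_all _ fun x => hTg k x)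
  have hTc : ∀ x, ∀ᶠ k : ℕ in atTop, T k x = g x := fun x => by
    filter_upwards [eventually_ge_atTop ⌈|g x|⌉₊] with k hk
    have : |g x| ≤ k := (Nat.le_ceil _).trans (by exact_mod_cast hk)
    rw [abs_le] at this
    simp only [hT]
    rw [min_eq_left this.2, max_eq_right this.1]
  have hgi : Integrable (fun x => |g x| ^ q) μ := by
    have := hg.integrable_norm_rpow (by simpa using hq1) ENNReal.ofReal_ne_top
    rwa [ENNReal.toReal_ofReal hq1.le] at this
  have hlim : Tendsto (fun k => ∫ x, |g x - T k x| ^ q ∂μ) atTop (𝓝 0) := by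
    have := tendsto_integral_of_dominated_convergence (μ := μ)
      (F := fun k x => |g x - T k x| ^ q) (f := fun _ => 0) (fun x => 2 ^ q * |g x| ^ q)
      (fun k => ?_) (hgi.const_mul _) (fun k => ae_of_all _ fun x => ?_)
      (ae_of_all _ fun x => ?_)
    · simpa using this
    · exact ((hg.aestronglyMeasurable.sub (hTm k)).norm.aemeasurable.pow_const
        q).aestronglyMeasurable
    · rw [Real.norm_of_nonneg (by positivity), ← Real.mul_rpow (by norm_num) (abs_nonneg _)]
      have h1 := abs_sub (g x) (T k x)
      have h2 := hTg k x
      gcongr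
      linarith
    · refine tendsto_const_nhds.congr' ?_
      filter_upwards [hTc x] with k hk
      rw [hk, sub_self, abs_zero, Real.zero_rpow hq1.ne']
  have hlim2 : Tendsto (fun k => B ^ (1 / p) * (∫ x, |g x - T k x| ^ q ∂μ) ^ (1 / q)) atTop
      (𝓝 0) := by
    have h1 : Tendsto (fun s : ℝ => B ^ (1 / p) * s ^ (1 / q)) (𝓝 0)
        (𝓝 (B ^ (1 / p) * 0 ^ (1 / q))) :=
      ((Real.continuousAt_rpow_const 0 _ (Or.inr (by positivity))).tendsto).const_mul _
    rw [Real.zero_rpow (by positivity), mul_zero] at h1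
    exact h1.comp hlim
  have tail : ∀ w : α → ℝ, (∀ᵐ x ∂μ, 0 ≤ w x) → MemLp w (ENNReal.ofReal p) μ →
      ∫ x, w x ^ p ∂μ ≤ B → ∀ k, |∫ x, w x * g x ∂μ - ∫ x, w x * T k x ∂μ| ≤
        B ^ (1 / p) * (∫ x, |g x - T k x| ^ q ∂μ) ^ (1 / q) := by
    intro w w0 wp wB k
    have : (ENNReal.ofReal p).HolderConjugate (ENNReal.ofReal q) := hpq.ennrealOfReal
    have i1 : Integrable (fun x => w x * g x) μ := wp.integrable_mul hg
    have i2 : Integrable (fun x => w x * T k x) μ := wp.integrable_mul (hTq k)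
    have hd : MemLp (fun x => |g x - T k x|) (ENNReal.ofReal q) μ := (hg.sub (hTq k)).norm
    rw [← integral_sub i1 i2]
    calc _ ≤ ∫ x, ‖w x * g x - w x * T k x‖ ∂μ := norm_integral_le_integral_norm _
      _ = ∫ x, w x * |g x - T k x| ∂μ := by
          refine integral_congr_ae ?_
          filter_upwards [w0] with x hx
          rw [← mul_sub, norm_mul, Real.norm_of_nonneg hx, Real.norm_eq_abs]
      _ ≤ (∫ x, w x ^ p ∂μ) ^ (1 / p) * (∫ x, |g x - T k x| ^ q ∂μ) ^ (1 / q) :=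
          integral_mul_le_Lp_mul_Lq_of_nonneg hpq w0 (ae_of_all _ fun x => abs_nonneg _) wp hd
      _ ≤ _ := by
          have : 0 ≤ ∫ x, w x ^ p ∂μ :=
            integral_nonneg_of_ae (w0.mono fun x hx => Real.rpow_nonneg hx _)
          have : 0 ≤ ∫ x, |g x - T k x| ^ q ∂μ := integral_nonneg fun x => by positivity
          gcongr
  rw [Metric.tendsto_atTop]
  intro ε hε
  obtain ⟨k, hk⟩ := (hlim2.eventually (gt_mem_nhds (show 0 < ε / 3 by positivity))).exists
  obtain ⟨N, hN⟩ := Metric.tendsto_atTop.1 (hb (T k) (hTm k) ⟨k, hTb k⟩) (ε / 3) (by positivity)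
  refine ⟨N, fun n hn => ?_⟩
  have n1 := hN n hn
  rw [Real.dist_eq] at n1 ⊢
  have b1 := tail _ (h0 n) (hp n) (hB n) k
  have b2 := tail _ h0' hp' hB' k
  have b3 := abs_sub_le (∫ x, u n x * g x ∂μ) (∫ x, u n x * T k x ∂μ) (∫ x, u₀ x * g x ∂μ)
  have b4 := abs_sub_le (∫ x, u n x * T k x ∂μ) (∫ x, u₀ x * T k x ∂μ) (∫ x, u₀ x * g x ∂μ)
  rw [abs_sub_comm (∫ x, u₀ x * T k x ∂μ)] at b4
  linarith

end WeakLimits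

/-! ### Continuity of the potential energy under weak convergence -/

/-- The probability measure with density `ρ / M`. -/
def densityMeasure (M : ℝ) (ρ : Plane → ℝ) : Measure Plane :=
  volume.withDensity fun x => ENNReal.ofReal (ρ x / M)

lemma isProbabilityMeasure_densityMeasure {ρ : Plane → ℝ} {M : ℝ} (hM : 0 < M)
    (hi : Integrable ρ) (h0 : ∀ᵐ x, 0 ≤ ρ x) (hm : ∫ x, ρ x = M) :
    IsProbabilityMeasure (densityMeasure M ρ) := by
  refine ⟨?_⟩
  rw [densityMeasure, withDensity_apply _ MeasurableSet.univ, Measure.restrict_univ,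
    ← ofReal_integral_eq_lintegral_ofReal (hi.div_const M)
    (h0.mono fun x hx => div_nonneg hx hM.le), integral_div, hm, div_self hM.ne',
    ENNReal.ofReal_one]

lemma aemeasurable_ofReal_div {ρ : Plane → ℝ} (hi : Integrable ρ) (M : ℝ) :
    AEMeasurable fun x => ENNReal.ofReal (ρ x / M) :=
  (hi.aestronglyMeasurable.aemeasurable.div_const M).ennreal_ofReal

lemma integral_densityMeasure {ρ : Plane → ℝ} {M : ℝ} (hM : 0 < M) (hi : Integrable ρ)
    (h0 : ∀ᵐ x, 0 ≤ ρ x) (F : Plane → ℝ) :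
    ∫ x, F x ∂(densityMeasure M ρ) = M⁻¹ * ∫ x, ρ x * F x := by
  rw [densityMeasure, integral_withDensity_eq_integral_toReal_smul₀ (aemeasurable_ofReal_div hi M)
    (ae_of_all _ fun _ => ENNReal.ofReal_lt_top), ← integral_const_mul]
  refine integral_congr_ae ?_
  filter_upwards [h0] with x hx
  rw [ENNReal.toReal_ofReal (div_nonneg hx hM.le), smul_eq_mul]
  ring

lemma integral_prod_densityMeasure {ρ σ : Plane → ℝ} {M : ℝ} (hM : 0 < M) (hi : Integrable ρ)
    (h0 : ∀ᵐ x, 0 ≤ ρ x) (hi' : Integrable σ) (h0' : ∀ᵐ x, 0 ≤ σ x) (F : Plane × Plane → ℝ) :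
    ∫ p, F p ∂((densityMeasure M ρ).prod (densityMeasure M σ)) =
      (M ^ 2)⁻¹ * ∫ p : Plane × Plane, ρ p.1 * σ p.2 * F p := by
  have a1 := aemeasurable_ofReal_div hi M
  have a2 := aemeasurable_ofReal_div hi' M
  have a12 : AEMeasurable (fun p : Plane × Plane =>
      ENNReal.ofReal (ρ p.1 / M) * ENNReal.ofReal (σ p.2 / M)) (volume.prod volume) :=
    a1.comp_fst.mul a2.comp_snd
  rw [densityMeasure, densityMeasure, prod_withDensity₀ a1 a2,
    integral_withDensity_eq_integral_toReal_smul₀ a12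
      (ae_of_all _ fun _ => ENNReal.mul_lt_top ENNReal.ofReal_lt_top ENNReal.ofReal_lt_top),
    ← integral_const_mul]
  refine integral_congr_ae ?_
  have n1 : ∀ᵐ p : Plane × Plane, 0 ≤ ρ p.1 := Measure.quasiMeasurePreserving_fst.ae h0
  have n2 : ∀ᵐ p : Plane × Plane, 0 ≤ σ p.2 := Measure.quasiMeasurePreserving_snd.ae h0'
  rw [← Measure.volume_eq_prod]
  filter_upwards [n1, n2] with p p1 p2
  rw [ENNReal.toReal_mul, ENNReal.toReal_ofReal (div_nonneg p1 hM.le),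
    ENNReal.toReal_ofReal (div_nonneg p2 hM.le), smul_eq_mul]
  ring

/-- Weak convergence of densities is inherited by their tensor products. -/
lemma tendsto_integral_prod {ρ σ : ℕ → Plane → ℝ} {ρ₀ : Plane → ℝ} {M : ℝ} (hM : 0 < M)
    (hρi : ∀ n, Integrable (ρ n)) (hρ0 : ∀ n, ∀ᵐ x, 0 ≤ ρ n x) (hρm : ∀ n, ∫ x, ρ n x = M)
    (hσi : ∀ n, Integrable (σ n)) (hσ0 : ∀ n, ∀ᵐ x, 0 ≤ σ n x) (hσm : ∀ n, ∫ x, σ n x = M)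
    (hi : Integrable ρ₀) (h0 : ∀ᵐ x, 0 ≤ ρ₀ x) (hm : ∫ x, ρ₀ x = M)
    (hρ : ∀ g : BoundedContinuousFunction Plane ℝ,
      Tendsto (fun n => ∫ x, ρ n x * g x) atTop (𝓝 (∫ x, ρ₀ x * g x)))
    (hσ : ∀ g : BoundedContinuousFunction Plane ℝ,
      Tendsto (fun n => ∫ x, σ n x * g x) atTop (𝓝 (∫ x, ρ₀ x * g x)))
    (F : BoundedContinuousFunction (Plane × Plane) ℝ) :
    Tendsto (fun n => ∫ p : Plane × Plane, ρ n p.1 * σ n p.2 * F p) atTop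
      (𝓝 (∫ p : Plane × Plane, ρ₀ p.1 * ρ₀ p.2 * F p)) := by
  set P : ℕ → ProbabilityMeasure Plane := fun n =>
    ⟨densityMeasure M (ρ n), isProbabilityMeasure_densityMeasure hM (hρi n) (hρ0 n) (hρm n)⟩ with hP
  set R : ℕ → ProbabilityMeasure Plane := fun n =>
    ⟨densityMeasure M (σ n), isProbabilityMeasure_densityMeasure hM (hσi n) (hσ0 n) (hσm n)⟩ with hR
  set P₀ : ProbabilityMeasure Plane :=
    ⟨densityMeasure M ρ₀, isProbabilityMeasure_densityMeasure hM hi h0 hm⟩ with hP₀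
  have tP : Tendsto P atTop (𝓝 P₀) := by
    rw [ProbabilityMeasure.tendsto_iff_forall_integral_tendsto]
    intro g
    simp only [hP, hP₀, ProbabilityMeasure.coe_mk]
    simp only [integral_densityMeasure hM (hρi _) (hρ0 _), integral_densityMeasure hM hi h0]
    exact (hρ g).const_mul _
  have tR : Tendsto R atTop (𝓝 P₀) := by
    rw [ProbabilityMeasure.tendsto_iff_forall_integral_tendsto]
    intro g
    simp only [hR, hP₀, ProbabilityMeasure.coe_mk]
    simp only [integral_densityMeasure hM (hσi _) (hσ0 _), integral_densityMeasure hM hi h0]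
    exact (hσ g).const_mul _
  have t := (ProbabilityMeasure.continuous_prod.tendsto (P₀, P₀)).comp (tP.prodMk_nhds tR)
  rw [ProbabilityMeasure.tendsto_iff_forall_integral_tendsto] at t
  have t' : Tendsto (fun n => ∫ p, F p ∂((densityMeasure M (ρ n)).prod (densityMeasure M (σ n))))
      atTop (𝓝 (∫ p, F p ∂((densityMeasure M ρ₀).prod (densityMeasure M ρ₀)))) := t F
  simp only [integral_prod_densityMeasure hM (hρi _) (hρ0 _) (hσi _) (hσ0 _),
    integral_prod_densityMeasure hM hi h0 hi h0] at t'
  have t2 := t'.const_mul (M ^ 2)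
  have hM2 : M ^ 2 ≠ 0 := by positivity
  simpa only [mul_inv_cancel_left₀ hM2] using t2

/-- The bounded continuous part `1/max(|x - y|, r)` of the Coulomb kernel. -/
def farKernel (r : ℝ) (hr : 0 < r) : BoundedContinuousFunction (Plane × Plane) ℝ :=
  BoundedContinuousFunction.ofNormedAddCommGroup (fun p => 1 / max ‖p.1 - p.2‖ r)
    (continuous_const.div (by fun_prop) fun p => (hr.trans_le (le_max_right _ _)).ne') (1 / r)
    fun p => by
      rw [Real.norm_of_nonneg (by positivity)]
      exact one_div_le_one_div_of_le hr (le_max_right _ _)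

/-- Replacing the Coulomb kernel by its bounded part changes the potential energy by at most
`O(r^{1/3})`, uniformly for densities bounded in `L^{3/2}`. -/
lemma IsDensity.interaction_sub_far_le {ρ σ : Plane → ℝ} {M S : ℝ} (hρ : IsDensity ρ M S)
    (hσ : IsDensity σ M S) {r : ℝ} (hr : 0 < r) :
    |interaction ρ σ - ∫ p : Plane × Plane, ρ p.1 * σ p.2 * farKernel r hr p| ≤
      2 * S * (S + 4 * Real.pi) * r ^ (1 / 3 : ℝ) := by
  have hτ : 0 < r ^ (1 / 3 : ℝ) := by positivity
  obtain ⟨h1, h2⟩ := hρ.near_le hσ hr hτ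
  have hi := hρ.integrable_interaction hσ
  have hf : Integrable (fun p : Plane × Plane => ρ p.1 * σ p.2 * farKernel r hr p) :=
    (hρ.integrable.mul_prod hσ.integrable).mul_bdd
      (farKernel r hr).continuous.aestronglyMeasurable
      (ae_of_all _ fun p => (farKernel r hr).norm_coe_le_norm p)
  have n1 : ∀ᵐ p : Plane × Plane, 0 ≤ ρ p.1 := Measure.quasiMeasurePreserving_fst.ae hρ.nonneg
  have n2 : ∀ᵐ p : Plane × Plane, 0 ≤ σ p.2 := Measure.quasiMeasurePreserving_snd.ae hσ.nonneg
  have e : (r ^ (1 / 3 : ℝ)) ^ (-(1 / 2) : ℝ) * (4 * Real.pi * r ^ (1 / 2 : ℝ)) =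
      4 * Real.pi * r ^ (1 / 3 : ℝ) := by
    rw [← Real.rpow_mul hr.le, mul_left_comm, ← Real.rpow_add hr]
    norm_num
  unfold interaction
  rw [← integral_sub hi hf]
  calc _ ≤ ∫ p : Plane × Plane, ‖ρ p.1 * σ p.2 / ‖p.1 - p.2‖ - ρ p.1 * σ p.2 * farKernel r hr p‖ :=
        norm_integral_le_integral_norm _
    _ = ∫ p : Plane × Plane, ρ p.1 * σ p.2 * nearKernel r (p.1 - p.2) := by
        refine integral_congr_ae ?_
        filter_upwards [n1, n2] with p p1 p2
        rw [div_eq_mul_one_div, ← mul_sub, norm_mul, Real.norm_of_nonneg (mul_nonneg p1 p2)]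
        rfl
    _ ≤ _ := h2
    _ = _ := by rw [e]; ring

lemma tendsto_interaction {ρ σ : ℕ → Plane → ℝ} {ρ₀ : Plane → ℝ} {M S : ℝ} (hM : 0 < M)
    (hρd : ∀ n, IsDensity (ρ n) M S) (hρm : ∀ n, ∫ x, ρ n x = M)
    (hσd : ∀ n, IsDensity (σ n) M S) (hσm : ∀ n, ∫ x, σ n x = M)
    (hd : IsDensity ρ₀ M S) (hm : ∫ x, ρ₀ x = M)
    (hρ : ∀ g : BoundedContinuousFunction Plane ℝ,
      Tendsto (fun n => ∫ x, ρ n x * g x) atTop (𝓝 (∫ x, ρ₀ x * g x)))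
    (hσ : ∀ g : BoundedContinuousFunction Plane ℝ,
      Tendsto (fun n => ∫ x, σ n x * g x) atTop (𝓝 (∫ x, ρ₀ x * g x))) :
    Tendsto (fun n => interaction (ρ n) (σ n)) atTop (𝓝 (interaction ρ₀ ρ₀)) := by
  rw [Metric.tendsto_atTop]
  intro ε hε
  have hlim : Tendsto (fun r : ℝ => 2 * S * (S + 4 * Real.pi) * r ^ (1 / 3 : ℝ)) (𝓝[>] 0) (𝓝 0) := by
    have h1 : Tendsto (fun r : ℝ => 2 * S * (S + 4 * Real.pi) * r ^ (1 / 3 : ℝ)) (𝓝 0)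
        (𝓝 (2 * S * (S + 4 * Real.pi) * 0 ^ (1 / 3 : ℝ))) :=
      ((Real.continuousAt_rpow_const 0 _ (Or.inr (by positivity))).tendsto).const_mul _
    rw [Real.zero_rpow (by positivity), mul_zero] at h1
    exact h1.mono_left nhdsWithin_le_nhds
  obtain ⟨r, hr1, hr0⟩ := ((hlim.eventually (gt_mem_nhds (show 0 < ε / 3 by positivity))).and
    (self_mem_nhdsWithin : Set.Ioi (0 : ℝ) ∈ 𝓝[>] 0)).exists
  have hr : 0 < r := hr0
  have t := tendsto_integral_prod hM (fun n => (hρd n).integrable) (fun n => (hρd n).nonneg) hρm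
    (fun n => (hσd n).integrable) (fun n => (hσd n).nonneg) hσm hd.integrable hd.nonneg hm hρ hσ
    (farKernel r hr)
  obtain ⟨N, hN⟩ := Metric.tendsto_atTop.1 t (ε / 3) (by positivity)
  refine ⟨N, fun n hn => ?_⟩
  have n1 := hN n hn
  rw [Real.dist_eq] at n1 ⊢
  have b1 := (hρd n).interaction_sub_far_le (hσd n) hr
  have b2 := hd.interaction_sub_far_le hd hr
  have b3 := abs_sub_le (interaction (ρ n) (σ n))
    (∫ p : Plane × Plane, ρ n p.1 * σ n p.2 * farKernel r hr p) (interaction ρ₀ ρ₀)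
  have b4 := abs_sub_le (∫ p : Plane × Plane, ρ n p.1 * σ n p.2 * farKernel r hr p)
    (∫ p : Plane × Plane, ρ₀ p.1 * ρ₀ p.2 * farKernel r hr p) (interaction ρ₀ ρ₀)
  rw [abs_sub_comm (∫ p : Plane × Plane, ρ₀ p.1 * ρ₀ p.2 * farKernel r hr p)] at b4
  linarith

lemma rho_sub {f g : Phase → ℝ} (hf : Integrable f) (hg : Integrable g) :
    ∀ᵐ x, rho (f - g) x = rho f x - rho g x := by
  filter_upwards [Integrable.prod_right_ae (μ := (volume : Measure Plane)) hf,
    Integrable.prod_right_ae (μ := (volume : Measure Plane)) hg] with x h1 h2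
  exact integral_sub h1 h2

/-- The potential energy of a difference, by bilinearity. -/
lemma Epot_sub {f g : Phase → ℝ} (hf : Integrable f) (hg : Integrable g) {M S : ℝ}
    (df : IsDensity (rho f) M S) (dg : IsDensity (rho g) M S) :
    EpotFinite (f - g) ∧ Epot (f - g) = -(1 / 2) * (interaction (rho f) (rho f) -
      2 * interaction (rho f) (rho g) + interaction (rho g) (rho g)) := by
  have hs := rho_sub hf hg
  have n1 : ∀ᵐ p : Plane × Plane, rho (f - g) p.1 = rho f p.1 - rho g p.1 :=
    Measure.quasiMeasurePreserving_fst.ae hs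
  have n2 : ∀ᵐ p : Plane × Plane, rho (f - g) p.2 = rho f p.2 - rho g p.2 :=
    Measure.quasiMeasurePreserving_snd.ae hs
  have i11 := df.integrable_interaction df
  have i12 := df.integrable_interaction dg
  have i21 := dg.integrable_interaction df
  have i22 := dg.integrable_interaction dg
  have he : (fun p : Plane × Plane => rho (f - g) p.1 * rho (f - g) p.2 / ‖p.1 - p.2‖) =ᵐ[volume]
      ((fun p : Plane × Plane => rho f p.1 * rho f p.2 / ‖p.1 - p.2‖) -
        fun p : Plane × Plane => rho f p.1 * rho g p.2 / ‖p.1 - p.2‖) -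
      ((fun p : Plane × Plane => rho g p.1 * rho f p.2 / ‖p.1 - p.2‖) -
        fun p : Plane × Plane => rho g p.1 * rho g p.2 / ‖p.1 - p.2‖) := by
    filter_upwards [n1, n2] with p p1 p2
    rw [p1, p2]
    simp only [Pi.sub_apply]
    ring
  have hfin : EpotFinite (f - g) := ((i11.sub i12).sub (i21.sub i22)).congr he.symm
  refine ⟨hfin, ?_⟩
  rw [Epot_eq_interaction hfin]
  have e : interaction (rho (f - g)) (rho (f - g)) =
      (interaction (rho f) (rho f) - interaction (rho f) (rho g)) -
        (interaction (rho g) (rho f) - interaction (rho g) (rho g)) := by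
    unfold interaction
    rw [integral_congr_ae he, integral_sub' (i11.sub i12) (i21.sub i22), integral_sub' i11 i12,
      integral_sub' i21 i22]
  rw [e, interaction_comm (rho g) (rho f)]
  ring

/-! ### Properties of the weak limit -/

section Limit

variable {Q : ℝ → ℝ} {C₁ C₂ F₀ μ₁ μ₂ μ₃ : ℝ}

/-- Weak lower semicontinuity of `P`. The integrand is convex in `f`, and the tangent inequality at
the limit is integrated over the sets where position, velocity and limit are bounded. -/
lemma CasimirAssumptions.posPart_le_of_weak (hQ : CasimirAssumptions Q C₁ C₂ F₀ μ₁ μ₂ μ₃) {M : ℝ}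
    {u : ℕ → Phase → ℝ} {u₀ : Phase → ℝ} (hu : ∀ n, u n ∈ massClass Q M)
    (hm : StronglyMeasurable u₀) (h2 : MemLp u₀ 2) (hw : WeakTendstoL2 volume u u₀) {L : ℕ → ℝ}
    {ℓ : ℝ} (hL : ∀ n, posPart Q (u n) ≤ L n) (hLl : Tendsto L atTop (𝓝 ℓ)) :
    Integrable (fun z : Phase => ‖z.2‖ ^ 2 * u₀ z) ∧ Integrable (fun z => Q (u₀ z)) ∧
      posPart Q u₀ ≤ ℓ := by
  have h0 : ∀ᵐ z, 0 ≤ u₀ z := hw.nonneg (fun n => (hu n).2.1) h2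
  set E : ℕ → Set Phase := fun k => Metric.ball 0 k ∩ {z | u₀ z ≤ k} with hE
  have hEm : ∀ k, MeasurableSet (E k) := fun k =>
    Metric.isOpen_ball.measurableSet.inter (measurableSet_le hm.measurable measurable_const)
  have hEμ : ∀ k, volume (E k) < ⊤ := fun k =>
    (measure_mono Set.inter_subset_left).trans_lt measure_ball_lt_top
  have hEc : AECover volume atTop E := by
    refine ⟨ae_of_all _ fun z => ?_, hEm⟩
    obtain ⟨k, hk⟩ := exists_nat_gt (max ‖z‖ (u₀ z))
    filter_upwards [eventually_ge_atTop k] with j hj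
    have hj' : (k : ℝ) ≤ j := by exact_mod_cast hj
    constructor
    · rw [mem_ball_zero_iff]; exact (le_max_left _ _).trans_lt (hk.trans_le hj')
    · exact (le_max_right ‖z‖ _).trans (hk.le.trans hj')
  -- The density of `P`, and its derivative with respect to `f` at the limit.
  set h : Phase → ℝ → ℝ := fun z s => 1 / 2 * (‖z.2‖ ^ 2 * s) + Q s with hh
  set G : Phase → ℝ := fun z => 1 / 2 * ‖z.2‖ ^ 2 + derivWithin Q (Set.Ici 0) (max (u₀ z) 0) with hG
  have hGm : Measurable G := by
    refine (by fun_prop : Measurable fun z : Phase => 1 / 2 * ‖z.2‖ ^ 2).add ?_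
    exact hQ.continuous_deriv_comp_max.measurable.comp hm.measurable
  have hv : ∀ {k : ℕ} {z : Phase}, z ∈ E k → ‖z.2‖ ≤ k := fun {k z} hz => by
    have := hz.1
    rw [mem_ball_zero_iff] at this
    exact (norm_snd_le z).trans this.le
  have hGb : ∀ k : ℕ, ∃ C, ∀ z ∈ E k, |G z| ≤ C := by
    intro k
    obtain ⟨C, hC⟩ := (isCompact_Icc (a := (0 : ℝ)) (b := k)).exists_bound_of_continuousOn
      hQ.continuous_deriv_comp_max.continuousOn
    refine ⟨1 / 2 * (k : ℝ) ^ 2 + C, fun z hz => ?_⟩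
    refine (abs_add_le _ _).trans (add_le_add ?_ ?_)
    · rw [abs_of_nonneg (by positivity)]
      have := hv hz
      gcongr
    · have := hC (max (u₀ z) 0) ⟨le_max_right _ _, max_le hz.2 (Nat.cast_nonneg k)⟩
      rwa [max_eq_left (le_max_right (u₀ z) 0)] at this
  have hh0 : ∀ {w : Phase → ℝ}, (∀ᵐ z, 0 ≤ w z) → ∀ᵐ z, 0 ≤ h z (w z) := fun {w} hw0 => by
    filter_upwards [hw0] with z hz
    have := hQ.nonneg _ hz
    simp only [hh]
    positivity
  have hhm : AEStronglyMeasurable (fun z => h z (u₀ z)) := by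
    refine AEStronglyMeasurable.add ?_ (hQ.aestronglyMeasurable_comp hm.aestronglyMeasurable h0)
    exact ((by fun_prop : Measurable fun z : Phase => ‖z.2‖ ^ 2).mul
      hm.measurable).aestronglyMeasurable.const_mul _
  have hhi : ∀ k, IntegrableOn (fun z => h z (u₀ z)) (E k) := by
    intro k
    have hfin : IsFiniteMeasure (volume.restrict (E k)) := ⟨by simpa using hEμ k⟩
    obtain ⟨C, hC⟩ := (isCompact_Icc (a := (0 : ℝ)) (b := k)).exists_bound_of_continuousOn
      hQ.continuous_comp_max.continuousOn
    refine Integrable.of_bound hhm.restrict (1 / 2 * ((k : ℝ) ^ 2 * k) + C) ?_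
    filter_upwards [self_mem_ae_restrict (hEm k), ae_restrict_of_ae h0] with z hz hz0
    refine (abs_add_le _ _).trans (add_le_add ?_ ?_)
    · rw [abs_of_nonneg (by positivity)]
      have := hv hz
      have : u₀ z ≤ k := hz.2
      gcongr
    · have := hC (u₀ z) ⟨hz0, hz.2⟩
      rwa [max_eq_left hz0] at this
  have hun : ∀ n, Integrable (fun z => h z (u n z)) := fun n =>
    ((hu n).2.2.2.1.const_mul _).add (hu n).2.2.2.2
  have hun' : ∀ n, ∫ z, h z (u n z) = posPart Q (u n) := fun n => by
    simp only [hh, posPart, Ekin, casimir]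
    rw [integral_add ((hu n).2.2.2.1.const_mul _) (hu n).2.2.2.2, integral_const_mul]
  have hbound : ∀ k, ∫ z in E k, h z (u₀ z) ≤ ℓ := by
    intro k
    obtain ⟨C, hC⟩ := hGb k
    have t := hw.setIntegral (hEm k) (hEμ k) hGm.aestronglyMeasurable hC
    have hGi : ∀ {w : Phase → ℝ}, MemLp w 2 → IntegrableOn (fun z => w z * G z) (E k) := by
      intro w hw2
      refine (integrableOn_of_memLp_two hw2 (hEμ k)).mul_bdd (c := C)
        hGm.aestronglyMeasurable.restrict ?_
      filter_upwards [self_mem_ae_restrict (hEm k)] with z hz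
      exact hC z hz
    have key : ∀ n, (∫ z in E k, h z (u₀ z)) +
        ((∫ z in E k, u n z * G z) - ∫ z in E k, u₀ z * G z) ≤ L n := by
      intro n
      have hn2 : MemLp (u n) 2 :=
        (memLp_two_iff_integrable_sq (hu n).1.aestronglyMeasurable).2 (hQ.integrable_sq (hu n))
      rw [← integral_sub' (hGi hn2) (hGi h2), ← integral_add' (hhi k) ((hGi hn2).sub (hGi h2))]
      calc _ ≤ ∫ z in E k, h z (u n z) := by
            refine integral_mono_ae ((hhi k).add ((hGi hn2).sub (hGi h2))) (hun n).integrableOn ?_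
            filter_upwards [ae_restrict_of_ae h0, ae_restrict_of_ae (hu n).2.1] with z z0 z1
            have := hQ.tangent z0 z1
            simp only [hh, hG, max_eq_left z0, Pi.add_apply, Pi.sub_apply]
            linarith
        _ ≤ ∫ z, h z (u n z) := setIntegral_le_integral (hun n) (hh0 (hu n).2.1)
        _ = posPart Q (u n) := hun' n
        _ ≤ L n := hL n
    have t2 : Tendsto (fun n => (∫ z in E k, h z (u₀ z)) +
        ((∫ z in E k, u n z * G z) - ∫ z in E k, u₀ z * G z)) atTop
        (𝓝 ((∫ z in E k, h z (u₀ z)) + ((∫ z in E k, u₀ z * G z) - ∫ z in E k, u₀ z * G z))) :=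
      (t.sub_const _).const_add _
    rw [sub_self, add_zero] at t2
    exact le_of_tendsto_of_tendsto' t2 hLl key
  obtain ⟨hint, hle⟩ := integrable_of_aecover (hh0 h0) hEc hhi hbound
  have i1 : Integrable (fun z : Phase => ‖z.2‖ ^ 2 * u₀ z) := by
    refine (hint.const_mul 2).mono' ?_ ?_
    · exact ((by fun_prop : Measurable fun z : Phase => ‖z.2‖ ^ 2).mul
        hm.measurable).aestronglyMeasurable
    · filter_upwards [h0] with z hz
      have := hQ.nonneg _ hz
      rw [Real.norm_of_nonneg (by positivity)]
      simp only [hh]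
      linarith
  have i2 : Integrable (fun z => Q (u₀ z)) := by
    refine hint.mono' (hQ.aestronglyMeasurable_comp hm.aestronglyMeasurable h0) ?_
    filter_upwards [h0] with z hz
    have hq := hQ.nonneg _ hz
    rw [Real.norm_of_nonneg hq]
    simp only [hh]
    have : 0 ≤ 1 / 2 * (‖z.2‖ ^ 2 * u₀ z) := by positivity
    linarith
  refine ⟨i1, i2, le_of_eq_of_le ?_ hle⟩
  simp only [hh, posPart, Ekin, casimir]
  rw [integral_add (i1.const_mul _) i2, integral_const_mul]

/-- Axial symmetry passes to weak limits. -/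
lemma axiallySymmetric_of_weak {u : ℕ → Phase → ℝ} {u₀ : Phase → ℝ}
    (hs : ∀ n, AxiallySymmetric (u n)) (h2 : MemLp u₀ 2) (hw : WeakTendstoL2 volume u u₀) :
    AxiallySymmetric u₀ := by
  intro A hA
  set e : Phase ≃ᵐ Phase := (rotation A hA).toHomeomorph.toMeasurableEquiv.prodCongr
    (rotation A hA).toHomeomorph.toMeasurableEquiv with he
  have hmp : MeasurePreserving e volume volume :=
    (rotation A hA).measurePreserving.prod (rotation A hA).measurePreserving
  have hce : ∀ z, e z = (act A z.1, act A z.2) := fun z => rfl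
  have h2' : MemLp (u₀ ∘ e) 2 := h2.comp_measurePreserving hmp
  have hgoal : u₀ ∘ e =ᵐ[volume] u₀ := by
    refine ae_eq_of_forall_setIntegral_eq_of_sigmaFinite
      (fun E _ hμ => integrableOn_of_memLp_two h2' hμ)
      (fun E _ hμ => integrableOn_of_memLp_two h2 hμ) fun E hE hμ => ?_
    -- The integral over `E` of a composition with the rotation is the integral over its image.
    have himg : ∀ w : Phase → ℝ, ∫ z in E, w (e z) = ∫ z in e.symm ⁻¹' E, w z := by
      intro w
      have := hmp.setIntegral_preimage_emb e.measurableEmbedding w (e.symm ⁻¹' E)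
      rw [← this]
      congr 2
      ext z
      simp
    have hE' : MeasurableSet (e.symm ⁻¹' E) := e.symm.measurable hE
    have hμ' : volume (e.symm ⁻¹' E) < ⊤ := by
      rw [(hmp.symm e).measure_preimage hE.nullMeasurableSet]
      exact hμ
    have t1 := hw.setIntegral_one hE hμ
    have t2 := hw.setIntegral_one hE' hμ'
    simp only [Function.comp]
    rw [himg]
    refine tendsto_nhds_unique (t2.congr fun n => ?_) t1
    rw [← himg]
    refine integral_congr_ae (ae_restrict_of_ae ?_)
    filter_upwards [hs n A hA] with z hz
    rw [hce, hz]
  filter_upwards [hgoal] with z hz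
  exact hz

end Limit

/-! ### Minimizing sequences -/

section Minimizing

variable {Q : ℝ → ℝ} {C₁ C₂ F₀ μ₁ μ₂ μ₃ : ℝ}

/-- The mass outside of discs depends continuously on the radius, so that every smaller mass is
attained. -/
lemma exists_outer_mass_eq {ρ : Plane → ℝ} (hρ : Integrable ρ) {R m : ℝ}
    (hm : 0 < m) (hR : m ≤ ∫ x in {x : Plane | R < ‖x‖}, ρ x) :
    ∃ R', R ≤ R' ∧ ∫ x in {x : Plane | R' < ‖x‖}, ρ x = m := by
  set F : ℝ → Plane → ℝ := fun r => {x : Plane | r < ‖x‖}.indicator ρ with hF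
  set Λ : ℝ → ℝ := fun r => ∫ x in {x : Plane | r < ‖x‖}, ρ x with hΛ
  have hΛF : ∀ r, Λ r = ∫ x, F r x := fun r => (integral_indicator (measurableSet_lt_norm r)).symm
  have hFm : ∀ r, AEStronglyMeasurable (F r) volume := fun r =>
    hρ.aestronglyMeasurable.indicator (measurableSet_lt_norm r)
  have hFb : ∀ r x, ‖F r x‖ ≤ ‖ρ x‖ := fun r x => norm_indicator_le_norm_self _ _
  have hcont : Continuous Λ := by
    rw [funext hΛF, continuous_iff_continuousAt]
    intro r₀
    refine continuousAt_of_dominated (Eventually.of_forall hFm)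
      (Eventually.of_forall fun r => ae_of_all _ (hFb r)) hρ.norm ?_
    filter_upwards [ae_norm_ne r₀] with x hx
    rcases lt_or_gt_of_ne hx with h | h
    · refine (continuousAt_const (y := (0 : ℝ))).congr ?_
      filter_upwards [lt_mem_nhds h] with r hr
      exact (Set.indicator_of_notMem (s := {x : Plane | r < ‖x‖}) (not_lt.2 hr.le) ρ).symm
    · refine (continuousAt_const (y := ρ x)).congr ?_
      filter_upwards [gt_mem_nhds h] with r hr
      exact (Set.indicator_of_mem (s := {x : Plane | r < ‖x‖}) hr ρ).symm
  have hlim : Tendsto Λ atTop (𝓝 0) := by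
    have := tendsto_integral_filter_of_dominated_convergence (l := atTop) (F := F)
      (f := fun _ => (0 : ℝ)) (fun x => ‖ρ x‖) (Eventually.of_forall hFm)
      (Eventually.of_forall fun r => ae_of_all _ (hFb r)) hρ.norm
      (ae_of_all _ fun x => by
        refine tendsto_const_nhds.congr' ?_
        filter_upwards [eventually_ge_atTop ‖x‖] with r hr
        exact (Set.indicator_of_notMem (s := {x : Plane | r < ‖x‖}) (not_lt.2 hr) ρ).symm)
    rw [integral_zero] at this
    exact this.congr fun r => (hΛF r).symm
  obtain ⟨r, hr, hRr⟩ := ((hlim.eventually (gt_mem_nhds hm)).and (eventually_ge_atTop R)).exists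
  obtain ⟨R', hR', h⟩ := intermediate_value_Icc' hRr hcont.continuousOn
    (show m ∈ Set.Icc (Λ r) (Λ R) from ⟨hr.le, hR⟩)
  exact ⟨R', hR'.1, h⟩

/-- Beyond the radius `R_M`, the outer mass of a density is controlled by its excess energy. If more
than half of the mass were outside, then the splitting estimate at the larger radius that halves the
mass would give a fixed excess. -/
lemma CasimirAssumptions.exists_outer_mass_le (hQ : CasimirAssumptions Q C₁ C₂ F₀ μ₁ μ₂ μ₃)
    {M : ℝ} (hM : 0 < M) {Cα CM : ℝ} (hsplit : AreSplittingConstants Q M Cα CM) {R : ℝ}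
    (hR : radius Q M Cα CM < R) : ∃ κ, 0 < κ ∧ ∀ f ∈ symMassClass Q M,
      energyCasimir Q f - symInf Q M < κ * (M / 2) →
        ∫ x in {x : Plane | R < ‖x‖}, rho f x ≤ (energyCasimir Q f - symInf Q M) / κ := by
  obtain ⟨hα, hCM, hsp⟩ := hsplit
  have hd := hQ.symInf_neg hM
  have hCd : 0 < Cα * symInf Q M := mul_pos_of_neg_of_neg hα hd
  set a := Cα * symInf Q M / M ^ 2 with ha
  have ha0 : 0 < a := by positivity
  have hR0 : 0 < R := (sq_nonneg _).trans_lt hR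
  have hsR : 0 < √R := Real.sqrt_pos.2 hR0
  have hlt : CM / √R < a * M / 2 := by
    have h1 : 2 * M * CM / (Cα * symInf Q M) < √R := by
      rw [Real.lt_sqrt (by positivity)]; exact hR
    rw [div_lt_iff₀ hCd] at h1
    rw [div_lt_iff₀ hsR, ha]
    have e : Cα * symInf Q M / M ^ 2 * M / 2 * √R = (√R * (Cα * symInf Q M)) / (2 * M) := by
      field_simp
    rw [e, lt_div_iff₀ (by positivity)]
    linarith
  refine ⟨a * M / 2 - CM / √R, sub_pos.2 hlt, fun f hf hD => ?_⟩
  set κ := a * M / 2 - CM / √R with hκ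
  have hκ0 : 0 < κ := sub_pos.2 hlt
  have hsum : ∀ r, (∫ x in {x : Plane | ‖x‖ < r}, rho f x) +
      ∫ x in {x : Plane | r < ‖x‖}, rho f x = M := fun r => by
    rw [integral_norm_lt_add_lt_norm (integrable_rho hf.1.1), integral_rho hf.1.1, hf.1.2.2.1]
  set l := ∫ x in {x : Plane | R < ‖x‖}, rho f x with hl
  have hl0 : 0 ≤ l := integral_nonneg_of_ae (ae_restrict_of_ae (rho_nonneg hf.1.2.1))
  have hhalf : l ≤ M / 2 := by
    by_contra hcon
    push Not at hcon
    obtain ⟨R', hRR', hR'⟩ := exists_outer_mass_eq (integrable_rho hf.1.1) (half_pos hM) hcon.le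
    have h1 := hsp f hf R' (hR0.trans_le hRR')
    have h2 := hsum R'
    rw [hR'] at h1 h2
    have h3 : (∫ x in {x : Plane | ‖x‖ < R'}, rho f x) = M / 2 := by linarith
    rw [h3] at h1
    have h4 : CM / √R' ≤ CM / √R := by gcongr
    have h5 : κ * (M / 2) ≤ (a * (M / 2) - CM / √R') * (M / 2) := by
      apply mul_le_mul_of_nonneg_right _ (half_pos hM).le
      rw [hκ]; linarith
    linarith
  have h1 := hsp f hf R hR0
  have h2 := hsum R
  rw [← hl] at h1 h2
  rw [le_div_iff₀ hκ0]
  have h3 : (∫ x in {x : Plane | ‖x‖ < R}, rho f x) = M - l := by linarith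
  rw [h3] at h1
  have h4 : l * κ ≤ (a * (M - l) - CM / √R) * l := by
    rw [mul_comm]
    apply mul_le_mul_of_nonneg_right _ hl0
    rw [hκ]; nlinarith
  linarith

lemma CasimirAssumptions.tendsto_outer_mass (hQ : CasimirAssumptions Q C₁ C₂ F₀ μ₁ μ₂ μ₃)
    {M : ℝ} (hM : 0 < M) {Cα CM : ℝ} (hsplit : AreSplittingConstants Q M Cα CM)
    {u : ℕ → Phase → ℝ} (hu : IsMinimizingSeq Q M u) {R : ℝ} (hR : radius Q M Cα CM < R) :
    Tendsto (fun n => ∫ x in {x : Plane | R < ‖x‖}, rho (u n) x) atTop (𝓝 0) := by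
  obtain ⟨κ, hκ, h⟩ := hQ.exists_outer_mass_le hM hsplit hR
  have hlim : Tendsto (fun n => energyCasimir Q (u n) - symInf Q M) atTop (𝓝 0) := by
    have := hu.2.sub_const (symInf Q M)
    rwa [sub_self] at this
  have hlim2 := hlim.div_const κ
  rw [zero_div] at hlim2
  refine tendsto_of_tendsto_of_tendsto_of_le_of_le' tendsto_const_nhds hlim2
    (Eventually.of_forall fun n => integral_nonneg_of_ae
      (ae_restrict_of_ae (rho_nonneg (hu.1 n).1.2.1))) ?_
  filter_upwards [hlim.eventually (gt_mem_nhds (show 0 < κ * (M / 2) by positivity))] with n hn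
  exact h _ (hu.1 n) hn

lemma integral_rho_mul {f : Phase → ℝ} (hf : Integrable f) {g : Plane → ℝ} (hg : Measurable g)
    {G : ℝ} (hG : ∀ x, |g x| ≤ G) : ∫ x, rho f x * g x = ∫ z : Phase, f z * g z.1 := by
  have hi : Integrable (fun z : Phase => f z * g z.1) :=
    hf.mul_bdd (hg.comp measurable_fst).aestronglyMeasurable (ae_of_all _ fun z => hG z.1)
  have := integral_prod (μ := (volume : Measure Plane)) (ν := (volume : Measure Plane)) _ hi
  rw [← Measure.volume_eq_prod] at this
  rw [this]
  simp only [integral_mul_const]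
  rfl

lemma integral_outer_rho {f : Phase → ℝ} (hf : Integrable f) (R : ℝ) :
    ∫ x in {x : Plane | R < ‖x‖}, rho f x =
      ∫ z : Phase, f z * {x : Plane | R < ‖x‖}.indicator (fun _ => (1 : ℝ)) z.1 := by
  have hb : ∀ x : Plane, |{x : Plane | R < ‖x‖}.indicator (fun _ => (1 : ℝ)) x| ≤ 1 := fun x => by
    by_cases h : x ∈ {x : Plane | R < ‖x‖}
    · rw [Set.indicator_of_mem h]; simp
    · rw [Set.indicator_of_notMem h]; simp
  rw [← integral_rho_mul hf (measurable_const.indicator (measurableSet_lt_norm R)) hb,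
    ← integral_indicator (measurableSet_lt_norm R)]
  refine integral_congr_ae (ae_of_all _ fun x => ?_)
  by_cases h : x ∈ {x : Plane | R < ‖x‖}
  · simp only [Set.indicator_of_mem h, mul_one]
  · simp only [Set.indicator_of_notMem h, mul_zero]

/-- Chebyshev's inequality: the mass outside of `{|x| ≤ R, |v| < V}` is at most the mass of the
positions with `|x| > R` and the second velocity moment over `V²`. -/
lemma mass_le_add {f : Phase → ℝ} (hf : Integrable f) (h0 : ∀ᵐ z, 0 ≤ f z)
    (hv : Integrable (fun z : Phase => ‖z.2‖ ^ 2 * f z)) {R V : ℝ} (hV : 0 < V) :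
    ∫ z, f z ≤ (∫ z in Metric.closedBall (0 : Plane) R ×ˢ Metric.ball (0 : Plane) V, f z) +
      (∫ x in {x : Plane | R < ‖x‖}, rho f x) + 2 * Ekin f / V ^ 2 := by
  set E : Set Phase := Metric.closedBall (0 : Plane) R ×ˢ Metric.ball (0 : Plane) V with hE
  have hEm : MeasurableSet E :=
    Metric.isClosed_closedBall.measurableSet.prod Metric.isOpen_ball.measurableSet
  set g : Phase → ℝ := fun z => {x : Plane | R < ‖x‖}.indicator (fun _ => (1 : ℝ)) z.1 with hg
  have hgm : Measurable g :=
    (measurable_const.indicator (measurableSet_lt_norm R)).comp measurable_fst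
  have hg01 : ∀ z, 0 ≤ g z ∧ |g z| ≤ 1 := fun z => by
    by_cases h : z.1 ∈ {x : Plane | R < ‖x‖}
    · simp only [hg, Set.indicator_of_mem h]; simp
    · simp only [hg, Set.indicator_of_notMem h]; simp
  have i1 : Integrable (E.indicator f) := hf.indicator hEm
  have i2 : Integrable (fun z => f z * g z) :=
    hf.mul_bdd hgm.aestronglyMeasurable (ae_of_all _ fun z => (hg01 z).2)
  have i3 : Integrable (fun z : Phase => (V ^ 2)⁻¹ * (‖z.2‖ ^ 2 * f z)) := hv.const_mul _
  have e : (∫ z in E, f z) + (∫ x in {x : Plane | R < ‖x‖}, rho f x) + 2 * Ekin f / V ^ 2 =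
      ∫ z, (E.indicator f + (fun z => f z * g z) +
        fun z : Phase => (V ^ 2)⁻¹ * (‖z.2‖ ^ 2 * f z)) z := by
    rw [integral_add' (i1.add i2) i3, integral_add' i1 i2, integral_indicator hEm,
      integral_outer_rho hf, integral_const_mul]
    simp only [Ekin]
    ring
  rw [e]
  refine integral_mono_ae hf ((i1.add i2).add i3) ?_
  filter_upwards [h0] with z hz
  simp only [Pi.add_apply]
  have n1 : 0 ≤ E.indicator f z := Set.indicator_nonneg (s := E) (f := fun _ => f z) (fun _ _ => hz) z
  have n2 : 0 ≤ f z * g z := mul_nonneg hz (hg01 z).1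
  have n3 : 0 ≤ (V ^ 2)⁻¹ * (‖z.2‖ ^ 2 * f z) := by positivity
  by_cases h1 : R < ‖z.1‖
  · have : g z = 1 := Set.indicator_of_mem (s := {x : Plane | R < ‖x‖}) h1 _
    rw [this, mul_one]
    linarith
  by_cases h2 : ‖z.2‖ < V
  · have : z ∈ E := ⟨by simpa using h1, by simpa using h2⟩
    rw [Set.indicator_of_mem this]
    linarith
  · push Not at h2
    have h3 : V ^ 2 * f z ≤ ‖z.2‖ ^ 2 * f z := by gcongr
    have : f z ≤ (V ^ 2)⁻¹ * (‖z.2‖ ^ 2 * f z) := by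
      rw [le_inv_mul_iff₀ (by positivity)]; exact h3
    linarith

lemma CasimirAssumptions.memLp_and_integral_rpow_le
    (hQ : CasimirAssumptions Q C₁ C₂ F₀ μ₁ μ₂ μ₃) {M : ℝ} {f : Phase → ℝ}
    (hf : f ∈ massClass Q M) : MemLp f (ENNReal.ofReal (1 + 1 / μ₁)) ∧
      ∫ z, f z ^ (1 + 1 / μ₁) ≤ 1 / C₁ * posPart Q f + F₀ ^ (1 / μ₁) * M := by
  have hμ := hQ.μ₁_mem.1
  have hp : 0 < 1 + 1 / μ₁ := by positivity
  have hP : casimir Q f ≤ posPart Q f := le_add_of_nonneg_left (Ekin_nonneg hf.2.1)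
  obtain ⟨h1, h0, hm, -, h4⟩ := hf
  have hi : Integrable (fun z => 1 / C₁ * Q (f z) + F₀ ^ (1 / μ₁) * f z) :=
    (h4.const_mul _).add (h1.const_mul _)
  have hb : ∀ᵐ z, f z ^ (1 + 1 / μ₁) ≤ 1 / C₁ * Q (f z) + F₀ ^ (1 / μ₁) * f z :=
    h0.mono fun z hz => hQ.rpow_le hz
  have hip : Integrable (fun z => f z ^ (1 + 1 / μ₁)) := by
    refine hi.mono' (h1.aestronglyMeasurable.aemeasurable.pow_const _).aestronglyMeasurable ?_
    filter_upwards [h0, hb] with z hz hz2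
    rwa [Real.norm_of_nonneg (Real.rpow_nonneg hz _)]
  constructor
  · rw [← integrable_norm_rpow_iff h1.aestronglyMeasurable (by simpa using hp)
      ENNReal.ofReal_ne_top, ENNReal.toReal_ofReal hp.le]
    refine hip.congr ?_
    filter_upwards [h0] with z hz
    rw [Real.norm_of_nonneg hz]
  · refine (integral_mono_ae hip hi hb).trans ?_
    rw [integral_add (h4.const_mul _) (h1.const_mul _), integral_const_mul, integral_const_mul, hm]
    have : 1 / C₁ * (∫ z, Q (f z)) ≤ 1 / C₁ * posPart Q f := by
      have := hQ.C₁_pos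
      have : (∫ z, Q (f z)) ≤ posPart Q f := hP
      gcongr
    linarith

end Minimizing

/-! ### Weak limits of minimizing sequences -/

section Limits

variable {Q : ℝ → ℝ} {C₁ C₂ F₀ μ₁ μ₂ μ₃ : ℝ}

lemma aecover_phase_ball :
    AECover (volume : Measure Phase) atTop fun k : ℕ => Metric.ball (0 : Phase) k :=
  aecover_ball tendsto_natCast_atTop_atTop

lemma CasimirAssumptions.memLp_two (hQ : CasimirAssumptions Q C₁ C₂ F₀ μ₁ μ₂ μ₃) {M : ℝ}
    {f : Phase → ℝ} (hf : f ∈ massClass Q M) : MemLp f 2 :=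
  (memLp_two_iff_integrable_sq hf.1.aestronglyMeasurable).2 (hQ.integrable_sq hf)

/-- A weak limit of a minimizing sequence is admissible. Its mass is `M`: mass outside of a fixed
disc vanishes in the limit, and few particles have a large velocity. -/
lemma CasimirAssumptions.mem_symMassClass_of_weak
    (hQ : CasimirAssumptions Q C₁ C₂ F₀ μ₁ μ₂ μ₃) {M : ℝ} (hM : 0 < M) {Cα CM : ℝ}
    (hsplit : AreSplittingConstants Q M Cα CM) {u : ℕ → Phase → ℝ} (hu : IsMinimizingSeq Q M u)
    {K : ℝ} (hK : ∀ n, posPart Q (u n) ≤ K) {u₀ : Phase → ℝ} (hm : StronglyMeasurable u₀)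
    (h2 : MemLp u₀ 2) (hw : WeakTendstoL2 volume u u₀) : u₀ ∈ symMassClass Q M := by
  have h0 : ∀ᵐ z, 0 ≤ u₀ z := hw.nonneg (fun n => (hu.1 n).1.2.1) h2
  obtain ⟨hv, hq, -⟩ := hQ.posPart_le_of_weak (fun n => (hu.1 n).1) hm h2 hw hK tendsto_const_nhds
  obtain ⟨hi, hle⟩ := integrable_of_aecover (I := M) h0 aecover_phase_ball
    (fun k => integrableOn_of_memLp_two h2 measure_ball_lt_top) fun k =>
      le_of_tendsto' (hw.setIntegral_one Metric.isOpen_ball.measurableSet measure_ball_lt_top)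
        fun n => (setIntegral_le_integral (hu.1 n).1.1 (hu.1 n).1.2.1).trans (hu.1 n).1.2.2.1.le
  refine ⟨⟨hi, h0, le_antisymm hle ?_, hv, hq⟩,
    axiallySymmetric_of_weak (fun n => (hu.1 n).2) h2 hw⟩
  have hV : ∀ V : ℝ, 0 < V → M ≤ (∫ z, u₀ z) + 2 * K / V ^ 2 := by
    intro V hV
    set R := radius Q M Cα CM + 1 with hR
    set E : Set Phase := Metric.closedBall (0 : Plane) R ×ˢ Metric.ball (0 : Plane) V with hE
    have hEm : MeasurableSet E :=
      Metric.isClosed_closedBall.measurableSet.prod Metric.isOpen_ball.measurableSet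
    have hEμ : volume E < ⊤ := by
      rw [hE, Measure.volume_eq_prod, Measure.prod_prod]
      exact ENNReal.mul_lt_top measure_closedBall_lt_top measure_ball_lt_top
    have hlim := ((hw.setIntegral_one hEm hEμ).add
      (hQ.tendsto_outer_mass hM hsplit hu (lt_add_one _))).add_const (2 * K / V ^ 2)
    have hMle : M ≤ (∫ z in E, u₀ z) + 0 + 2 * K / V ^ 2 := by
      refine ge_of_tendsto' hlim fun n => ?_
      obtain ⟨a1, a0, am, av, -⟩ := (hu.1 n).1
      have h := mass_le_add a1 a0 av (R := R) hV
      have hkin : Ekin (u n) ≤ K :=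
        (le_add_of_nonneg_right (hQ.casimir_nonneg a0)).trans (hK n)
      rw [am] at h
      refine h.trans ?_
      gcongr
    have := setIntegral_le_integral (s := E) hi h0
    linarith
  have hlim : Tendsto (fun n : ℕ => (∫ z, u₀ z) + 2 * K / ((n : ℝ) + 1) ^ 2) atTop
      (𝓝 ((∫ z, u₀ z) + 0)) := by
    refine tendsto_const_nhds.add (Tendsto.div_atTop tendsto_const_nhds ?_)
    exact (tendsto_pow_atTop two_ne_zero).comp
      (tendsto_atTop_add_const_right _ _ tendsto_natCast_atTop_atTop)
  rw [add_zero] at hlim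
  exact ge_of_tendsto' hlim fun n => hV _ (by positivity)

lemma tendsto_bounded_of_weak {M : ℝ} {u : ℕ → Phase → ℝ} (hu : ∀ n, u n ∈ massClass Q M)
    {u₀ : Phase → ℝ} (hu₀ : u₀ ∈ massClass Q M) (hw : WeakTendstoL2 volume u u₀)
    {g : Phase → ℝ} (hg : AEStronglyMeasurable g) {G : ℝ} (hG : ∀ z, |g z| ≤ G) :
    Tendsto (fun n => ∫ z, u n z * g z) atTop (𝓝 (∫ z, u₀ z * g z)) :=
  hw.tendsto_bounded (fun n => (hu n).2.1) hu₀.2.1 (fun n => (hu n).1) hu₀.1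
    (fun n => (hu n).2.2.1) hu₀.2.2.1 aecover_phase_ball (fun _ => measure_ball_lt_top) hg hG

lemma CasimirAssumptions.ae_eq_zero_of_weak
    (hQ : CasimirAssumptions Q C₁ C₂ F₀ μ₁ μ₂ μ₃) {M : ℝ} (hM : 0 < M) {Cα CM : ℝ}
    (hsplit : AreSplittingConstants Q M Cα CM) {u : ℕ → Phase → ℝ} (hu : IsMinimizingSeq Q M u)
    {u₀ : Phase → ℝ} (hu₀ : u₀ ∈ massClass Q M) (hw : WeakTendstoL2 volume u u₀) :
    ∀ᵐ z : Phase, z.1 ∉ Metric.ball (0 : Plane) (radius Q M Cα CM) → u₀ z = 0 := by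
  set r := radius Q M Cα CM with hr
  have hR : ∀ R, r < R → ∀ᵐ z : Phase, R < ‖z.1‖ → u₀ z = 0 := by
    intro R hR
    set g : Phase → ℝ := fun z => {x : Plane | R < ‖x‖}.indicator (fun _ => (1 : ℝ)) z.1 with hg
    have hgm : Measurable g :=
      (measurable_const.indicator (measurableSet_lt_norm R)).comp measurable_fst
    have hg01 : ∀ z, 0 ≤ g z ∧ |g z| ≤ 1 := fun z => by
      by_cases h : z.1 ∈ {x : Plane | R < ‖x‖}
      · simp only [hg, Set.indicator_of_mem h]; simp
      · simp only [hg, Set.indicator_of_notMem h]; simp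
    have l1 := tendsto_bounded_of_weak (fun n => (hu.1 n).1) hu₀ hw hgm.aestronglyMeasurable
      fun z => (hg01 z).2
    have l2 := hQ.tendsto_outer_mass hM hsplit hu hR
    simp only [integral_outer_rho (hu.1 _).1.1] at l2
    have hz := tendsto_nhds_unique l1 l2
    have hi : Integrable (fun z => u₀ z * g z) :=
      hu₀.1.mul_bdd hgm.aestronglyMeasurable (ae_of_all _ fun z => (hg01 z).2)
    rw [integral_eq_zero_iff_of_nonneg_ae
      (hu₀.2.1.mono fun z hz => mul_nonneg hz (hg01 z).1) hi] at hz
    filter_upwards [hz] with z hz hzR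
    have : g z = 1 := Set.indicator_of_mem (s := {x : Plane | R < ‖x‖}) hzR _
    simpa [this] using hz
  have hall : ∀ᵐ z : Phase, ∀ k : ℕ, r + 1 / ((k : ℝ) + 1) < ‖z.1‖ → u₀ z = 0 :=
    ae_all_iff.2 fun k => hR _ (lt_add_of_pos_right _ (by positivity))
  have hne : ∀ᵐ z : Phase, ‖z.1‖ ≠ r := Measure.quasiMeasurePreserving_fst.ae (ae_norm_ne r)
  filter_upwards [hall, hne] with z hz hn hzb
  rw [mem_ball_zero_iff, not_lt] at hzb
  have hlt := lt_of_le_of_ne hzb (Ne.symm hn)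
  obtain ⟨k, hk⟩ := exists_nat_one_div_lt (sub_pos.2 hlt)
  exact hz k (by linarith)

/-- The potential energy is weakly continuous along bounded sequences of fixed mass, also
for the differences to the limit. -/
lemma CasimirAssumptions.tendsto_Epot_of_weak
    (hQ : CasimirAssumptions Q C₁ C₂ F₀ μ₁ μ₂ μ₃) {M : ℝ} (hM : 0 < M) {u : ℕ → Phase → ℝ}
    (hu : ∀ n, u n ∈ massClass Q M) {K : ℝ} (hK : ∀ n, posPart Q (u n) ≤ K) {u₀ : Phase → ℝ}
    (hu₀ : u₀ ∈ massClass Q M) (hw : WeakTendstoL2 volume u u₀) :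
    Tendsto (fun n => Epot (u n)) atTop (𝓝 (Epot u₀)) ∧ (∀ n, EpotFinite (u n - u₀)) ∧
      Tendsto (fun n => Epot (u n - u₀)) atTop (𝓝 0) := by
  obtain ⟨C, -, hC⟩ := hQ.exists_isDensity M one_pos
  set S := max K (posPart Q u₀) + C with hS
  have d : ∀ n, IsDensity (rho (u n)) M S := fun n => (hC _ (hu n)).mono le_rfl (by
    have := le_max_left K (posPart Q u₀)
    linarith [hK n])
  have d₀ : IsDensity (rho u₀) M S := (hC _ hu₀).mono le_rfl (by
    have := le_max_right K (posPart Q u₀)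
    linarith)
  have hm : ∀ n, ∫ x, rho (u n) x = M := fun n => (integral_rho (hu n).1).trans (hu n).2.2.1
  have hm₀ : ∫ x, rho u₀ x = M := (integral_rho hu₀.1).trans hu₀.2.2.1
  have hρ : ∀ g : BoundedContinuousFunction Plane ℝ,
      Tendsto (fun n => ∫ x, rho (u n) x * g x) atTop (𝓝 (∫ x, rho u₀ x * g x)) := by
    intro g
    have hgm := g.continuous.measurable
    have hgb : ∀ x, |g x| ≤ ‖g‖ := g.norm_coe_le_norm
    rw [integral_rho_mul hu₀.1 hgm hgb]
    simp only [integral_rho_mul (hu _).1 hgm hgb]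
    exact tendsto_bounded_of_weak hu hu₀ hw (hgm.comp measurable_fst).aestronglyMeasurable
      fun z => hgb z.1
  have t1 := tendsto_interaction hM d hm d hm d₀ hm₀ hρ hρ
  have t2 := tendsto_interaction hM d hm (fun _ => d₀) (fun _ => hm₀) d₀ hm₀ hρ
    fun _ => tendsto_const_nhds
  refine ⟨?_, fun n => (Epot_sub (hu n).1 hu₀.1 (d n) d₀).1, ?_⟩
  · rw [Epot_eq_interaction (epotFinite_of_isDensity d₀)]
    simp only [Epot_eq_interaction (epotFinite_of_isDensity (d _))]
    exact t1.const_mul _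
  · simp only [fun n => (Epot_sub (hu n).1 hu₀.1 (d n) d₀).2]
    have := ((t1.sub (t2.const_mul 2)).add_const (interaction (rho u₀) (rho u₀))).const_mul
      (-(1 / 2) : ℝ)
    convert this using 2
    ring

lemma CasimirAssumptions.energyCasimir_eq_symInf_of_weak
    (hQ : CasimirAssumptions Q C₁ C₂ F₀ μ₁ μ₂ μ₃) {M : ℝ} {u : ℕ → Phase → ℝ}
    (hu : IsMinimizingSeq Q M u) {u₀ : Phase → ℝ} (hm : StronglyMeasurable u₀)
    (hu₀ : u₀ ∈ symMassClass Q M) (hw : WeakTendstoL2 volume u u₀)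
    (hE : Tendsto (fun n => Epot (u n)) atTop (𝓝 (Epot u₀))) :
    energyCasimir Q u₀ = symInf Q M := by
  refine le_antisymm ?_ (hQ.symInf_le hu₀)
  have := (hQ.posPart_le_of_weak (fun n => (hu.1 n).1) hm (hQ.memLp_two hu₀.1) hw
    (L := fun n => energyCasimir Q (u n) - Epot (u n))
    (fun n => (add_sub_cancel_right _ _).ge) (hu.2.sub hE)).2.2
  unfold energyCasimir
  linarith

lemma CasimirAssumptions.weakTendstoLp_of_weak
    (hQ : CasimirAssumptions Q C₁ C₂ F₀ μ₁ μ₂ μ₃) {M : ℝ} {u : ℕ → Phase → ℝ}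
    (hu : ∀ n, u n ∈ massClass Q M) {K : ℝ} (hK : ∀ n, posPart Q (u n) ≤ K) {u₀ : Phase → ℝ}
    (hu₀ : u₀ ∈ massClass Q M) (hw : WeakTendstoL2 volume u u₀) :
    WeakTendstoLp (1 + 1 / μ₁) u u₀ := by
  have hp1 : 1 < 1 + 1 / μ₁ := lt_add_of_pos_right _ (one_div_pos.2 hQ.μ₁_mem.1)
  have hC₁ := hQ.C₁_pos
  refine ⟨fun k => (hQ.memLp_and_integral_rpow_le (hu k)).1,
    (hQ.memLp_and_integral_rpow_le hu₀).1, fun g hg => ?_⟩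
  refine tendsto_integral_mul_of_bounded (Real.HolderConjugate.conjExponent hp1)
    (fun n => (hu n).2.1) hu₀.2.1 (fun n => (hQ.memLp_and_integral_rpow_le (hu n)).1)
    (hQ.memLp_and_integral_rpow_le hu₀).1
    (B := 1 / C₁ * max K (posPart Q u₀) + F₀ ^ (1 / μ₁) * M)
    (fun n => (hQ.memLp_and_integral_rpow_le (hu n)).2.trans ?_)
    ((hQ.memLp_and_integral_rpow_le hu₀).2.trans ?_)
    (fun g hg ⟨G, hG⟩ => tendsto_bounded_of_weak hu hu₀ hw hg hG) hg
  · gcongr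
    exact (hK n).trans (le_max_left _ _)
  · gcongr
    exact le_max_right _ _

end Limits

end FlatVP

end

open FlatVP in
theorem theorem1 (Q : ℝ → ℝ) (C₁ C₂ F₀ μ₁ μ₂ μ₃ : ℝ)
    (hQ : CasimirAssumptions Q C₁ C₂ F₀ μ₁ μ₂ μ₃) (M : ℝ) (hM : 0 < M) :
    -- the energy-Casimir functional is well defined, its infimum is finite and negative
    (∀ f ∈ symMassClass Q M, EpotFinite f) ∧
    BddBelow (energyCasimir Q '' symMassClass Q M) ∧
    symInf Q M < 0 ∧
    -- the constants that define the radius exist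
    (∃ Cα, IsAlphaConstant μ₃ Cα) ∧
    (∀ Cα, IsAlphaConstant μ₃ Cα → ∃ CM, AreSplittingConstants Q M Cα CM) ∧
    -- for every choice of them, the assertion on minimizing sequences holds
    ∀ Cα CM, AreSplittingConstants Q M Cα CM →
      ∀ f : ℕ → Phase → ℝ, IsMinimizingSeq Q M f →
        ∃ f₀ ∈ symMassClass Q M, ∃ φ : ℕ → ℕ, StrictMono φ ∧
          energyCasimir Q f₀ = symInf Q M ∧
          (∀ g ∈ symMassClass Q M, energyCasimir Q f₀ ≤ energyCasimir Q g) ∧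
          (∀ᵐ z : Phase, z.1 ∉ Metric.ball (0 : Plane) (radius Q M Cα CM) → f₀ z = 0) ∧
          WeakTendstoLp (1 + 1 / μ₁) (fun k => f (φ k)) f₀ ∧
          (∀ k, EpotFinite (f (φ k) - f₀)) ∧
          Tendsto (fun k => Epot (f (φ k) - f₀)) atTop (𝓝 0) := by
  refine ⟨fun f hf => hQ.epotFinite hf.1, hQ.bddBelow M, hQ.symInf_neg hM,
    hQ.exists_isAlphaConstant, fun Cα hα => hQ.exists_splitting hM hα, ?_⟩
  intro Cα CM hsplit f hf
  obtain ⟨C, hC⟩ := hQ.exists_posPart_le M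
  obtain ⟨B, hB⟩ := hf.2.bddAbove_range
  have hK : ∀ n, posPart Q (f n) ≤ 2 * B + C := fun n => by
    have h1 := hC _ (hf.1 n).1
    have h2 : energyCasimir Q (f n) ≤ B := hB ⟨n, rfl⟩
    linarith
  obtain ⟨C', hC'⟩ := hQ.exists_integral_sq_le M one_pos
  have hsq : ∀ n, ∫ z, f n z ^ 2 ≤ 2 * B + C + C' := fun n => by
    have h1 := hC' _ (hf.1 n).1
    have h2 : casimir Q (f n) ≤ posPart Q (f n) :=
      le_add_of_nonneg_left (Ekin_nonneg (hf.1 n).1.2.1)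
    linarith [hK n]
  obtain ⟨f₀, hm, h2, φ, hφ, hw⟩ :=
    exists_weakTendstoL2 (fun n => hQ.memLp_two (hf.1 n).1) hsq
  have hu : IsMinimizingSeq Q M fun k => f (φ k) :=
    ⟨fun k => hf.1 _, hf.2.comp hφ.tendsto_atTop⟩
  have hu' : ∀ k, f (φ k) ∈ massClass Q M := fun k => (hf.1 _).1
  have hKφ : ∀ k, posPart Q (f (φ k)) ≤ 2 * B + C := fun k => hK _
  have hf₀ := hQ.mem_symMassClass_of_weak hM hsplit hu hKφ hm h2 hw
  obtain ⟨t1, t2, t3⟩ := hQ.tendsto_Epot_of_weak hM hu' hKφ hf₀.1 hw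
  have hmin := hQ.energyCasimir_eq_symInf_of_weak hu hm hf₀ hw t1
  exact ⟨f₀, hf₀, φ, hφ, hmin, fun g hg => hmin.trans_le (hQ.symInf_le hg),
    hQ.ae_eq_zero_of_weak hM hsplit hu hf₀.1 hw, hQ.weakTendstoLp_of_weak hu' hKφ hf₀.1 hw, t2, t3⟩
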